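/- For $n\ge 1$ let $\mathbb T_n$ be the set of combinatorial trees without degree-2 vertices that have one degree-1 vertex called the root and exactly $n$ further degree-1 vertices, called leaves, labelled by $[n]=\{1,\ldots,n\}$; the other vertices are called branch points, and all edges are directed away from the root. Let $0\le\alpha\le 1$ and $0\le\gamma\le\alpha$. The alpha-gamma trees $(T_n,n\ge 1)$ are random trees $T_n\in\mathbb T_n$ grown as follows. $T_1$ and $T_2$ are the unique elements of $\mathbb T_1$ and $\mathbb T_2$. Given $T_n$, $n\ge 2$, assign weight $1-\alpha$ to each edge adjacent to a leaf, weight $\gamma$ to each other edge, and weight $(k-1)\alpha-\gamma$ to each branch point of degree $k+1\ge 3$; select an edge or a branch point with probability proportional to its weight. If an edge $a\to c$ is selected, replace it by the three edges $a\to b$, $b\to c$, $b\to n+1$, where $b$ is a new branch point and $n+1$ a new leaf; if a branch point $v$ is selected, add an edge $v\to n+1$ to a new leaf $n+1$. The result is $T_{n+1}$. Write $T_n^\circ$ for the delabelled tree, i.e. the class of $T_n$ modulo relabelling of the leaves. The subtrees of an unlabelled tree with $n\ge 2$ leaves are the tree components above the branch point adjacent to the root; if they have $n_1\ge\cdots\ge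 n_k\ge 1$ leaves, then $(n_1,\ldots,n_k)$ is the first split of the tree, and the tree is said to be formed by joining its subtrees together. (a) The sequence $(T_n^\circ,n\ge 1)$ has the Markov branching property: for every $n\ge 2$, $T_n^\circ$ has the same distribution as the tree formed by joining together $S_1^\circ,\ldots,S_K^\circ$, where $N_1\ge\cdots\ge N_K\ge 1$ are the parts of a random partition of the integer $n$ into $K\ge 2$ parts and, conditionally given $K=k$ and $N_j=n_j$, $j\in[k]$, the trees $S_j^\circ$ are independent and distributed as $T_{n_j}^\circ$, $j\in[k]$. If $\alpha<1$, the splitting rule, i.e. the probability function of the first split of $T_n^\circ$, $n\ge 2$, is $$q^{\rm seq}_{\alpha,\gamma}(n_1,\ldots,n_k)\ \propto\ \Big(\gamma+(1-\alpha-\gamma)\frac{1}{n(n-1)}\sum_{i\ne j}n_in_j\Big)\,q^{\rm PD^*}_{\alpha,-\alpha-\gamma}(n_1,\ldots,n_k)$$ for $n_1\ge\cdots\ge n_k\ge 1$, $k\ge 2$, $n_1+\cdots+n_k=n$, where the sum is over ordered pairs of distinct indices and $\propto$ means equality up to a positive multiplicative constant depending only on $n,\alpha,\gamma$ that makes the left-hand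 side a probability function. Here $$q^{\rm PD^*}_{\alpha,\theta}(n_1,\ldots,n_k)=\frac{1}{m_1!\cdots m_n!}\frac{n!}{n_1!\cdots n_k!}\,p^{\rm PD^*}_{\alpha,\theta}(n_1,\ldots,n_k),\qquad p^{\rm PD^*}_{\alpha,\theta}(n_1,\ldots,n_k)=\frac{a_k}{Z_n}\prod_{j=1}^k w_{n_j},$$ $m_r$ is the number of $j$ with $n_j=r$, $w_m=\Gamma(m-\alpha)/\Gamma(1-\alpha)$, $a_k=\alpha^{k-2}\Gamma(k+\theta/\alpha)/\Gamma(2+\theta/\alpha)$ (extended by continuity to $\alpha=0$ and to $\theta=-2\alpha$, i.e. $a_k=\prod_{i=2}^{k-1}(i\alpha+\theta)$), and $Z_n$ is the constant for which $q^{\rm PD^*}_{\alpha,\theta}$ is a probability function on the splits of $n$ into $k\ge2$ parts. (b) The labelling of $T_n$ is exchangeable for all $n\ge 1$, i.e. the distribution of $T_n$ is invariant under all permutations of the labels $1,\ldots,n$, if and only if $\gamma=1-\alpha$ and $1/2\le\alpha\le 1$. -/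

import Mathlib

namespace AlphaGamma

/-- A rooted combinatorial tree without degree-2 vertices, with finitely many leaves labelled by the
elements of a finite set `leaves` (the set `B`) of natural numbers.  A vertex other than the root is
identified with the set of the labels of the leaves above it; the root is an additional vertex,
attached to the common ancestor `leaves`, and is left implicit. -/
@[ext]
structure LTree where
  leaves : Finset ℕ
  nodes : Finset (Finset ℕ)
  top_mem : leaves ∈ nodes
  singleton_mem : ∀ i ∈ leaves, {i} ∈ nodes
  nonempty_of_mem : ∀ A ∈ nodes, A.Nonempty
  subset_of_mem : ∀ A ∈ nodes, A ⊆ leaves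
  laminar : ∀ A ∈ nodes, ∀ C ∈ nodes, Disjoint A C ∨ A ⊆ C ∨ C ⊆ A

namespace LTree

/-- The children of the vertex `A`: the maximal vertices strictly contained in `A`. -/
def children (t : LTree) (A : Finset ℕ) : Finset (Finset ℕ) :=
  {C ∈ t.nodes | C ⊂ A ∧ ∀ D ∈ t.nodes, C ⊆ D → D ⊆ A → D = C ∨ D = A}

/-- The branch points: the vertices that are neither the root nor a leaf. -/
def branchPoints (t : LTree) : Finset (Finset ℕ) := {A ∈ t.nodes | 2 ≤ A.card}

/-- The tree with exactly one leaf, labelled `i`. -/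
def single (i : ℕ) : LTree where
  leaves := {i}
  nodes := {{i}}
  top_mem := by simp
  singleton_mem := by simp
  nonempty_of_mem := by simp
  subset_of_mem := by simp
  laminar := by simp

/-! ### Insertion of a new leaf -/

/-- The effect on the vertex `C` of attaching a leaf `x` at or directly below the vertex `A`: the new
leaf lies above `C` if and only if `A` does. -/
def lift (x : ℕ) (A C : Finset ℕ) : Finset ℕ := if A ⊆ C then insert x C else C

lemma lift_laminar {x : ℕ} {A C D : Finset ℕ} (hA : A.Nonempty) (hC : x ∉ C) (hD : x ∉ D)
    (h : Disjoint C D ∨ C ⊆ D ∨ D ⊆ C) :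
    Disjoint (lift x A C) (lift x A D) ∨ lift x A C ⊆ lift x A D ∨ lift x A D ⊆ lift x A C := by
  obtain ⟨a, ha⟩ := hA
  unfold lift
  split_ifs with h1 h2 h2
  · rcases h with h | h | h
    · exact absurd (h2 ha) (Finset.disjoint_left.1 h (h1 ha))
    · exact Or.inr (Or.inl (Finset.insert_subset_insert _ h))
    · exact Or.inr (Or.inr (Finset.insert_subset_insert _ h))
  · rcases h with h | h | h
    · exact Or.inl (Finset.disjoint_insert_left.2 ⟨hD, h⟩)
    · exact absurd (h1.trans h) h2
    · exact Or.inr (Or.inr (h.trans (Finset.subset_insert _ _)))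
  · rcases h with h | h | h
    · exact Or.inl (Finset.disjoint_insert_right.2 ⟨hC, h⟩)
    · exact Or.inr (Or.inl (h.trans (Finset.subset_insert _ _)))
    · exact absurd (h2.trans h) h1
  · exact h

lemma lift_singleton {x : ℕ} {A C : Finset ℕ} (hC : x ∉ C) :
    Disjoint {x} (lift x A C) ∨ {x} ⊆ lift x A C := by
  unfold lift
  split_ifs with h
  · right; simp
  · left; simpa using hC

lemma lift_self_laminar {x : ℕ} {A C : Finset ℕ}
    (h : Disjoint A C ∨ A ⊆ C ∨ C ⊆ A) :
    Disjoint A (lift x A C) ∨ A ⊆ lift x A C ∨ lift x A C ⊆ A := by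
  unfold lift
  split_ifs with h1
  · exact Or.inr (Or.inl (h1.trans (Finset.subset_insert _ _)))
  · exact h

lemma laminar_symm {A C : Finset ℕ} (h : Disjoint A C ∨ A ⊆ C ∨ C ⊆ A) :
    Disjoint C A ∨ C ⊆ A ∨ A ⊆ C := by
  rcases h with h | h | h
  · exact Or.inl h.symm
  · exact Or.inr (Or.inr h)
  · exact Or.inr (Or.inl h)

lemma notMem_of_mem {t : LTree} {x : ℕ} (hx : x ∉ t.leaves) {A : Finset ℕ} (hA : A ∈ t.nodes) :
    x ∉ A := fun h => hx (t.subset_of_mem A hA h)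

/-- Attach a new leaf `x` to the branch point `A` by a new edge `A → x`. -/
def insertVertex (t : LTree) (x : ℕ) (hx : x ∉ t.leaves) (A : Finset ℕ)
    (hA : A ∈ t.branchPoints) : LTree where
  leaves := insert x t.leaves
  nodes := insert {x} (t.nodes.image (lift x A))
  top_mem := by
    rw [branchPoints, Finset.mem_filter] at hA
    refine Finset.mem_insert_of_mem (Finset.mem_image.2 ⟨_, t.top_mem, ?_⟩)
    rw [lift, if_pos (t.subset_of_mem A hA.1)]
  singleton_mem := by
    rw [branchPoints, Finset.mem_filter] at hA
    intro i hi
    rcases Finset.mem_insert.1 hi with rfl | hi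
    · simp
    · refine Finset.mem_insert_of_mem (Finset.mem_image.2 ⟨_, t.singleton_mem i hi, ?_⟩)
      rw [lift, if_neg]
      intro h
      have := Finset.card_le_card h
      simp at this
      omega
  nonempty_of_mem := by
    intro C hC
    rcases Finset.mem_insert.1 hC with rfl | hC
    · simp
    · obtain ⟨D, hD, rfl⟩ := Finset.mem_image.1 hC
      have := t.nonempty_of_mem D hD
      unfold lift
      split_ifs
      · simp
      · exact this
  subset_of_mem := by
    intro C hC
    rcases Finset.mem_insert.1 hC with rfl | hC
    · simp
    · obtain ⟨D, hD, rfl⟩ := Finset.mem_image.1 hC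
      have := t.subset_of_mem D hD
      unfold lift
      split_ifs
      · exact Finset.insert_subset_insert _ this
      · exact this.trans (Finset.subset_insert _ _)
  laminar := by
    rw [branchPoints, Finset.mem_filter] at hA
    intro C hC D hD
    rcases Finset.mem_insert.1 hC with rfl | hC <;> rcases Finset.mem_insert.1 hD with rfl | hD
    · right; left; exact subset_rfl
    · obtain ⟨D, hD', rfl⟩ := Finset.mem_image.1 hD
      rcases lift_singleton (A := A) (notMem_of_mem hx hD') with h | h
      · exact Or.inl h
      · exact Or.inr (Or.inl h)
    · obtain ⟨C, hC', rfl⟩ := Finset.mem_image.1 hC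
      rcases lift_singleton (A := A) (notMem_of_mem hx hC') with h | h
      · exact Or.inl h.symm
      · exact Or.inr (Or.inr h)
    · obtain ⟨C, hC', rfl⟩ := Finset.mem_image.1 hC
      obtain ⟨D, hD', rfl⟩ := Finset.mem_image.1 hD
      exact lift_laminar (t.nonempty_of_mem A hA.1) (notMem_of_mem hx hC') (notMem_of_mem hx hD')
        (t.laminar C hC' D hD')

/-- Attach a new leaf `x` to the edge `a → A` that leads to the vertex `A` from its parent `a` (or
from the root): the edge is replaced by the three edges `a → b`, `b → A` and `b → x`, where `b` is a
new branch point, identified with `A ∪ {x}`. -/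
def insertEdge (t : LTree) (x : ℕ) (hx : x ∉ t.leaves) (A : Finset ℕ) (hA : A ∈ t.nodes) :
    LTree where
  leaves := insert x t.leaves
  nodes := insert A (insert {x} (t.nodes.image (lift x A)))
  top_mem := by
    refine Finset.mem_insert_of_mem
      (Finset.mem_insert_of_mem (Finset.mem_image.2 ⟨_, t.top_mem, ?_⟩))
    rw [lift, if_pos (t.subset_of_mem A hA)]
  singleton_mem := by
    intro i hi
    rcases Finset.mem_insert.1 hi with rfl | hi
    · simp
    · by_cases h : A ⊆ {i}
      · rw [(t.nonempty_of_mem A hA).subset_singleton_iff.1 h]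
        exact Finset.mem_insert_self _ _
      · refine Finset.mem_insert_of_mem
          (Finset.mem_insert_of_mem (Finset.mem_image.2 ⟨_, t.singleton_mem i hi, ?_⟩))
        rw [lift, if_neg h]
  nonempty_of_mem := by
    intro C hC
    rcases Finset.mem_insert.1 hC with rfl | hC
    · exact t.nonempty_of_mem _ hA
    rcases Finset.mem_insert.1 hC with rfl | hC
    · simp
    · obtain ⟨D, hD, rfl⟩ := Finset.mem_image.1 hC
      have := t.nonempty_of_mem D hD
      unfold lift
      split_ifs
      · simp
      · exact this
  subset_of_mem := by
    intro C hC
    rcases Finset.mem_insert.1 hC with rfl | hC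
    · exact (t.subset_of_mem _ hA).trans (Finset.subset_insert _ _)
    rcases Finset.mem_insert.1 hC with rfl | hC
    · simp
    · obtain ⟨D, hD, rfl⟩ := Finset.mem_image.1 hC
      have := t.subset_of_mem D hD
      unfold lift
      split_ifs
      · exact Finset.insert_subset_insert _ this
      · exact this.trans (Finset.subset_insert _ _)
  laminar := by
    have hxA : Disjoint A {x} := by simpa using notMem_of_mem hx hA
    intro C hC D hD
    rcases Finset.mem_insert.1 hC with rfl | hC <;> rcases Finset.mem_insert.1 hD with rfl | hD
    · right; left; exact subset_rfl
    · rcases Finset.mem_insert.1 hD with rfl | hD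
      · exact Or.inl hxA
      · obtain ⟨D, hD', rfl⟩ := Finset.mem_image.1 hD
        exact lift_self_laminar (t.laminar _ hA D hD')
    · rcases Finset.mem_insert.1 hC with rfl | hC
      · exact Or.inl hxA.symm
      · obtain ⟨C, hC', rfl⟩ := Finset.mem_image.1 hC
        exact laminar_symm (lift_self_laminar (t.laminar _ hA C hC'))
    rcases Finset.mem_insert.1 hC with rfl | hC <;> rcases Finset.mem_insert.1 hD with rfl | hD
    · right; left; exact subset_rfl
    · obtain ⟨D, hD', rfl⟩ := Finset.mem_image.1 hD
      rcases lift_singleton (A := A) (notMem_of_mem hx hD') with h | h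
      · exact Or.inl h
      · exact Or.inr (Or.inl h)
    · obtain ⟨C, hC', rfl⟩ := Finset.mem_image.1 hC
      rcases lift_singleton (A := A) (notMem_of_mem hx hC') with h | h
      · exact Or.inl h.symm
      · exact Or.inr (Or.inr h)
    · obtain ⟨C, hC', rfl⟩ := Finset.mem_image.1 hC
      obtain ⟨D, hD', rfl⟩ := Finset.mem_image.1 hD
      exact lift_laminar (t.nonempty_of_mem A hA) (notMem_of_mem hx hC') (notMem_of_mem hx hD')
        (t.laminar C hC' D hD')

/-! ### The growth rules -/

/-- The places where a new leaf may be attached: the edges of `t` (an edge is identified with its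
endpoint further away from the root) and the branch points of `t`. -/
abbrev Site (t : LTree) : Type := {A // A ∈ t.nodes} ⊕ {A // A ∈ t.branchPoints}

/-- The weights: `1 - α` for an edge adjacent to a leaf, `γ` for any other edge, and
`(k - 1) α - γ` for a branch point with `k` children, that is, of degree `k + 1`. -/
noncomputable def weight (α γ : ℝ) (t : LTree) : t.Site → ℝ
  | Sum.inl A => if A.1.card = 1 then 1 - α else γ
  | Sum.inr A => (((t.children A.1).card : ℝ) - 1) * α - γ

/-- The label of the next leaf: the largest label plus one. -/
def nextLabel (t : LTree) : ℕ := t.leaves.sup id + 1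

lemma nextLabel_notMem (t : LTree) : t.nextLabel ∉ t.leaves := by
  intro h
  have : id t.nextLabel ≤ t.leaves.sup id := Finset.le_sup (f := id) h
  simp only [nextLabel, id] at this
  omega

/-- If the leaves are labelled by `{1, …, n}`, the next label is `n + 1`. -/
lemma nextLabel_eq (t : LTree) (n : ℕ) (h : t.leaves = Finset.Icc 1 n) :
    t.nextLabel = n + 1 := by
  rw [nextLabel, h, add_left_inj]
  apply le_antisymm
  · exact Finset.sup_le fun i hi => (Finset.mem_Icc.1 hi).2
  · rcases Nat.eq_zero_or_pos n with rfl | hn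
    · exact Nat.zero_le _
    · exact Finset.le_sup (f := id) (Finset.mem_Icc.2 ⟨hn, le_rfl⟩)

/-- The tree with the next leaf attached at the selected site. -/
def insertAt (t : LTree) : t.Site → LTree
  | Sum.inl A => t.insertEdge t.nextLabel t.nextLabel_notMem A.1 A.2
  | Sum.inr A => t.insertVertex t.nextLabel t.nextLabel_notMem A.1 A.2

/-- The conditional distribution of the next tree given that the present tree is `t`: a site is
selected with probability proportional to its weight, and the next leaf is attached there.  (The
total weight is never zero in the cases of interest, see `sum_weight_ne_zero`.) -/
noncomputable def grow (α γ : ℝ) (t : LTree) : PMF LTree :=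
  open Classical in
  if h : ∑ s : t.Site, ENNReal.ofReal (t.weight α γ s) = 0 then PMF.pure t
  else (PMF.normalize (fun s : t.Site => ENNReal.ofReal (t.weight α γ s))
    (by rwa [tsum_fintype])
    (by rw [tsum_fintype]; exact (ENNReal.sum_lt_top.2 fun _ _ => ENNReal.ofReal_lt_top).ne)).map
      t.insertAt

lemma exists_child (t : LTree) {i : ℕ} (hi : i ∈ t.leaves) (h2 : 2 ≤ t.leaves.card) :
    ∃ C ∈ t.children t.leaves, i ∈ C := by
  have hne : ({C ∈ t.nodes | C ⊂ t.leaves ∧ i ∈ C} : Finset (Finset ℕ)).Nonempty := by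
    refine ⟨{i}, Finset.mem_filter.2 ⟨t.singleton_mem i hi, ?_, by simp⟩⟩
    refine Finset.ssubset_iff_subset_ne.2 ⟨by simpa using hi, ?_⟩
    intro h
    rw [← h] at h2
    simp at h2
  obtain ⟨C, hC, hmax⟩ := Finset.exists_max_image _ Finset.card hne
  rw [Finset.mem_filter] at hC
  refine ⟨C, Finset.mem_filter.2 ⟨hC.1, hC.2.1, ?_⟩, hC.2.2⟩
  intro D hD hCD hDB
  by_cases hDB' : D = t.leaves
  · exact Or.inr hDB'
  · left
    have := hmax D (Finset.mem_filter.2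
      ⟨hD, Finset.ssubset_iff_subset_ne.2 ⟨hDB, hDB'⟩, hCD hC.2.2⟩)
    exact (Finset.eq_of_subset_of_card_le hCD this).symm

lemma two_le_card_children (t : LTree) (h2 : 2 ≤ t.leaves.card) :
    2 ≤ (t.children t.leaves).card := by
  obtain ⟨i, hi⟩ := t.nonempty_of_mem _ t.top_mem
  obtain ⟨C, hC, hiC⟩ := t.exists_child hi h2
  have hC' := (Finset.mem_filter.1 hC).2.1
  obtain ⟨j, hj, hjC⟩ := Finset.exists_of_ssubset hC'
  obtain ⟨D, hD, hjD⟩ := t.exists_child hj h2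
  have hne : C ≠ D := fun h => hjC (h ▸ hjD)
  exact Finset.one_lt_card.2 ⟨C, hC, D, hD, hne⟩

lemma sum_weight_ne_zero {α γ : ℝ} (hα : 0 ≤ α) (t : LTree)
    (h2 : 2 ≤ t.leaves.card) : ∑ s : t.Site, ENNReal.ofReal (t.weight α γ s) ≠ 0 := by
  intro h
  rw [Finset.sum_eq_zero_iff] at h
  have key : ∀ s : t.Site, t.weight α γ s ≤ 0 := fun s =>
    ENNReal.ofReal_eq_zero.1 (h s (Finset.mem_univ s))
  obtain ⟨i, hi⟩ := t.nonempty_of_mem _ t.top_mem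
  have h1 := key (Sum.inl ⟨{i}, t.singleton_mem i hi⟩)
  have h3 := key (Sum.inl ⟨t.leaves, t.top_mem⟩)
  have h4 := key (Sum.inr ⟨t.leaves, Finset.mem_filter.2 ⟨t.top_mem, h2⟩⟩)
  have h5 : (2 : ℝ) ≤ (t.children t.leaves).card := by exact_mod_cast t.two_le_card_children h2
  simp only [weight, Finset.card_singleton, if_true] at h1
  simp only [weight, if_neg (by omega : ¬ t.leaves.card = 1)] at h3
  simp only [weight] at h4
  nlinarith

/-! ### Relabelling and tree shapes -/

/-- The tree `t'` arises from the tree `t` by a relabelling `f` of its leaves. -/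
def Relabels (f : ℕ → ℕ) (t t' : LTree) : Prop :=
  Set.InjOn f t.leaves ∧ t'.leaves = t.leaves.image f ∧
    t'.nodes = t.nodes.image (Finset.image f)

lemma Relabels.symm {f : ℕ → ℕ} {t t' : LTree} (h : Relabels f t t') :
    ∃ g, Relabels g t' t := by
  classical
  obtain ⟨hf, hl, hn⟩ := h
  have hg : ∀ a ∈ t.leaves, Function.invFunOn f t.leaves (f a) = a := fun a ha =>
    hf.leftInvOn_invFunOn ha
  have himg : ∀ A ⊆ t.leaves, (A.image f).image (Function.invFunOn f t.leaves) = A := by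
    intro A hA
    rw [Finset.image_image]
    conv_rhs => rw [← Finset.image_id (s := A)]
    exact Finset.image_congr fun a ha => hg a (hA ha)
  refine ⟨Function.invFunOn f t.leaves, ?_, ?_, ?_⟩
  · rw [hl]
    intro a ha b hb hab
    obtain ⟨a', ha', rfl⟩ := Finset.mem_image.1 (Finset.mem_coe.1 ha)
    obtain ⟨b', hb', rfl⟩ := Finset.mem_image.1 (Finset.mem_coe.1 hb)
    rw [hg a' ha', hg b' hb'] at hab
    rw [hab]
  · rw [hl, himg _ subset_rfl]
  · rw [hn, Finset.image_image]
    conv_lhs => rw [← Finset.image_id (s := t.nodes)]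
    exact Finset.image_congr fun A hA => (himg A (t.subset_of_mem A hA)).symm

/-- Two trees have the same shape if they agree up to a relabelling of the leaves. -/
instance shapeSetoid : Setoid LTree where
  r t t' := ∃ f, Relabels f t t'
  iseqv :=
    { refl := fun t => ⟨id, Set.injOn_id _, by simp, by
        conv_lhs => rw [← Finset.image_id (s := t.nodes)]
        exact Finset.image_congr fun A _ => by simp⟩
      symm := fun ⟨_, h⟩ => h.symm
      trans := by
        rintro t₁ t₂ t₃ ⟨f, hf, hl, hn⟩ ⟨g, hg, hl', hn'⟩
        refine ⟨g ∘ f, ?_, ?_, ?_⟩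
        · refine hg.comp hf ?_
          intro a ha
          rw [hl]
          exact Finset.mem_coe.2 (Finset.mem_image_of_mem f (Finset.mem_coe.1 ha))
        · rw [hl', hl, Finset.image_image]
        · rw [hn', hn, Finset.image_image]
          exact Finset.image_congr fun A _ => by simp [Finset.image_image] }

/-- The sizes of the blocks of the first split, that is, the numbers of leaves of the subtrees of the
common ancestor. -/
def firstSplit (t : LTree) : Multiset ℕ := (t.children t.leaves).val.map Finset.card

lemma Relabels.children {f : ℕ → ℕ} {t t' : LTree} (h : Relabels f t t') :
    t'.children t'.leaves = (t.children t.leaves).image (Finset.image f) := by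
  obtain ⟨hf, hl, hn⟩ := h
  have hsub : ∀ A ⊆ t.leaves, ∀ C ⊆ t.leaves, A.image f ⊆ C.image f → A ⊆ C := by
    intro A hA C hC h a ha
    obtain ⟨c, hc, hac⟩ := Finset.mem_image.1 (h (Finset.mem_image_of_mem f ha))
    rwa [← hf (hC hc) (hA ha) hac]
  have hinj : ∀ A ⊆ t.leaves, ∀ C ⊆ t.leaves, A.image f = C.image f → A = C :=
    fun A hA C hC h => (hsub A hA C hC h.subset).antisymm (hsub C hC A hA h.symm.subset)
  ext C'
  simp only [LTree.children, Finset.mem_filter, Finset.mem_image, hn, hl]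
  constructor
  · rintro ⟨⟨C, hC, rfl⟩, hlt, hmax⟩
    have hCB := t.subset_of_mem C hC
    refine ⟨C, ⟨hC, ?_, ?_⟩, rfl⟩
    · refine Finset.ssubset_iff_subset_ne.2 ⟨hCB, ?_⟩
      rintro rfl
      exact hlt.ne rfl
    · intro D hD hCD hDB
      rcases hmax _ ⟨D, hD, rfl⟩ (Finset.image_subset_image hCD) (Finset.image_subset_image hDB)
        with h | h
      · exact Or.inl (hinj _ hDB _ hCB h)
      · exact Or.inr (hinj _ hDB _ subset_rfl h)
  · rintro ⟨C, ⟨hC, hlt, hmax⟩, rfl⟩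
    have hCB := t.subset_of_mem C hC
    refine ⟨⟨C, hC, rfl⟩, ?_, ?_⟩
    · refine Finset.ssubset_iff_subset_ne.2 ⟨Finset.image_subset_image hCB, fun h => ?_⟩
      exact hlt.ne (hinj _ hCB _ subset_rfl h)
    · rintro _ ⟨D, hD, rfl⟩ hCD hDB
      have hDB' := t.subset_of_mem D hD
      rcases hmax D hD (hsub _ hCB _ hDB' hCD) hDB' with h | h
      · exact Or.inl (by rw [h])
      · exact Or.inr (by rw [h])

lemma Relabels.firstSplit {f : ℕ → ℕ} {t t' : LTree} (h : Relabels f t t') :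
    t.firstSplit = t'.firstSplit := by
  have hf := h.1
  have hchild : ∀ C ∈ t.children t.leaves, C ⊆ t.leaves := fun C hC =>
    t.subset_of_mem C (Finset.mem_filter.1 hC).1
  have hinj : Set.InjOn (Finset.image f) (t.children t.leaves : Set (Finset ℕ)) := by
    intro A hA C hC hAC
    have hA' := hchild A hA
    have hC' := hchild C hC
    ext a
    constructor
    · intro ha
      have : f a ∈ C.image f := hAC ▸ Finset.mem_image_of_mem f ha
      obtain ⟨c, hc, hac⟩ := Finset.mem_image.1 this
      rwa [← hf (hC' hc) (hA' ha) hac]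
    · intro ha
      have : f a ∈ A.image f := hAC ▸ Finset.mem_image_of_mem f ha
      obtain ⟨c, hc, hac⟩ := Finset.mem_image.1 this
      rwa [← hf (hA' hc) (hC' ha) hac]
  rw [LTree.firstSplit, LTree.firstSplit, h.children, Finset.image_val_of_injOn hinj,
    Multiset.map_map]
  refine Multiset.map_congr rfl fun C hC => ?_
  exact (Finset.card_image_of_injOn (hf.mono (Finset.coe_subset.2 (hchild C hC)))).symm

/-! ### Joining trees together -/

/-- The leaves of the disjoint union of the trees in a list, relabelled to be disjoint. -/
def forestLeaves : List LTree → Finset ℕ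
  | [] => ∅
  | t :: ts => t.leaves.image (2 * ·) ∪ (forestLeaves ts).image (2 * · + 1)

/-- The vertices (without roots) of the disjoint union of the trees in a list, relabelled to be
disjoint. -/
def forestNodes : List LTree → Finset (Finset ℕ)
  | [] => ∅
  | t :: ts => t.nodes.image (Finset.image (2 * ·)) ∪
      (forestNodes ts).image (Finset.image (2 * · + 1))

lemma forestLeaves_nonempty {ts : List LTree} (h : ts ≠ []) : (forestLeaves ts).Nonempty := by
  cases ts with
  | nil => exact absurd rfl h
  | cons t ts =>
    exact ((t.nonempty_of_mem _ t.top_mem).image _).mono Finset.subset_union_left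

lemma forest_nonempty (ts : List LTree) : ∀ A ∈ forestNodes ts, A.Nonempty := by
  induction ts with
  | nil => simp [forestNodes]
  | cons t ts ih =>
    intro A hA
    rcases Finset.mem_union.1 hA with hA | hA
    · obtain ⟨C, hC, rfl⟩ := Finset.mem_image.1 hA
      exact (t.nonempty_of_mem C hC).image _
    · obtain ⟨C, hC, rfl⟩ := Finset.mem_image.1 hA
      exact (ih C hC).image _

lemma forest_subset (ts : List LTree) : ∀ A ∈ forestNodes ts, A ⊆ forestLeaves ts := by
  induction ts with
  | nil => simp [forestNodes]
  | cons t ts ih =>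
    intro A hA
    rcases Finset.mem_union.1 hA with hA | hA
    · obtain ⟨C, hC, rfl⟩ := Finset.mem_image.1 hA
      exact (Finset.image_subset_image (t.subset_of_mem C hC)).trans Finset.subset_union_left
    · obtain ⟨C, hC, rfl⟩ := Finset.mem_image.1 hA
      exact (Finset.image_subset_image (ih C hC)).trans Finset.subset_union_right

lemma forest_singleton (ts : List LTree) : ∀ i ∈ forestLeaves ts, {i} ∈ forestNodes ts := by
  induction ts with
  | nil => simp [forestLeaves]
  | cons t ts ih =>
    intro i hi
    rcases Finset.mem_union.1 hi with hi | hi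
    · obtain ⟨j, hj, rfl⟩ := Finset.mem_image.1 hi
      exact Finset.mem_union_left _ (Finset.mem_image.2 ⟨{j}, t.singleton_mem j hj, by simp⟩)
    · obtain ⟨j, hj, rfl⟩ := Finset.mem_image.1 hi
      exact Finset.mem_union_right _ (Finset.mem_image.2 ⟨{j}, ih j hj, by simp⟩)

lemma image_laminar {f : ℕ → ℕ} (hf : Function.Injective f) {A C : Finset ℕ}
    (h : Disjoint A C ∨ A ⊆ C ∨ C ⊆ A) :
    Disjoint (A.image f) (C.image f) ∨ A.image f ⊆ C.image f ∨ C.image f ⊆ A.image f := by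
  rcases h with h | h | h
  · exact Or.inl ((Finset.disjoint_image hf).2 h)
  · exact Or.inr (Or.inl (Finset.image_subset_image h))
  · exact Or.inr (Or.inr (Finset.image_subset_image h))

lemma even_odd_disjoint (A C : Finset ℕ) :
    Disjoint (A.image (2 * ·)) (C.image (2 * · + 1)) := by
  rw [Finset.disjoint_left]
  intro a ha hc
  obtain ⟨i, -, rfl⟩ := Finset.mem_image.1 ha
  obtain ⟨j, -, hj⟩ := Finset.mem_image.1 hc
  omega

lemma forest_laminar (ts : List LTree) : ∀ A ∈ forestNodes ts, ∀ C ∈ forestNodes ts,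
    Disjoint A C ∨ A ⊆ C ∨ C ⊆ A := by
  induction ts with
  | nil => simp [forestNodes]
  | cons t ts ih =>
    intro A hA C hC
    rcases Finset.mem_union.1 hA with hA | hA <;> rcases Finset.mem_union.1 hC with hC | hC <;>
      obtain ⟨A, hA', rfl⟩ := Finset.mem_image.1 hA <;>
      obtain ⟨C, hC', rfl⟩ := Finset.mem_image.1 hC
    · exact image_laminar (fun a b h => by omega) (t.laminar A hA' C hC')
    · exact Or.inl (even_odd_disjoint A C)
    · exact Or.inl (even_odd_disjoint C A).symm
    · exact image_laminar (fun a b h => by omega) (ih A hA' C hC')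

/-- The tree whose subtrees of the common ancestor are the given trees (made disjoint by a
relabelling).  Only used for lists of at least two trees. -/
def join (ts : List LTree) : LTree :=
  if h : ts = [] then single 1 else
  { leaves := forestLeaves ts
    nodes := insert (forestLeaves ts) (forestNodes ts)
    top_mem := Finset.mem_insert_self _ _
    singleton_mem := fun i hi => Finset.mem_insert_of_mem (forest_singleton ts i hi)
    nonempty_of_mem := by
      intro A hA
      rcases Finset.mem_insert.1 hA with rfl | hA
      · exact forestLeaves_nonempty h
      · exact forest_nonempty ts A hA
    subset_of_mem := by
      intro A hA
      rcases Finset.mem_insert.1 hA with rfl | hA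
      · exact subset_rfl
      · exact forest_subset ts A hA
    laminar := by
      intro A hA C hC
      rcases Finset.mem_insert.1 hA with rfl | hA
      · rcases Finset.mem_insert.1 hC with rfl | hC
        · exact Or.inr (Or.inl subset_rfl)
        · exact Or.inr (Or.inr (forest_subset ts C hC))
      · rcases Finset.mem_insert.1 hC with rfl | hC
        · exact Or.inr (Or.inl (forest_subset ts A hA))
        · exact forest_laminar ts A hA C hC }

/-- The relabelling of a tree by a permutation of the labels. -/
def relabel (σ : Equiv.Perm ℕ) (t : LTree) : LTree where
  leaves := t.leaves.image σ
  nodes := t.nodes.image (Finset.image σ)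
  top_mem := Finset.mem_image_of_mem _ t.top_mem
  singleton_mem := by
    intro i hi
    obtain ⟨j, hj, rfl⟩ := Finset.mem_image.1 hi
    exact Finset.mem_image.2 ⟨{j}, t.singleton_mem j hj, by simp⟩
  nonempty_of_mem := by
    intro A hA
    obtain ⟨C, hC, rfl⟩ := Finset.mem_image.1 hA
    exact (t.nonempty_of_mem C hC).image _
  subset_of_mem := by
    intro A hA
    obtain ⟨C, hC, rfl⟩ := Finset.mem_image.1 hA
    exact Finset.image_subset_image (t.subset_of_mem C hC)
  laminar := by
    intro A hA C hC
    obtain ⟨A, hA', rfl⟩ := Finset.mem_image.1 hA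
    obtain ⟨C, hC', rfl⟩ := Finset.mem_image.1 hC
    exact image_laminar σ.injective (t.laminar A hA' C hC')

end LTree

/-- Unlabelled trees: equivalence classes of labelled trees under relabelling. -/
def Shape : Type := Quotient LTree.shapeSetoid

namespace Shape

/-- The delabelled tree. -/
def mk (t : LTree) : Shape := Quotient.mk LTree.shapeSetoid t

/-- The number of leaves. -/
def numLeaves : Shape → ℕ :=
  Quotient.lift (fun t : LTree => t.leaves.card) (by
    rintro t t' ⟨f, hf, hl, -⟩
    simp only [hl]
    exact (Finset.card_image_of_injOn hf).symm)

/-- The first split of an unlabelled tree, as a multiset of block sizes. -/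
def firstSplit : Shape → Multiset ℕ :=
  Quotient.lift LTree.firstSplit (by
    rintro t t' ⟨f, h⟩
    exact h.firstSplit)

/-- The unlabelled tree formed by joining together the given unlabelled trees at a common
ancestor. -/
noncomputable def join (l : List Shape) : Shape := mk (LTree.join (l.map Quotient.out))

end Shape

/-! ### The model -/

/-- The distribution of the labelled alpha-gamma tree `T_n` with leaves labelled by `{1, …, n}`,
`n ≥ 1`: the trees `T_1` and `T_2` are deterministic, and `T_{n+1}` is obtained from `T_n`, `n ≥ 2`,
by the growth rules.  (The value at `n = 0` has no meaning.) -/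
noncomputable def treeLaw (α γ : ℝ) : ℕ → PMF LTree
  | 0 => PMF.pure (LTree.single 1)
  | 1 => PMF.pure (LTree.single 1)
  | 2 => PMF.pure ((LTree.single 1).insertEdge 2 (by simp [LTree.single]) {1}
      (by simp [LTree.single]))
  | n + 3 => (treeLaw α γ (n + 2)).bind (LTree.grow α γ)

/-- The distribution of the delabelled alpha-gamma tree `T_n°`. -/
noncomputable def shapeLaw (α γ : ℝ) (n : ℕ) : PMF Shape := (treeLaw α γ n).map Shape.mk

/-- The distribution of a list of independent unlabelled trees, with one tree of distribution `P m`
for each entry `m` of a list. -/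
noncomputable def indepShapes (P : ℕ → PMF Shape) : List ℕ → PMF (List Shape)
  | [] => PMF.pure []
  | m :: ms => (P m).bind fun s => (indepShapes P ms).map fun l => s :: l

/-- The Markov branching property of a sequence of random unlabelled trees `T_n°` with `n` leaves and
distribution `P n`, `n ≥ 1`: for all `n ≥ 2`, the tree `T_n°` is distributed as
`S_1° * … * S_K°`, where `N_1 ≥ … ≥ N_K ≥ 1` is a random partition of `n` into `K ≥ 2` parts, and,
conditionally given `K = k` and `N_j = n_j`, the trees `S_j°` are independent and
distributed as `T_{n_j}°`. -/
def MarkovBranching (P : ℕ → PMF Shape) : Prop :=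
  (∀ n, 1 ≤ n → ∀ s ∈ (P n).support, s.numLeaves = n) ∧
  ∀ n, 2 ≤ n → ∃ q : PMF n.Partition,
    (∀ p ∈ q.support, 2 ≤ p.parts.card) ∧
    P n = q.bind fun p => (indepShapes P (p.parts.sort (· ≥ ·))).map Shape.join

/-- The splitting rule of a sequence of random unlabelled trees: the distribution of the block sizes
of the first split of the `n`th tree. -/
noncomputable def splittingRule (P : ℕ → PMF Shape) (n : ℕ) : PMF (Multiset ℕ) :=
  (P n).map Shape.firstSplit

/-- The labelling of a random tree with leaves `{1, …, n}` and distribution `P` is exchangeable: the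
distribution is invariant under all permutations of `{1, …, n}`. -/
def Exchangeable (n : ℕ) (P : PMF LTree) : Prop :=
  ∀ σ : Equiv.Perm ℕ, (∀ i, σ i ∈ Finset.Icc 1 n ↔ i ∈ Finset.Icc 1 n) →
    P.map (LTree.relabel σ) = P

/-! ### The Ewens-Pitman-type splitting rule -/

/-- `w_m = Γ(m - α) / Γ(1 - α)`. -/
noncomputable def pdW (α : ℝ) (m : ℕ) : ℝ := Real.Gamma ((m : ℝ) - α) / Real.Gamma (1 - α)

/-- `a_k = α ^ (k - 2) Γ(k + θ / α) / Γ(2 + θ / α)`, extended by continuity to the cases `α = 0` and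
`θ = -2 α` as a product of `k - 2` linear factors, see `pdA_eq`. -/
noncomputable def pdA (α θ : ℝ) (k : ℕ) : ℝ := ∏ i ∈ Finset.Ico 2 k, ((i : ℝ) * α + θ)

lemma pdA_eq {α θ : ℝ} (hα : 0 < α) (hθ : -2 * α < θ) {k : ℕ} (hk : 2 ≤ k) :
    pdA α θ k = α ^ (k - 2) * Real.Gamma ((k : ℝ) + θ / α) / Real.Gamma (2 + θ / α) := by
  have h2 : 0 < 2 + θ / α := by
    have h : 2 + θ / α = (2 * α + θ) / α := by field_simp
    rw [h]
    exact div_pos (by linarith) hα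
  induction k, hk using Nat.le_induction with
  | base => simp [pdA, (Real.Gamma_pos_of_pos h2).ne']
  | succ k hk ih =>
    have hk' : (2 : ℝ) ≤ k := by exact_mod_cast hk
    have h3 : (k : ℝ) + θ / α ≠ 0 := by
      have : 0 < (k : ℝ) + θ / α := by linarith
      exact this.ne'
    have h4 : ((k + 1 : ℕ) : ℝ) + θ / α = ((k : ℝ) + θ / α) + 1 := by push_cast; ring
    have h5 : k + 1 - 2 = (k - 2) + 1 := by omega
    rw [pdA, Finset.prod_Ico_succ_top hk, ← pdA, ih, h4, Real.Gamma_add_one h3, h5, pow_succ]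
    field_simp

/-- The number of partitions of a set of `n_1 + … + n_k` elements into blocks of sizes
`n_1, …, n_k`: the multinomial coefficient divided by `m_1! m_2! ⋯`, where `m_r` is the number of
`r`s among the block sizes. -/
noncomputable def numSetPartitions (ns : Multiset ℕ) : ℝ :=
  (ns.sum.factorial : ℝ) / (ns.map fun m => (m.factorial : ℝ)).prod /
    ∏ r ∈ ns.toFinset, ((ns.count r).factorial : ℝ)

/-- `a_k w_{n_1} ⋯ w_{n_k}`. -/
noncomputable def pdGibbs (α θ : ℝ) (ns : Multiset ℕ) : ℝ :=
  pdA α θ ns.card * (ns.map (pdW α)).prod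

/-- The normalisation constant `Z_n`, which makes `pdEPPF` the probability function of a random
partition of an `n`-element set into at least two blocks. -/
noncomputable def pdZ (α θ : ℝ) (n : ℕ) : ℝ :=
  ∑ p : n.Partition with 2 ≤ p.parts.card, numSetPartitions p.parts * pdGibbs α θ p.parts

/-- The Ewens-Pitman-type exchangeable partition probability function
`p(n_1, …, n_k) = a_k w_{n_1} ⋯ w_{n_k} / Z_n`, `k ≥ 2`. -/
noncomputable def pdEPPF (α θ : ℝ) (ns : Multiset ℕ) : ℝ :=
  pdGibbs α θ ns / pdZ α θ ns.sum

/-- The Ewens-Pitman-type splitting rule associated with `pdEPPF`, the distribution of the block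
sizes. -/
noncomputable def pdSplit (α θ : ℝ) (ns : Multiset ℕ) : ℝ :=
  numSetPartitions ns * pdEPPF α θ ns

/-- The sum of `n_i n_j` over all ordered pairs of distinct indices `i ≠ j`. -/
noncomputable def crossSum (ns : Multiset ℕ) : ℝ :=
  (ns.map fun a => ((ns.erase a).map fun b => (a : ℝ) * (b : ℝ)).sum).sum

end AlphaGamma

/-!
# The alpha-gamma trees: Markov branching, splitting rule and exchangeability

Markov branching. The growth step selects the root edge (weight `γ`), the first branch point
(weight `(k - 1) α - γ`), or a site within one of the `k` subtrees, and the total weight of the sites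
of a tree with `m` leaves is `m - α` (`Shape.growSum_one`). Hence a subtree with `m` leaves is
selected with weight `m - α`, whatever its shape, and if selected, it makes a growth step itself
(`LTree.growSum_eq`). The step therefore acts on a forest like a derivation (`multisetDeriv`), and
independent alpha-gamma trees remain independent alpha-gamma trees, while the numbers of their leaves
form a Markov chain of their own (`forestExpect_multisetDeriv`). If the root edge is selected, the
new subtrees are the old tree and a leaf, which are again independent alpha-gamma trees. This gives
the Markov branching property by induction on the number of leaves (`expect_shapeLaw`), together with
a recursion for the distribution of the first split (`mul_expect_splittingRule`). The work on
unlabelled trees rests on the fact that a tree is determined by the multiset of its subtrees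
(`LTree.mk_eq_of_subtrees_eq`) and that joining is inverse to splitting (`LTree.subtrees_join`).

Splitting rule. The probability of a first split `M` of `n` is
`numSetPartitions M * pdGibbs M * (γ + (1 - α - γ) X) / w_n`, where `X` is the probability that two
elements chosen at random lie in different blocks (`toReal_splittingRule`). The recursion is solved
by this expression: its terms correspond to the block of size `b` that contains the element added
last, which has a share `b / (n + 1)` of the set partitions (`count_mul_numSetPartitions`), and `X` is
an average over the removal of a random element (`sum_mul_seqFactor`). The selection of the root edge
fits in as the growth of a new block from the trivial partition, since the expression equals `γ`
there.

Exchangeability. Trees with three leaves force `γ = 1 - α` (`eq_of_exchangeable`), and then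
`1 / 2 ≤ α` by `γ ≤ α`. Conversely, a labelled tree determines its predecessor and the selected site
(`LTree.IsAttach.tree_eq`, `LTree.insertAt_injective`), so its probability is the product of the
selected weights over the normalising constants. For `γ = 1 - α` every edge has weight `1 - α` and a
branch point with `k` children has weight `k α - 1`, so the product is `LTree.gibbsWeight`, a function
of the numbers of children, which does not depend on the labels.
-/

/-! ### Subtrees above a vertex -/

namespace AlphaGamma

open Finset

namespace LTree

variable {t t' : LTree} {A B C D : Finset ℕ}

lemma mem_children : C ∈ t.children A ↔
    C ∈ t.nodes ∧ C ⊂ A ∧ ∀ D ∈ t.nodes, C ⊆ D → D ⊆ A → D = C ∨ D = A := by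
  simp [children]

lemma mem_branchPoints : A ∈ t.branchPoints ↔ A ∈ t.nodes ∧ 2 ≤ A.card := by
  simp [branchPoints]

lemma mem_nodes_of_mem_children (h : C ∈ t.children A) : C ∈ t.nodes := (mem_children.1 h).1

lemma ssubset_of_mem_children (h : C ∈ t.children A) : C ⊂ A := (mem_children.1 h).2.1

lemma exists_mem_children_superset (hB : B ∈ t.nodes) (hBA : B ⊂ A) :
    ∃ C ∈ t.children A, B ⊆ C := by
  obtain ⟨C, hC, hmax⟩ := Finset.exists_max_image {C ∈ t.nodes | C ⊂ A ∧ B ⊆ C} Finset.card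
    ⟨B, by simp [hB, hBA]⟩
  simp only [Finset.mem_filter] at hC hmax
  refine ⟨C, mem_children.2 ⟨hC.1, hC.2.1, fun D hD hCD hDA => ?_⟩, hC.2.2⟩
  by_cases h : D = A
  · exact Or.inr h
  · exact Or.inl (Finset.eq_of_subset_of_card_le hCD
      (hmax D ⟨hD, Finset.ssubset_iff_subset_ne.2 ⟨hDA, h⟩, hC.2.2.trans hCD⟩)).symm

lemma disjoint_of_mem_children (hC : C ∈ t.children A) (hD : D ∈ t.children A) (h : C ≠ D) :
    Disjoint C D := by
  rw [mem_children] at hC hD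
  rcases t.laminar C hC.1 D hD.1 with h1 | h1 | h1
  · exact h1
  · rcases hC.2.2 D hD.1 h1 hD.2.1.subset with h2 | h2
    · exact absurd h2.symm h
    · exact absurd h2 hD.2.1.ne
  · rcases hD.2.2 C hC.1 h1 hC.2.1.subset with h2 | h2
    · exact absurd h2 h
    · exact absurd h2 hC.2.1.ne

lemma eq_of_mem_children (hC : C ∈ t.children A) (hD : D ∈ t.children A) {i : ℕ} (hi : i ∈ C)
    (hj : i ∈ D) : C = D := by
  by_contra h
  exact Finset.disjoint_left.1 (disjoint_of_mem_children hC hD h) hi hj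

/-- The subtree above the edge that leads to the vertex `C`: its vertices are the vertices of `t`
above `C`, with their labels.  (By convention this is `t` itself if `C` is not a vertex of `t`.) -/
def sub (t : LTree) (C : Finset ℕ) : LTree :=
  if hC : C ∈ t.nodes then
    { leaves := C
      nodes := {A ∈ t.nodes | A ⊆ C}
      top_mem := by simp [hC]
      singleton_mem := fun i hi => by
        simpa [hi] using t.singleton_mem i (t.subset_of_mem C hC hi)
      nonempty_of_mem := fun A hA => t.nonempty_of_mem A (Finset.mem_filter.1 hA).1
      subset_of_mem := fun A hA => (Finset.mem_filter.1 hA).2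
      laminar := fun A hA D hD =>
        t.laminar A (Finset.mem_filter.1 hA).1 D (Finset.mem_filter.1 hD).1 }
  else t

lemma sub_leaves (hC : C ∈ t.nodes) : (t.sub C).leaves = C := by simp [sub, hC]

lemma sub_nodes (hC : C ∈ t.nodes) : (t.sub C).nodes = {A ∈ t.nodes | A ⊆ C} := by
  simp [sub, hC]

lemma mem_sub_nodes (hC : C ∈ t.nodes) : A ∈ (t.sub C).nodes ↔ A ∈ t.nodes ∧ A ⊆ C := by
  simp [sub_nodes hC]

lemma mem_sub_branchPoints (hC : C ∈ t.nodes) :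
    A ∈ (t.sub C).branchPoints ↔ A ∈ t.branchPoints ∧ A ⊆ C := by
  simp only [mem_branchPoints, mem_sub_nodes hC]; tauto

lemma children_sub (hC : C ∈ t.nodes) (hA : A ⊆ C) : (t.sub C).children A = t.children A := by
  ext D
  simp only [mem_children, mem_sub_nodes hC]
  constructor
  · rintro ⟨⟨h1, h2⟩, h3, h4⟩
    exact ⟨h1, h3, fun E hE hDE hEA => h4 E ⟨hE, hEA.trans hA⟩ hDE hEA⟩
  · rintro ⟨h1, h3, h4⟩
    exact ⟨⟨h1, h3.subset.trans hA⟩, h3, fun E hE hDE hEA => h4 E hE.1 hDE hEA⟩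

lemma card_leaves_sub_lt (hC : C ∈ t.children t.leaves) :
    (t.sub C).leaves.card < t.leaves.card := by
  rw [sub_leaves (mem_nodes_of_mem_children hC)]
  exact Finset.card_lt_card (ssubset_of_mem_children hC)

lemma mem_nodes_iff : A ∈ t.nodes ↔
    A = t.leaves ∨ ∃ C ∈ t.children t.leaves, A ∈ (t.sub C).nodes := by
  constructor
  · intro hA
    by_cases h : A = t.leaves
    · exact Or.inl h
    · obtain ⟨C, hC, hAC⟩ := exists_mem_children_superset hA
        (Finset.ssubset_iff_subset_ne.2 ⟨t.subset_of_mem A hA, h⟩)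
      exact Or.inr ⟨C, hC, (mem_sub_nodes (mem_nodes_of_mem_children hC)).2 ⟨hA, hAC⟩⟩
  · rintro (rfl | ⟨C, hC, hA⟩)
    · exact t.top_mem
    · exact ((mem_sub_nodes (mem_nodes_of_mem_children hC)).1 hA).1

lemma notMem_sub_nodes_of_ne (hC : C ∈ t.children t.leaves) (hD : D ∈ t.children t.leaves)
    (h : C ≠ D) (hA : A ∈ (t.sub C).nodes) : A ∉ (t.sub D).nodes := by
  intro hA'
  rw [mem_sub_nodes (mem_nodes_of_mem_children hC)] at hA
  rw [mem_sub_nodes (mem_nodes_of_mem_children hD)] at hA'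
  obtain ⟨i, hi⟩ := t.nonempty_of_mem A hA.1
  exact h (eq_of_mem_children hC hD (hA.2 hi) (hA'.2 hi))

lemma leaves_notMem_sub_nodes (hC : C ∈ t.children t.leaves) : t.leaves ∉ (t.sub C).nodes := by
  intro h
  rw [mem_sub_nodes (mem_nodes_of_mem_children hC)] at h
  exact (ssubset_of_mem_children hC).not_subset h.2

/-- The vertices of a tree are its common ancestor and the vertices of its subtrees. -/
lemma sum_nodes {M : Type*} [AddCommMonoid M] (t : LTree) (f : Finset ℕ → M) :
    ∑ A ∈ t.nodes, f A =
      f t.leaves + ∑ C ∈ t.children t.leaves, ∑ A ∈ (t.sub C).nodes, f A := by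
  have h : t.nodes =
      insert t.leaves ((t.children t.leaves).biUnion fun C => (t.sub C).nodes) := by
    ext A
    rw [mem_nodes_iff]
    simp
  rw [h, Finset.sum_insert, Finset.sum_biUnion]
  · intro C hC D hD hCD
    exact Finset.disjoint_left.2 fun A => notMem_sub_nodes_of_ne hC hD hCD
  · simp only [Finset.mem_biUnion, not_exists, not_and]
    exact fun C hC => leaves_notMem_sub_nodes hC

lemma sum_branchPoints {M : Type*} [AddCommMonoid M] (t : LTree) (h2 : 2 ≤ t.leaves.card)
    (f : Finset ℕ → M) :
    ∑ A ∈ t.branchPoints, f A =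
      f t.leaves + ∑ C ∈ t.children t.leaves, ∑ A ∈ (t.sub C).branchPoints, f A := by
  simp only [branchPoints, Finset.sum_filter]
  rw [sum_nodes, if_pos h2]

/-- The shapes of the subtrees of the common ancestor. -/
def subtrees (t : LTree) : Multiset Shape :=
  (t.children t.leaves).val.map fun C => Shape.mk (t.sub C)

/-! ### Subtrees and relabelling -/

lemma Relabels.image_subset_iff {f : ℕ → ℕ} (h : Relabels f t t') (hA : A ⊆ t.leaves)
    (hC : C ⊆ t.leaves) : A.image f ⊆ C.image f ↔ A ⊆ C := by
  refine ⟨fun h' a ha => ?_, Finset.image_subset_image⟩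
  obtain ⟨c, hc, hac⟩ := Finset.mem_image.1 (h' (Finset.mem_image_of_mem f ha))
  rwa [← h.1 (hC hc) (hA ha) hac]

lemma Relabels.injOn_image {f : ℕ → ℕ} (h : Relabels f t t') :
    Set.InjOn (Finset.image f) (t.nodes : Set (Finset ℕ)) := by
  intro A hA C hC hAC
  have hA' := t.subset_of_mem A hA
  have hC' := t.subset_of_mem C hC
  exact ((h.image_subset_iff hA' hC').1 hAC.subset).antisymm
    ((h.image_subset_iff hC' hA').1 hAC.symm.subset)

lemma Relabels.sub {f : ℕ → ℕ} (h : Relabels f t t') (hC : C ∈ t.nodes) :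
    Relabels f (t.sub C) (t'.sub (C.image f)) := by
  have hC' : C.image f ∈ t'.nodes := by rw [h.2.2]; exact Finset.mem_image_of_mem _ hC
  refine ⟨?_, ?_, ?_⟩
  · rw [sub_leaves hC]
    exact h.1.mono (Finset.coe_subset.2 (t.subset_of_mem C hC))
  · rw [sub_leaves hC, sub_leaves hC']
  · ext A
    simp only [mem_sub_nodes hC', Finset.mem_image, mem_sub_nodes hC, h.2.2]
    constructor
    · rintro ⟨⟨B, hB, rfl⟩, hBC⟩
      exact ⟨B, ⟨hB, (h.image_subset_iff (t.subset_of_mem B hB) (t.subset_of_mem C hC)).1 hBC⟩,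
        rfl⟩
    · rintro ⟨B, ⟨hB, hBC⟩, rfl⟩
      exact ⟨⟨B, hB, rfl⟩, Finset.image_subset_image hBC⟩

lemma _root_.AlphaGamma.Shape.mk_eq_mk {t t' : LTree} :
    Shape.mk t = Shape.mk t' ↔ ∃ f, Relabels f t t' := Quotient.eq

lemma Relabels.mk_eq {f : ℕ → ℕ} (h : Relabels f t t') : Shape.mk t = Shape.mk t' :=
  Shape.mk_eq_mk.2 ⟨f, h⟩

lemma Relabels.subtrees {f : ℕ → ℕ} (h : Relabels f t t') : t.subtrees = t'.subtrees := by
  have hinj : Set.InjOn (Finset.image f) (t.children t.leaves : Set (Finset ℕ)) :=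
    h.injOn_image.mono fun C hC => mem_nodes_of_mem_children hC
  rw [LTree.subtrees, LTree.subtrees, h.children, Finset.image_val_of_injOn hinj,
    Multiset.map_map]
  exact Multiset.map_congr rfl fun C hC => (h.sub (mem_nodes_of_mem_children hC)).mk_eq

end LTree

/-- Two finite families with the same multiset of values are related by a bijection. -/
lemma exists_injOn_of_map_eq {α β X : Type*} [DecidableEq α] [DecidableEq β] [Inhabited β]
    {F : α → X} {G : β → X} (s : Finset α) : ∀ s' : Finset β, s.val.map F = s'.val.map G →
    ∃ e : α → β, Set.InjOn e s ∧ s.image e = s' ∧ ∀ a ∈ s, G (e a) = F a := by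
  induction s using Finset.induction_on with
  | empty =>
    intro s' h
    obtain rfl : s' = ∅ := by
      have := congrArg Multiset.card h
      simpa [eq_comm] using this
    exact ⟨fun _ => default, by simp, by simp, by simp⟩
  | insert a s ha ih =>
    intro s' h
    rw [Finset.insert_val_of_notMem ha, Multiset.map_cons] at h
    have hmem : F a ∈ s'.val.map G := h ▸ Multiset.mem_cons_self _ _
    obtain ⟨b, hb, hGb⟩ := Multiset.mem_map.1 hmem
    have hb' : b ∈ s' := hb
    have h' : s.val.map F = (s'.erase b).val.map G := by
      rw [← Finset.insert_erase hb', Finset.insert_val_of_notMem (Finset.notMem_erase b s'),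
        Multiset.map_cons, hGb] at h
      exact (Multiset.cons_inj_right _).1 h
    obtain ⟨e, he, hes, heG⟩ := ih _ h'
    have hne : ∀ c ∈ s, c ≠ a := fun c hc hca => ha (hca ▸ hc)
    have hupd : ∀ c ∈ s, Function.update e a b c = e c := fun c hc =>
      Function.update_of_ne (hne c hc) _ _
    have himg : s.image (Function.update e a b) = s'.erase b := by
      rw [← hes]
      exact Finset.image_congr hupd
    refine ⟨Function.update e a b, ?_, ?_, ?_⟩
    · rw [Finset.coe_insert, Set.injOn_insert (by simpa using ha)]
      refine ⟨he.congr fun c hc => (hupd c hc).symm, ?_⟩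
      rw [Function.update_self, ← Finset.coe_image, himg]
      simp
    · rw [Finset.image_insert, himg, Function.update_self, Finset.insert_erase hb']
    · intro c hc
      rcases Finset.mem_insert.1 hc with rfl | hc
      · rw [Function.update_self, hGb]
      · rw [hupd c hc, heG c hc]

namespace LTree

variable {t t' : LTree} {A B C D : Finset ℕ}

/-- A tree with at least two leaves is determined, up to a relabelling, by the shapes of its
subtrees: relabellings of the subtrees are glued to a relabelling of the whole tree. -/
lemma mk_eq_of_subtrees_eq (h2 : 2 ≤ t.leaves.card) (h2' : 2 ≤ t'.leaves.card)
    (h : t.subtrees = t'.subtrees) : Shape.mk t = Shape.mk t' := by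
  classical
  obtain ⟨e, he, hes, heq⟩ := exists_injOn_of_map_eq _ _ h
  have hrel : ∀ C, ∃ f, C ∈ t.children t.leaves → Relabels f (t.sub C) (t'.sub (e C)) := by
    intro C
    by_cases hC : C ∈ t.children t.leaves
    · obtain ⟨f, hf⟩ := Shape.mk_eq_mk.1 (heq C hC).symm
      exact ⟨f, fun _ => hf⟩
    · exact ⟨id, fun h => absurd h hC⟩
  choose f hf using hrel
  have heC : ∀ C ∈ t.children t.leaves, e C ∈ t'.children t'.leaves := fun C hC =>
    hes ▸ Finset.mem_image_of_mem e hC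
  have hchild : ∀ i, ∃ C, i ∈ t.leaves → C ∈ t.children t.leaves ∧ i ∈ C := by
    intro i
    by_cases hi : i ∈ t.leaves
    · obtain ⟨C, hC⟩ := t.exists_child hi h2
      exact ⟨C, fun _ => hC⟩
    · exact ⟨∅, fun h => absurd h hi⟩
  choose c hc using hchild
  set g : ℕ → ℕ := fun i => f (c i) i with hg
  have hgC : ∀ C ∈ t.children t.leaves, ∀ i ∈ C, g i = f C i := by
    intro C hC i hi
    have hi' := (ssubset_of_mem_children hC).subset hi
    rw [hg]
    simp only
    rw [eq_of_mem_children (hc i hi').1 hC (hc i hi').2 hi]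
  have hfC : ∀ C ∈ t.children t.leaves, C.image (f C) = e C := by
    intro C hC
    have := (hf C hC).2.1
    rwa [sub_leaves (mem_nodes_of_mem_children hC),
      sub_leaves (mem_nodes_of_mem_children (heC C hC)), eq_comm] at this
  have hmem : ∀ C ∈ t.children t.leaves, ∀ i ∈ C, g i ∈ e C := by
    intro C hC i hi
    rw [hgC C hC i hi, ← hfC C hC]
    exact Finset.mem_image_of_mem _ hi
  have himg : ∀ C ∈ t.children t.leaves, ∀ A ⊆ C, A.image g = A.image (f C) :=
    fun C hC A hA => Finset.image_congr fun i hi => hgC C hC i (hA hi)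
  have hleaves : t'.leaves = t.leaves.image g := by
    ext j
    constructor
    · intro hj
      obtain ⟨C', hC', hjC'⟩ := t'.exists_child hj h2'
      rw [← hes] at hC'
      obtain ⟨C, hC, rfl⟩ := Finset.mem_image.1 hC'
      rw [← hfC C hC, ← himg C hC C subset_rfl] at hjC'
      exact Finset.image_subset_image (ssubset_of_mem_children hC).subset hjC'
    · intro hj
      obtain ⟨i, hi, rfl⟩ := Finset.mem_image.1 hj
      obtain ⟨hC, hiC⟩ := hc i hi
      exact (ssubset_of_mem_children (heC _ hC)).subset (hmem _ hC i hiC)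
  refine Relabels.mk_eq (f := g) ⟨?_, hleaves, ?_⟩
  · intro i hi j hj hij
    obtain ⟨hC, hiC⟩ := hc i hi
    obtain ⟨hD, hjD⟩ := hc j hj
    have h1 : e (c i) = e (c j) := eq_of_mem_children (heC _ hC) (heC _ hD) (hmem _ hC i hiC)
      (hij ▸ hmem _ hD j hjD)
    have h2 : c i = c j := he hC hD h1
    have hinj := (hf _ hC).1
    rw [sub_leaves (mem_nodes_of_mem_children hC)] at hinj
    refine hinj hiC (h2 ▸ hjD) ?_
    rw [← hgC _ hC i hiC, hij, hgC _ hC j (h2 ▸ hjD)]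
  · ext A
    rw [mem_nodes_iff, ← hes]
    simp only [Finset.mem_image, exists_exists_and_eq_and]
    constructor
    · rintro (rfl | ⟨C, hC, hA⟩)
      · exact ⟨_, t.top_mem, hleaves.symm⟩
      · rw [(hf C hC).2.2] at hA
        obtain ⟨B, hB, rfl⟩ := Finset.mem_image.1 hA
        rw [mem_sub_nodes (mem_nodes_of_mem_children hC)] at hB
        exact ⟨B, hB.1, himg C hC B hB.2⟩
    · rintro ⟨B, hB, rfl⟩
      rcases mem_nodes_iff.1 hB with rfl | ⟨C, hC, hB⟩
      · exact Or.inl hleaves.symm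
      · refine Or.inr ⟨C, hC, ?_⟩
        rw [himg C hC B ((mem_sub_nodes (mem_nodes_of_mem_children hC)).1 hB).2, (hf C hC).2.2]
        exact Finset.mem_image_of_mem _ hB

/-! ### Subtrees and joining -/

/-- The relabelling that `join` applies to the tree at position `i` of a list. -/
def joinLabel : ℕ → ℕ → ℕ
  | 0, x => 2 * x
  | i + 1, x => 2 * joinLabel i x + 1

lemma joinLabel_inj {i j x y : ℕ} (h : joinLabel i x = joinLabel j y) : i = j ∧ x = y := by
  induction i generalizing j with
  | zero =>
    cases j with
    | zero => simp only [joinLabel] at h; omega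
    | succ j => simp only [joinLabel] at h; omega
  | succ i ih =>
    cases j with
    | zero => simp only [joinLabel] at h; omega
    | succ j =>
      simp only [joinLabel] at h
      have := @ih j (by omega)
      omega

lemma mem_forestLeaves {ts : List LTree} {a : ℕ} : a ∈ forestLeaves ts ↔
    ∃ i : Fin ts.length, ∃ b ∈ ts[i].leaves, joinLabel i b = a := by
  induction ts generalizing a with
  | nil => simp [forestLeaves]
  | cons t ts ih =>
    rw [forestLeaves, Finset.mem_union, Finset.mem_image, Finset.mem_image]
    simp only [ih]
    rw [show (∃ i : Fin (t :: ts).length, ∃ b ∈ (t :: ts)[i].leaves, joinLabel i b = a) ↔ _ from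
      Fin.exists_fin_succ]
    simp [joinLabel]

lemma mem_forestNodes {ts : List LTree} {A : Finset ℕ} : A ∈ forestNodes ts ↔
    ∃ i : Fin ts.length, ∃ B ∈ ts[i].nodes, B.image (joinLabel i) = A := by
  induction ts generalizing A with
  | nil => simp [forestNodes]
  | cons t ts ih =>
    rw [forestNodes, Finset.mem_union, Finset.mem_image, Finset.mem_image]
    simp only [ih]
    rw [show (∃ i : Fin (t :: ts).length, ∃ B ∈ (t :: ts)[i].nodes, B.image (joinLabel i) = A) ↔ _
      from Fin.exists_fin_succ]
    have h0 : joinLabel 0 = (2 * ·) := rfl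
    have hs : ∀ i, joinLabel (i + 1) = (2 * · + 1) ∘ joinLabel i := fun i => rfl
    simp [h0, hs, ← Finset.image_image]

section Join

variable {ts : List LTree}

lemma join_leaves (h : ts ≠ []) : (join ts).leaves = forestLeaves ts := by
  simp [join, h]

lemma join_nodes (h : ts ≠ []) :
    (join ts).nodes = insert (forestLeaves ts) (forestNodes ts) := by
  simp [join, h]

lemma image_joinLabel_subset {i j : ℕ} (hA : A.Nonempty)
    (h : A.image (joinLabel i) ⊆ B.image (joinLabel j)) : i = j ∧ A ⊆ B := by
  have key : ∀ a ∈ A, ∃ b ∈ B, i = j ∧ a = b := by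
    intro a ha
    obtain ⟨b, hb, hab⟩ := Finset.mem_image.1 (h (Finset.mem_image_of_mem _ ha))
    have := joinLabel_inj hab
    exact ⟨b, hb, this.1.symm, this.2.symm⟩
  obtain ⟨a, ha⟩ := hA
  refine ⟨?_, fun c hc => ?_⟩
  · obtain ⟨b, -, h, -⟩ := key a ha
    exact h
  · obtain ⟨b, hb, -, rfl⟩ := key c hc
    exact hb

lemma leaves_nonempty (t : LTree) : t.leaves.Nonempty := t.nonempty_of_mem _ t.top_mem

lemma image_joinLabel_ssubset (h2 : 2 ≤ ts.length) (i : Fin ts.length) :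
    ts[i].leaves.image (joinLabel i) ⊂ forestLeaves ts := by
  rw [Finset.ssubset_iff_of_subset]
  · obtain ⟨j, hj⟩ : ∃ j : Fin ts.length, j ≠ i := by
      have : Nontrivial (Fin ts.length) := Fin.nontrivial_iff_two_le.2 h2
      exact exists_ne i
    obtain ⟨b, hb⟩ := ts[j].leaves_nonempty
    refine ⟨joinLabel j b, mem_forestLeaves.2 ⟨j, b, hb, rfl⟩, fun h => ?_⟩
    obtain ⟨c, -, hc⟩ := Finset.mem_image.1 h
    exact hj (Fin.ext (joinLabel_inj hc).1.symm)
  · intro a ha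
    obtain ⟨b, hb, rfl⟩ := Finset.mem_image.1 ha
    exact mem_forestLeaves.2 ⟨i, b, hb, rfl⟩

lemma children_join (h2 : 2 ≤ ts.length) : (join ts).children (join ts).leaves =
    Finset.univ.image fun i : Fin ts.length => ts[i].leaves.image (joinLabel i) := by
  have h0 : ts ≠ [] := by rintro rfl; simp at h2
  ext C
  rw [mem_children, join_leaves h0, join_nodes h0]
  simp only [Finset.mem_image, Finset.mem_univ, true_and, Finset.mem_insert, mem_forestNodes]
  constructor
  · rintro ⟨hC, hlt, hmax⟩
    rcases hC with rfl | ⟨i, B, hB, rfl⟩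
    · exact absurd rfl hlt.ne
    · refine ⟨i, ?_⟩
      rcases hmax (ts[i].leaves.image (joinLabel i)) (Or.inr ⟨i, _, ts[i].top_mem, rfl⟩)
        (Finset.image_subset_image (ts[i].subset_of_mem B hB))
        (image_joinLabel_ssubset h2 i).subset with h | h
      · exact h
      · exact absurd h (image_joinLabel_ssubset h2 i).ne
  · rintro ⟨i, rfl⟩
    refine ⟨Or.inr ⟨i, _, ts[i].top_mem, rfl⟩, image_joinLabel_ssubset h2 i, ?_⟩
    rintro D (rfl | ⟨j, B, hB, rfl⟩) hCD -
    · exact Or.inr rfl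
    · left
      obtain ⟨hij, hsub⟩ := image_joinLabel_subset ts[i].leaves_nonempty hCD
      obtain rfl : i = j := Fin.ext hij
      rw [hsub.antisymm (ts[i].subset_of_mem B hB)]

lemma relabels_sub_join (h2 : 2 ≤ ts.length) (i : Fin ts.length) :
    Relabels (joinLabel i) ts[i] ((join ts).sub (ts[i].leaves.image (joinLabel i))) := by
  have h0 : ts ≠ [] := by rintro rfl; simp at h2
  have hmem : ts[i].leaves.image (joinLabel i) ∈ (join ts).nodes := by
    refine mem_nodes_of_mem_children (A := (join ts).leaves) ?_
    rw [children_join h2]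
    exact Finset.mem_image_of_mem (fun i : Fin ts.length => ts[i].leaves.image (joinLabel i))
      (Finset.mem_univ i)
  refine ⟨fun a _ b _ h => (joinLabel_inj h).2, sub_leaves hmem, ?_⟩
  ext A
  rw [mem_sub_nodes hmem, join_nodes h0, Finset.mem_insert, mem_forestNodes, Finset.mem_image]
  constructor
  · rintro ⟨rfl | ⟨j, B, hB, rfl⟩, hA⟩
    · exact absurd hA (image_joinLabel_ssubset h2 i).not_subset
    · obtain ⟨hij, -⟩ := image_joinLabel_subset (ts[j].nonempty_of_mem B hB) hA
      obtain rfl : j = i := Fin.ext hij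
      exact ⟨B, hB, rfl⟩
  · rintro ⟨B, hB, rfl⟩
    exact ⟨Or.inr ⟨i, B, hB, rfl⟩, Finset.image_subset_image (ts[i].subset_of_mem B hB)⟩

/-- Splitting at the common ancestor inverts joining. -/
lemma subtrees_join (h2 : 2 ≤ ts.length) : (join ts).subtrees = (ts.map Shape.mk : List Shape) := by
  have hinj : Function.Injective
      fun i : Fin ts.length => ts[i].leaves.image (joinLabel i) := fun i j hij =>
    Fin.ext (image_joinLabel_subset ts[i].leaves_nonempty
      (show ts[i].leaves.image (joinLabel i) ⊆ ts[j].leaves.image (joinLabel j) from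
        Eq.subset hij)).1
  rw [subtrees, children_join h2, Finset.image_val_of_injOn hinj.injOn, Multiset.map_map]
  have : (fun C => Shape.mk ((join ts).sub C)) ∘
      (fun i : Fin ts.length => ts[i].leaves.image (joinLabel i)) =
      fun i : Fin ts.length => Shape.mk ts[i] :=
    funext fun i => (relabels_sub_join h2 i).mk_eq.symm
  rw [this, Fin.univ_val_map]
  congr 1
  apply List.ext_getElem <;> simp

lemma card_children_le_card_leaves : (t.children t.leaves).card ≤ t.leaves.card := by
  have : ((t.children t.leaves).biUnion id).card = ∑ C ∈ t.children t.leaves, C.card :=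
    Finset.card_biUnion fun C hC D hD h => disjoint_of_mem_children hC hD h
  calc (t.children t.leaves).card = ∑ C ∈ t.children t.leaves, 1 := by simp
    _ ≤ ∑ C ∈ t.children t.leaves, C.card := Finset.sum_le_sum fun C hC =>
        (t.nonempty_of_mem C (mem_nodes_of_mem_children hC)).card_pos
    _ ≤ t.leaves.card := by
        rw [← this]
        exact Finset.card_le_card (Finset.biUnion_subset.2 fun C hC =>
          (ssubset_of_mem_children hC).subset)

lemma two_le_card_leaves_join (h2 : 2 ≤ ts.length) : 2 ≤ (join ts).leaves.card := by
  refine le_trans ?_ card_children_le_card_leaves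
  have := congrArg Multiset.card (subtrees_join h2)
  simp only [subtrees, Multiset.card_map, Multiset.coe_card, List.length_map] at this
  exact h2.trans this.ge

end Join

lemma sum_card_children (t : LTree) (h2 : 2 ≤ t.leaves.card) :
    ∑ C ∈ t.children t.leaves, C.card = t.leaves.card := by
  rw [← Finset.card_biUnion fun C hC D hD h => disjoint_of_mem_children hC hD h]
  congr 1
  ext i
  rw [Finset.mem_biUnion]
  exact ⟨fun ⟨C, hC, hi⟩ => (ssubset_of_mem_children hC).subset hi,
    fun hi => t.exists_child hi h2⟩

end LTree

namespace Shape

/-- The multiset of the subtrees of an unlabelled tree. -/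
def subtrees : Shape → Multiset Shape :=
  Quotient.lift LTree.subtrees (by rintro t t' ⟨f, h⟩; exact h.subtrees)

lemma subtrees_mk (t : LTree) : (mk t).subtrees = t.subtrees := rfl

lemma numLeaves_mk (t : LTree) : (mk t).numLeaves = t.leaves.card := rfl

lemma mk_out (s : Shape) : mk (Quotient.out s) = s := Quotient.out_eq s

lemma exists_mk_eq (s : Shape) : ∃ t, mk t = s := ⟨_, mk_out s⟩

lemma length_map_out (l : List Shape) :
    (l.map Quotient.out : List LTree).length = l.length := List.length_map _

lemma map_mk_map_out (l : List Shape) : (l.map Quotient.out : List LTree).map mk = l := by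
  refine (List.map_map (l := l)).trans ?_
  conv_rhs => rw [← List.map_id l]
  exact List.map_congr_left fun s _ => mk_out s

lemma eq_of_subtrees_eq {s s' : Shape} (h2 : 2 ≤ s.numLeaves) (h2' : 2 ≤ s'.numLeaves)
    (h : s.subtrees = s'.subtrees) : s = s' := by
  obtain ⟨t, rfl⟩ := s.exists_mk_eq
  obtain ⟨t', rfl⟩ := s'.exists_mk_eq
  exact LTree.mk_eq_of_subtrees_eq h2 h2' h

lemma subtrees_join {l : List Shape} (h2 : 2 ≤ l.length) : (join l).subtrees = l := by
  rw [join, subtrees_mk, LTree.subtrees_join (h2.trans (length_map_out l).ge), map_mk_map_out]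

lemma two_le_numLeaves_join {l : List Shape} (h2 : 2 ≤ l.length) : 2 ≤ (join l).numLeaves :=
  LTree.two_le_card_leaves_join (h2.trans (length_map_out l).ge)

/-- The unlabelled tree with the given multiset of subtrees. -/
noncomputable def joinMultiset (M : Multiset Shape) : Shape := join M.toList

lemma subtrees_joinMultiset {M : Multiset Shape} (h2 : 2 ≤ M.card) :
    (joinMultiset M).subtrees = M := by
  rw [joinMultiset, subtrees_join (by simpa using h2), Multiset.coe_toList]

lemma two_le_numLeaves_joinMultiset {M : Multiset Shape} (h2 : 2 ≤ M.card) :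
    2 ≤ (joinMultiset M).numLeaves :=
  two_le_numLeaves_join (by simpa using h2)

lemma joinMultiset_coe {l : List Shape} (h2 : 2 ≤ l.length) : joinMultiset l = join l :=
  eq_of_subtrees_eq (two_le_numLeaves_joinMultiset (by simpa using h2))
    (two_le_numLeaves_join h2)
    (by rw [subtrees_joinMultiset (by simpa using h2), subtrees_join h2])

lemma two_le_card_subtrees {s : Shape} (h2 : 2 ≤ s.numLeaves) : 2 ≤ s.subtrees.card := by
  obtain ⟨t, rfl⟩ := s.exists_mk_eq
  rw [subtrees_mk, LTree.subtrees, Multiset.card_map]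
  exact t.two_le_card_children h2

lemma joinMultiset_subtrees {s : Shape} (h2 : 2 ≤ s.numLeaves) :
    joinMultiset s.subtrees = s :=
  have h := two_le_card_subtrees h2
  eq_of_subtrees_eq (two_le_numLeaves_joinMultiset h) h2 (subtrees_joinMultiset h)

lemma firstSplit_eq (s : Shape) : s.firstSplit = s.subtrees.map numLeaves := by
  obtain ⟨t, rfl⟩ := s.exists_mk_eq
  change LTree.firstSplit t = (LTree.subtrees t).map numLeaves
  rw [LTree.firstSplit, LTree.subtrees, Multiset.map_map]
  refine Multiset.map_congr rfl fun C hC => ?_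
  rw [Function.comp, numLeaves_mk, LTree.sub_leaves (LTree.mem_nodes_of_mem_children hC)]

lemma sum_firstSplit {s : Shape} (h2 : 2 ≤ s.numLeaves) : s.firstSplit.sum = s.numLeaves := by
  obtain ⟨t, rfl⟩ := s.exists_mk_eq
  exact t.sum_card_children h2

lemma numLeaves_pos (s : Shape) : 0 < s.numLeaves := by
  obtain ⟨t, rfl⟩ := s.exists_mk_eq
  exact t.leaves_nonempty.card_pos

end Shape

end AlphaGamma

/-! ### Attaching a leaf -/

namespace AlphaGamma

open Finset

namespace LTree

variable {t t' t₁ t₂ : LTree} {A B C D : Finset ℕ} {x : ℕ} {e : Prop}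

lemma subset_lift : C ⊆ lift x A C := by
  unfold lift
  split_ifs
  · exact Finset.subset_insert _ _
  · exact subset_rfl

lemma lift_of_subset (h : A ⊆ C) : lift x A C = insert x C := if_pos h

lemma lift_of_not_subset (h : ¬ A ⊆ C) : lift x A C = C := if_neg h

lemma mem_lift_self_iff (hC : x ∉ C) : x ∈ lift x A C ↔ A ⊆ C := by
  unfold lift
  split_ifs with h <;> simp [h, hC]

lemma mem_lift_of_ne {i : ℕ} (hi : i ≠ x) : i ∈ lift x A C ↔ i ∈ C := by
  unfold lift
  split_ifs <;> simp [hi]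

lemma erase_lift (hC : x ∉ C) : (lift x A C).erase x = C := by
  unfold lift
  split_ifs
  · exact Finset.erase_insert hC
  · exact Finset.erase_eq_of_notMem hC

lemma lift_subset_lift_iff (hC : x ∉ C) (hD : x ∉ D) : lift x A C ⊆ lift x A D ↔ C ⊆ D := by
  constructor
  · intro h
    rw [← erase_lift (A := A) hC, ← erase_lift (A := A) hD]
    exact Finset.erase_subset_erase _ h
  · intro h i hi
    by_cases hix : i = x
    · subst hix
      rw [mem_lift_self_iff hC] at hi
      rw [mem_lift_self_iff hD]
      exact hi.trans h
    · rw [mem_lift_of_ne hix] at hi ⊢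
      exact h hi

lemma lift_inj (hC : x ∉ C) (hD : x ∉ D) (h : lift x A C = lift x A D) : C = D := by
  rw [← erase_lift (A := A) hC, h, erase_lift hD]

lemma lift_ssubset_lift_iff (hC : x ∉ C) (hD : x ∉ D) : lift x A C ⊂ lift x A D ↔ C ⊂ D := by
  rw [Finset.ssubset_def, Finset.ssubset_def, lift_subset_lift_iff hC hD,
    lift_subset_lift_iff hD hC]

/-- The tree `t'` arises from the tree `t` by attaching a leaf `x` to the edge below `A` if `e`
holds, and to the vertex `A` otherwise. -/
structure IsAttach (e : Prop) (t : LTree) (x : ℕ) (A : Finset ℕ) (t' : LTree) : Prop where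
  notMem : x ∉ t.leaves
  mem : A ∈ t.nodes
  leaves : t'.leaves = insert x t.leaves
  nodes : ∀ B, B ∈ t'.nodes ↔ (e ∧ B = A) ∨ B = {x} ∨ ∃ C ∈ t.nodes, lift x A C = B

lemma isAttach_insertEdge (hx : x ∉ t.leaves) (hA : A ∈ t.nodes) :
    IsAttach True t x A (t.insertEdge x hx A hA) :=
  ⟨hx, hA, rfl, fun B => by simp [insertEdge]⟩

lemma isAttach_insertVertex (hx : x ∉ t.leaves) (hA : A ∈ t.branchPoints) :
    IsAttach False t x A (t.insertVertex x hx A hA) :=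
  ⟨hx, (mem_branchPoints.1 hA).1, rfl, fun B => by simp [insertVertex]⟩

lemma IsAttach.unique (h₁ : IsAttach e t x A t₁) (h₂ : IsAttach e t x A t₂) : t₁ = t₂ := by
  refine LTree.ext (by rw [h₁.leaves, h₂.leaves]) (Finset.ext fun B => ?_)
  rw [h₁.nodes, h₂.nodes]

namespace IsAttach

lemma notMem_of_mem (h : IsAttach e t x A t') (hC : C ∈ t.nodes) : x ∉ C :=
  LTree.notMem_of_mem h.notMem hC

lemma lift_mem (h : IsAttach e t x A t') (hC : C ∈ t.nodes) : lift x A C ∈ t'.nodes :=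
  (h.nodes _).2 (Or.inr (Or.inr ⟨C, hC, rfl⟩))

lemma not_lift_subset_singleton (h : IsAttach e t x A t') (hC : C ∈ t.nodes) :
    ¬ lift x A C ⊆ {x} := by
  intro h'
  obtain ⟨i, hi⟩ := t.nonempty_of_mem C hC
  have := Finset.mem_singleton.1 (h' (subset_lift hi))
  exact h.notMem_of_mem hC (this ▸ hi)

lemma singleton_subset_lift_iff (h : IsAttach e t x A t') (hC : C ∈ t.nodes) :
    {x} ⊆ lift x A C ↔ A ⊆ C := by
  rw [Finset.singleton_subset_iff, mem_lift_self_iff (h.notMem_of_mem hC)]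

lemma subset_lift_iff (h : IsAttach e t x A t') : A ⊆ lift x A C ↔ A ⊆ C := by
  refine ⟨fun h' i hi => ?_, fun h' => h'.trans subset_lift⟩
  have hix : i ≠ x := by
    rintro rfl
    exact h.notMem_of_mem h.mem hi
  exact (mem_lift_of_ne hix).1 (h' hi)

lemma lift_ne_self (h : IsAttach e t x A t') (hC : C ∈ t.nodes) : lift x A C ≠ A := by
  intro h'
  have h1 : A ⊆ C := h.subset_lift_iff.1 h'.symm.subset
  have h2 : x ∈ lift x A C := (mem_lift_self_iff (h.notMem_of_mem hC)).2 h1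
  rw [h'] at h2
  exact h.notMem_of_mem h.mem h2

lemma lift_mem_children (h : IsAttach e t x A t') (hC : C ∈ t.nodes) (hCA : ¬ e ∨ C ≠ A)
    (hD : D ∈ t.children C) : lift x A D ∈ t'.children (lift x A C) := by
  have hDn := mem_nodes_of_mem_children hD
  have hxC := h.notMem_of_mem hC
  have hxD := h.notMem_of_mem hDn
  refine mem_children.2 ⟨h.lift_mem hDn,
    (lift_ssubset_lift_iff hxD hxC).2 (ssubset_of_mem_children hD), fun E hE hDE hEC => ?_⟩
  rcases (h.nodes E).1 hE with ⟨he, rfl⟩ | rfl | ⟨E, hE', rfl⟩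
  · exfalso
    have h2 : E ⊆ C := h.subset_lift_iff.1 hEC
    rcases (mem_children.1 hD).2.2 E h.mem (subset_lift.trans hDE) h2 with h3 | h3
    · subst h3
      exact hxD (hDE ((mem_lift_self_iff hxD).2 subset_rfl))
    · rcases hCA with h4 | h4
      · exact h4 he
      · exact h4 h3.symm
  · exact absurd hDE (h.not_lift_subset_singleton hDn)
  · have hxE := h.notMem_of_mem hE'
    rcases (mem_children.1 hD).2.2 E hE' ((lift_subset_lift_iff hxD hxE).1 hDE)
      ((lift_subset_lift_iff hxE hxC).1 hEC) with h3 | h3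
    · exact Or.inl (by rw [h3])
    · exact Or.inr (by rw [h3])

lemma mem_children_of_lift (h : IsAttach e t x A t') (hC : C ∈ t.nodes) (hD : D ∈ t.nodes)
    (hDC : lift x A D ∈ t'.children (lift x A C)) : D ∈ t.children C := by
  have hxC := h.notMem_of_mem hC
  have hxD := h.notMem_of_mem hD
  obtain ⟨-, hlt, hmax⟩ := mem_children.1 hDC
  refine mem_children.2 ⟨hD, (lift_ssubset_lift_iff hxD hxC).1 hlt, fun E hE hDE hEC => ?_⟩
  have hxE := h.notMem_of_mem hE
  rcases hmax _ (h.lift_mem hE) ((lift_subset_lift_iff hxD hxE).2 hDE)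
    ((lift_subset_lift_iff hxE hxC).2 hEC) with h3 | h3
  · exact Or.inl (lift_inj hxE hxD h3)
  · exact Or.inr (lift_inj hxE hxC h3)

lemma lift_self_between (h : IsAttach e t x A t') (hC : C ∈ t.nodes) (hCA : C ≠ A) (hAC : A ⊆ C)
    (hD : D ⊆ lift x A A) (hD' : D ≠ lift x A A) : D ∉ t'.children (lift x A C) := by
  intro h'
  have hxA := h.notMem_of_mem h.mem
  have hxC := h.notMem_of_mem hC
  rcases (mem_children.1 h').2.2 _ (h.lift_mem h.mem) hD ((lift_subset_lift_iff hxA hxC).2 hAC)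
    with h3 | h3
  · exact hD' h3.symm
  · exact hCA (lift_inj hxA hxC h3).symm

lemma children_lift (h : IsAttach e t x A t') (hC : C ∈ t.nodes) (hCA : C ≠ A) :
    t'.children (lift x A C) = (t.children C).image (lift x A) := by
  have hxA := h.notMem_of_mem h.mem
  ext D
  rw [Finset.mem_image]
  constructor
  · intro hD
    rcases (h.nodes D).1 (mem_nodes_of_mem_children hD) with ⟨-, rfl⟩ | rfl | ⟨D, hD', rfl⟩
    · exact absurd hD (h.lift_self_between hC hCA
        (h.subset_lift_iff.1 (ssubset_of_mem_children hD).subset) subset_lift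
        (h.lift_ne_self h.mem).symm)
    · refine absurd hD (h.lift_self_between hC hCA
        ((h.singleton_subset_lift_iff hC).1 (ssubset_of_mem_children hD).subset)
        ((h.singleton_subset_lift_iff h.mem).2 subset_rfl) fun h' => ?_)
      exact h.not_lift_subset_singleton h.mem h'.symm.subset
    · exact ⟨D, h.mem_children_of_lift hC hD' hD, rfl⟩
  · rintro ⟨D, hD, rfl⟩
    exact h.lift_mem_children hC (Or.inr hCA) hD

lemma singleton_mem_children (h : IsAttach e t x A t') :
    {x} ∈ t'.children (lift x A A) := by
  refine mem_children.2 ⟨(h.nodes _).2 (Or.inr (Or.inl rfl)), ?_, fun E hE hxE hEA => ?_⟩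
  · refine Finset.ssubset_iff_subset_ne.2 ⟨(h.singleton_subset_lift_iff h.mem).2 subset_rfl, ?_⟩
    exact fun h' => h.not_lift_subset_singleton h.mem h'.symm.subset
  · rcases (h.nodes E).1 hE with ⟨-, rfl⟩ | rfl | ⟨E, hE', rfl⟩
    · exact absurd (hxE (Finset.mem_singleton_self x)) (h.notMem_of_mem h.mem)
    · exact Or.inl rfl
    · have h1 := (h.singleton_subset_lift_iff hE').1 hxE
      have h2 := (lift_subset_lift_iff (h.notMem_of_mem hE') (h.notMem_of_mem h.mem)).1 hEA
      exact Or.inr (by rw [h2.antisymm h1])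

lemma children_lift_self_of_vertex (h : IsAttach e t x A t') (he : ¬ e) :
    t'.children (lift x A A) = insert {x} ((t.children A).image (lift x A)) := by
  ext D
  rw [Finset.mem_insert, Finset.mem_image]
  constructor
  · intro hD
    rcases (h.nodes D).1 (mem_nodes_of_mem_children hD) with ⟨h', -⟩ | rfl | ⟨D, hD', rfl⟩
    · exact absurd h' he
    · exact Or.inl rfl
    · exact Or.inr ⟨D, h.mem_children_of_lift h.mem hD' hD, rfl⟩
  · rintro (rfl | ⟨D, hD, rfl⟩)
    · exact h.singleton_mem_children
    · exact h.lift_mem_children h.mem (Or.inl he) hD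

lemma children_lift_self_of_edge (h : IsAttach e t x A t') (he : e) :
    t'.children (lift x A A) = {A, {x}} := by
  have hA : A ∈ t'.children (lift x A A) := by
    refine mem_children.2 ⟨(h.nodes _).2 (Or.inl ⟨he, rfl⟩), Finset.ssubset_iff_subset_ne.2
      ⟨subset_lift, (h.lift_ne_self h.mem).symm⟩, fun E hE hAE hEA => ?_⟩
    rcases (h.nodes E).1 hE with ⟨-, rfl⟩ | rfl | ⟨E, hE', rfl⟩
    · exact Or.inl rfl
    · refine absurd ?_ (h.notMem_of_mem h.mem)
      obtain ⟨i, hi⟩ := t.nonempty_of_mem A h.mem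
      have := Finset.mem_singleton.1 (hAE hi)
      exact this ▸ hi
    · have h2 := (lift_subset_lift_iff (h.notMem_of_mem hE') (h.notMem_of_mem h.mem)).1 hEA
      exact Or.inr (by rw [h2.antisymm (h.subset_lift_iff.1 hAE)])
  ext D
  rw [Finset.mem_insert, Finset.mem_singleton]
  constructor
  · intro hD
    -- a child of `A ∪ {x}` contains `x` or an element of `A`
    obtain ⟨i, hi⟩ := t'.nonempty_of_mem D (mem_nodes_of_mem_children hD)
    have hi' := (ssubset_of_mem_children hD).subset hi
    rw [lift_of_subset subset_rfl, Finset.mem_insert] at hi'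
    rcases hi' with rfl | hi'
    · exact Or.inr (eq_of_mem_children hD h.singleton_mem_children hi (by simp))
    · exact Or.inl (eq_of_mem_children hD hA hi hi')
  · rintro (rfl | rfl)
    · exact hA
    · exact h.singleton_mem_children

/-- The vertices strictly above `A` are not affected by the new leaf. -/
lemma children_self (h : IsAttach e t x A t') :
    t'.children A = t.children A := by
  have hlt : ∀ {D}, D ⊂ A → lift x A D = D := fun hD => lift_of_not_subset hD.not_subset
  ext D
  constructor
  · intro hD
    obtain ⟨hDn, hDA, hmax⟩ := mem_children.1 hD
    rcases (h.nodes D).1 hDn with ⟨-, rfl⟩ | rfl | ⟨D, hD', rfl⟩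
    · exact absurd rfl hDA.ne
    · exact absurd (hDA.subset (Finset.mem_singleton_self x)) (h.notMem_of_mem h.mem)
    · have hD1 : lift x A D = D := lift_of_not_subset fun h' =>
        (h.notMem_of_mem h.mem) (hDA.subset ((mem_lift_self_iff (h.notMem_of_mem hD')).2 h'))
      rw [hD1] at hDA hmax ⊢
      refine mem_children.2 ⟨hD', hDA, fun E hE hDE hEA => ?_⟩
      by_cases hEA' : E = A
      · exact Or.inr hEA'
      · have hE1 := hlt (Finset.ssubset_iff_subset_ne.2 ⟨hEA, hEA'⟩)
        exact hmax E (hE1 ▸ h.lift_mem hE) hDE hEA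
  · intro hD
    obtain ⟨hDn, hDA, hmax⟩ := mem_children.1 hD
    refine mem_children.2 ⟨hlt hDA ▸ h.lift_mem hDn, hDA, fun E hE hDE hEA => ?_⟩
    rcases (h.nodes E).1 hE with ⟨-, rfl⟩ | rfl | ⟨E, hE', rfl⟩
    · exact Or.inr rfl
    · exact absurd (hEA (Finset.mem_singleton_self x)) (h.notMem_of_mem h.mem)
    · have hE1 : lift x A E = E := lift_of_not_subset fun h' =>
        (h.notMem_of_mem h.mem) (hEA ((mem_lift_self_iff (h.notMem_of_mem hE')).2 h'))
      rw [hE1] at hDE hEA ⊢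
      exact hmax E hE' hDE hEA

/-! ### The subtrees after attaching a leaf -/

lemma lift_leaves (h : IsAttach e t x A t') : lift x A t.leaves = t'.leaves := by
  rw [h.leaves, lift_of_subset (t.subset_of_mem A h.mem)]

lemma sub_singleton (h : IsAttach e t x A t') : t'.sub {x} = single x := by
  have hx : {x} ∈ t'.nodes := (h.nodes _).2 (Or.inr (Or.inl rfl))
  refine LTree.ext (sub_leaves hx) (Finset.ext fun B => ?_)
  rw [mem_sub_nodes hx]
  simp only [single, Finset.mem_singleton]
  refine ⟨fun hB => ?_, fun hB => by simp [hB, hx]⟩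
  exact ((t'.nonempty_of_mem B hB.1).subset_singleton_iff).1 hB.2

/-- A subtree in which the new leaf does not lie is unchanged. -/
lemma sub_of_not_subset (h : IsAttach e t x A t') (hC : C ∈ t.nodes) (hAC : ¬ A ⊆ C) :
    t'.sub C = t.sub C := by
  have hC' : C ∈ t'.nodes := lift_of_not_subset (x := x) hAC ▸ h.lift_mem hC
  refine LTree.ext (by rw [sub_leaves hC, sub_leaves hC']) (Finset.ext fun B => ?_)
  rw [mem_sub_nodes hC', mem_sub_nodes hC]
  constructor
  · rintro ⟨hB, hBC⟩
    refine ⟨?_, hBC⟩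
    rcases (h.nodes B).1 hB with ⟨-, rfl⟩ | rfl | ⟨B, hB', rfl⟩
    · exact absurd hBC hAC
    · exact absurd (hBC (Finset.mem_singleton_self x)) (h.notMem_of_mem hC)
    · rw [lift_of_not_subset fun h' => hAC ((h'.trans subset_lift).trans hBC)]
      exact hB'
  · rintro ⟨hB, hBC⟩
    refine ⟨?_, hBC⟩
    rw [← lift_of_not_subset (x := x) fun h' => hAC (h'.trans hBC)]
    exact h.lift_mem hB

/-- The new leaf is attached within the subtree that contains the selected site. -/
lemma isAttach_sub (h : IsAttach e t x A t') (hC : C ∈ t.nodes) (hAC : A ⊆ C) :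
    IsAttach e (t.sub C) x A (t'.sub (insert x C)) := by
  have hC' : insert x C ∈ t'.nodes := lift_of_subset (x := x) hAC ▸ h.lift_mem hC
  have hxC := h.notMem_of_mem hC
  refine ⟨by rwa [sub_leaves hC], (mem_sub_nodes hC).2 ⟨h.mem, hAC⟩,
    by rw [sub_leaves hC, sub_leaves hC'], fun B => ?_⟩
  rw [mem_sub_nodes hC', h.nodes]
  constructor
  · rintro ⟨h1 | h1 | ⟨B, hB, rfl⟩, h2⟩
    · exact Or.inl h1
    · exact Or.inr (Or.inl h1)
    · refine Or.inr (Or.inr ⟨B, (mem_sub_nodes hC).2 ⟨hB, ?_⟩, rfl⟩)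
      rw [← lift_of_subset (x := x) hAC] at h2
      exact (lift_subset_lift_iff (h.notMem_of_mem hB) hxC).1 h2
  · rintro (⟨h1, rfl⟩ | rfl | ⟨B, hB, rfl⟩)
    · exact ⟨Or.inl ⟨h1, rfl⟩, hAC.trans (Finset.subset_insert _ _)⟩
    · exact ⟨Or.inr (Or.inl rfl), by simp⟩
    · rw [mem_sub_nodes hC] at hB
      refine ⟨Or.inr (Or.inr ⟨B, hB.1, rfl⟩), ?_⟩
      rw [← lift_of_subset (x := x) hAC]
      exact (lift_subset_lift_iff (h.notMem_of_mem hB.1) hxC).2 hB.2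

lemma sub_leaves_eq (h : IsAttach e t x t.leaves t') (he : e) : t'.sub t.leaves = t := by
  have hC' : t.leaves ∈ t'.nodes := (h.nodes _).2 (Or.inl ⟨he, rfl⟩)
  refine LTree.ext (sub_leaves hC') (Finset.ext fun B => ?_)
  rw [mem_sub_nodes hC', h.nodes]
  constructor
  · rintro ⟨⟨-, rfl⟩ | rfl | ⟨B, hB, rfl⟩, h2⟩
    · exact t.top_mem
    · exact absurd (h2 (Finset.mem_singleton_self x)) h.notMem
    · rwa [lift_of_not_subset fun h' =>
        h.notMem (h2 ((mem_lift_self_iff (h.notMem_of_mem hB)).2 h'))]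
  · intro hB
    refine ⟨?_, t.subset_of_mem B hB⟩
    by_cases h' : B = t.leaves
    · exact Or.inl ⟨he, h'⟩
    · refine Or.inr (Or.inr ⟨B, hB, lift_of_not_subset fun h'' => h' ?_⟩)
      exact (t.subset_of_mem B hB).antisymm h''

/-- The subtrees after the root edge has been selected. -/
lemma subtrees_of_edge (h : IsAttach e t x t.leaves t') (he : e) :
    t'.subtrees = {Shape.mk t, Shape.mk (single x)} := by
  have hne : t.leaves ≠ {x} := by
    intro h'
    exact h.notMem (h' ▸ Finset.mem_singleton_self x)
  rw [LTree.subtrees, ← h.lift_leaves, h.children_lift_self_of_edge he,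
    Finset.insert_val_of_notMem (by simpa using hne)]
  simp [h.sub_leaves_eq he, h.sub_singleton]

/-- The subtrees after the branch point adjacent to the root has been selected. -/
lemma subtrees_of_vertex (h : IsAttach e t x t.leaves t') (he : ¬ e) :
    t'.subtrees = Shape.mk (single x) ::ₘ t.subtrees := by
  have himg : (t.children t.leaves).image (lift x t.leaves) = t.children t.leaves := by
    conv_rhs => rw [← Finset.image_id (s := t.children t.leaves)]
    exact Finset.image_congr fun C hC =>
      lift_of_not_subset (ssubset_of_mem_children hC).not_subset
  have hx : {x} ∉ t.children t.leaves := fun h' =>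
    h.notMem_of_mem (mem_nodes_of_mem_children h') (Finset.mem_singleton_self x)
  rw [LTree.subtrees, ← h.lift_leaves, h.children_lift_self_of_vertex he, himg,
    Finset.insert_val_of_notMem hx, Multiset.map_cons, h.sub_singleton, LTree.subtrees]
  congr 1
  refine Multiset.map_congr rfl fun C hC => ?_
  rw [h.sub_of_not_subset (mem_nodes_of_mem_children hC) (ssubset_of_mem_children hC).not_subset]

/-- The subtrees after a site within the subtree above `C` has been selected. -/
lemma subtrees_of_subset (h : IsAttach e t x A t') (hC : C ∈ t.children t.leaves) (hAC : A ⊆ C) :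
    t'.subtrees = Shape.mk (t'.sub (insert x C)) ::ₘ
      ((t.children t.leaves).erase C).val.map fun D => Shape.mk (t.sub D) := by
  have hA : t.leaves ≠ A := by
    rintro rfl
    exact (ssubset_of_mem_children hC).not_subset hAC
  have hinj : Set.InjOn (lift x A) (t.children t.leaves : Set (Finset ℕ)) := fun D hD E hE hDE =>
    lift_inj (h.notMem_of_mem (mem_nodes_of_mem_children hD))
      (h.notMem_of_mem (mem_nodes_of_mem_children hE)) hDE
  rw [LTree.subtrees, ← h.lift_leaves, h.children_lift t.top_mem hA,
    Finset.image_val_of_injOn hinj, Multiset.map_map]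
  conv_lhs => rw [← Finset.insert_erase hC]
  rw [Finset.insert_val_of_notMem (Finset.notMem_erase _ _), Multiset.map_cons,
    Function.comp, lift_of_subset hAC]
  congr 1
  refine Multiset.map_congr rfl fun D hD => ?_
  obtain ⟨hDC, hD⟩ := Finset.mem_erase.1 hD
  have hAD : ¬ A ⊆ D := by
    intro hAD
    obtain ⟨i, hi⟩ := t.nonempty_of_mem A h.mem
    exact hDC (eq_of_mem_children hD hC (hAD hi) (hAC hi))
  rw [Function.comp, lift_of_not_subset hAD,
    h.sub_of_not_subset (mem_nodes_of_mem_children hD) hAD]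

lemma card_leaves (h : IsAttach e t x A t') : t'.leaves.card = t.leaves.card + 1 := by
  rw [h.leaves, Finset.card_insert_of_notMem h.notMem]

end IsAttach

end LTree

end AlphaGamma

/-! ### The growth step on unlabelled trees -/

namespace AlphaGamma

open Finset

open scoped ENNReal

/-- The unlabelled tree with one leaf. -/
def Shape.leaf : Shape := Shape.mk (LTree.single 1)

namespace LTree

variable {t t' : LTree} {A B C D : Finset ℕ} {x : ℕ} {α γ : ℝ}

lemma eq_single_of_card_eq_one (h : t.leaves.card = 1) : ∃ i, t = single i := by
  obtain ⟨i, hi⟩ := Finset.card_eq_one.1 h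
  refine ⟨i, LTree.ext hi (Finset.ext fun B => ?_)⟩
  simp only [single, Finset.mem_singleton]
  constructor
  · intro hB
    exact ((t.nonempty_of_mem B hB).subset_singleton_iff).1 (hi ▸ t.subset_of_mem B hB)
  · rintro rfl
    exact hi ▸ t.top_mem

lemma mk_single (i : ℕ) : Shape.mk (single i) = Shape.leaf :=
  Relabels.mk_eq (f := fun _ => 1) ⟨by simp [single], by simp [single], by simp [single]⟩

lemma notMem_leaves_sub (hx : x ∉ t.leaves) (hC : C ∈ t.children t.leaves) : x ∉ (t.sub C).leaves := by
  rw [sub_leaves (mem_nodes_of_mem_children hC)]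
  exact notMem_of_mem hx (mem_nodes_of_mem_children hC)

/-- `insertEdge` without the proofs in its arguments; `t` itself if `x` is not a new label or `A` is
not a vertex. -/
def attachEdge (t : LTree) (x : ℕ) (A : Finset ℕ) : LTree :=
  if h : x ∉ t.leaves ∧ A ∈ t.nodes then t.insertEdge x h.1 A h.2 else t

/-- `insertVertex` without the proofs in its arguments; `t` itself if `x` is not a new label or `A`
is not a branch point. -/
def attachVertex (t : LTree) (x : ℕ) (A : Finset ℕ) : LTree :=
  if h : x ∉ t.leaves ∧ A ∈ t.branchPoints then t.insertVertex x h.1 A h.2 else t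

lemma attachEdge_eq (hx : x ∉ t.leaves) (hA : A ∈ t.nodes) :
    t.attachEdge x A = t.insertEdge x hx A hA := dif_pos ⟨hx, hA⟩

lemma attachVertex_eq (hx : x ∉ t.leaves) (hA : A ∈ t.branchPoints) :
    t.attachVertex x A = t.insertVertex x hx A hA := dif_pos ⟨hx, hA⟩

lemma isAttach_attachEdge (hx : x ∉ t.leaves) (hA : A ∈ t.nodes) :
    IsAttach True t x A (t.attachEdge x A) := by
  rw [attachEdge_eq hx hA]
  exact isAttach_insertEdge hx hA

lemma isAttach_attachVertex (hx : x ∉ t.leaves) (hA : A ∈ t.branchPoints) :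
    IsAttach False t x A (t.attachVertex x A) := by
  rw [attachVertex_eq hx hA]
  exact isAttach_insertVertex hx hA

/-- The weight of the edge that leads to the vertex `A`. -/
noncomputable def edgeWeight (α γ : ℝ) (A : Finset ℕ) : ℝ≥0∞ :=
  ENNReal.ofReal (if A.card = 1 then 1 - α else γ)

/-- The weight of the branch point `A`. -/
noncomputable def vertexWeight (α γ : ℝ) (t : LTree) (A : Finset ℕ) : ℝ≥0∞ :=
  ENNReal.ofReal ((((t.children A).card : ℝ) - 1) * α - γ)

/-- The sum of `φ` over the shapes of the trees that arise from `t` by attaching a leaf `x`, each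
counted with the weight of the selected site.  This is the expectation of `φ` after a growth step,
up to the total weight. -/
noncomputable def growSum (α γ : ℝ) (t : LTree) (x : ℕ) (φ : Shape → ℝ≥0∞) : ℝ≥0∞ :=
  ∑ A ∈ t.nodes, edgeWeight α γ A * φ (Shape.mk (t.attachEdge x A)) +
    ∑ A ∈ t.branchPoints, vertexWeight α γ t A * φ (Shape.mk (t.attachVertex x A))

lemma sum_site (t : LTree) (φ : LTree → ℝ≥0∞) :
    ∑ s : t.Site, ENNReal.ofReal (t.weight α γ s) * φ (t.insertAt s) =
      ∑ A ∈ t.nodes, edgeWeight α γ A * φ (t.attachEdge t.nextLabel A) +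
        ∑ A ∈ t.branchPoints, vertexWeight α γ t A * φ (t.attachVertex t.nextLabel A) := by
  rw [Fintype.sum_sum_type]
  congr 1
  · rw [← Finset.sum_coe_sort t.nodes]
    refine Finset.sum_congr rfl fun A _ => ?_
    rw [attachEdge_eq t.nextLabel_notMem A.2]
    rfl
  · rw [← Finset.sum_coe_sort t.branchPoints]
    refine Finset.sum_congr rfl fun A _ => ?_
    rw [attachVertex_eq t.nextLabel_notMem A.2]
    rfl

lemma IsAttach.mk_eq {e : Prop} (h : IsAttach e t x A t') :
    Shape.mk t' = Shape.joinMultiset t'.subtrees := by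
  rw [← Shape.subtrees_mk, Shape.joinMultiset_subtrees]
  rw [Shape.numLeaves_mk, h.card_leaves]
  have := t.leaves_nonempty.card_pos
  omega

lemma growSum_single {i : ℕ} (hx : x ≠ i) (φ : Shape → ℝ≥0∞) :
    growSum α γ (single i) x φ =
      ENNReal.ofReal (1 - α) * φ (Shape.joinMultiset {Shape.leaf, Shape.leaf}) := by
  have hb : (single i).branchPoints = ∅ := by
    ext A
    rw [mem_branchPoints]
    simp only [single, Finset.mem_singleton, Finset.notMem_empty, iff_false, not_and]
    rintro rfl
    simp
  have hA := isAttach_attachEdge (t := single i) (x := x) (by simpa [single] using hx)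
    (single i).top_mem
  rw [growSum, hb, Finset.sum_empty, add_zero]
  change ∑ A ∈ ({{i}} : Finset (Finset ℕ)), _ = _
  rw [Finset.sum_singleton]
  change _ * φ (Shape.mk ((single i).attachEdge x (single i).leaves)) = _
  rw [hA.mk_eq, hA.subtrees_of_edge trivial, mk_single, mk_single]
  simp [edgeWeight]

/-- The growth step acts at the root edge, at the common ancestor, or within one of the subtrees. -/
lemma growSum_eq (hx : x ∉ t.leaves) (h2 : 2 ≤ t.leaves.card) (φ : Shape → ℝ≥0∞) :
    growSum α γ t x φ =
      ENNReal.ofReal γ * φ (Shape.joinMultiset {Shape.mk t, Shape.leaf}) +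
      ENNReal.ofReal (((t.subtrees.card : ℝ) - 1) * α - γ) *
        φ (Shape.joinMultiset (Shape.leaf ::ₘ t.subtrees)) +
      ∑ C ∈ t.children t.leaves, growSum α γ (t.sub C) x fun s =>
        φ (Shape.joinMultiset (s ::ₘ
          ((t.children t.leaves).erase C).val.map fun D => Shape.mk (t.sub D))) := by
  have htop : t.leaves ∈ t.branchPoints := mem_branchPoints.2 ⟨t.top_mem, h2⟩
  have hE := isAttach_attachEdge hx t.top_mem
  have hV := isAttach_attachVertex hx htop
  rw [growSum, sum_nodes, sum_branchPoints t h2, hE.mk_eq, hE.subtrees_of_edge trivial, hV.mk_eq,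
    hV.subtrees_of_vertex not_false, mk_single]
  have hsub : ∀ C ∈ t.children t.leaves,
      (growSum α γ (t.sub C) x fun s => φ (Shape.joinMultiset (s ::ₘ
          ((t.children t.leaves).erase C).val.map fun D => Shape.mk (t.sub D)))) =
      ∑ A ∈ (t.sub C).nodes, edgeWeight α γ A * φ (Shape.mk (t.attachEdge x A)) +
      ∑ A ∈ (t.sub C).branchPoints, vertexWeight α γ t A * φ (Shape.mk (t.attachVertex x A)) := by
    intro C hC
    have hCn := mem_nodes_of_mem_children hC
    have hxC : x ∉ (t.sub C).leaves := by
      rw [sub_leaves hCn]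
      exact notMem_of_mem hx hCn
    rw [growSum]
    congr 1
    · refine Finset.sum_congr rfl fun A hA => ?_
      obtain ⟨hAn, hAC⟩ := (mem_sub_nodes hCn).1 hA
      have h := isAttach_attachEdge hx hAn
      rw [h.mk_eq, h.subtrees_of_subset hC hAC,
        (h.isAttach_sub hCn hAC).unique (isAttach_attachEdge hxC hA)]
    · refine Finset.sum_congr rfl fun A hA => ?_
      obtain ⟨hAn, hAC⟩ := (mem_sub_branchPoints hCn).1 hA
      have h := isAttach_attachVertex hx hAn
      rw [h.mk_eq, h.subtrees_of_subset hC hAC,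
        (h.isAttach_sub hCn hAC).unique (isAttach_attachVertex hxC hA), vertexWeight,
        vertexWeight, children_sub hCn hAC]
  rw [Finset.sum_congr rfl hsub, Finset.sum_add_distrib]
  have hw : edgeWeight α γ t.leaves = ENNReal.ofReal γ := by
    rw [edgeWeight, if_neg (by omega)]
  have hw' : vertexWeight α γ t t.leaves =
      ENNReal.ofReal (((t.subtrees.card : ℝ) - 1) * α - γ) := by
    rw [vertexWeight, subtrees, Multiset.card_map, Finset.card_val]
  rw [hw, hw']
  ring

end LTree

open Classical in
/-- The sum over the elements `s` of a multiset `M`, where the operation `V` is applied to `s` while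
the rest of `M` is kept fixed.  For `V` the growth step, this is the growth step in a forest. -/
noncomputable def multisetDeriv {X : Type*}
    (V : X → (X → ℝ≥0∞) → ℝ≥0∞) (H : Multiset X → ℝ≥0∞) (M : Multiset X) : ℝ≥0∞ :=
  (M.map fun s => V s fun s' => H (s' ::ₘ M.erase s)).sum

open Classical in
lemma multisetDeriv_cons {X : Type*} (V : X → (X → ℝ≥0∞) → ℝ≥0∞)
    (H : Multiset X → ℝ≥0∞) (s : X) (M : Multiset X) :
    multisetDeriv V H (s ::ₘ M) =
      V s (fun s' => H (s' ::ₘ M)) + multisetDeriv V (fun N => H (s ::ₘ N)) M := by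
  rw [multisetDeriv, Multiset.map_cons, Multiset.sum_cons, Multiset.erase_cons_head, multisetDeriv]
  congr 2
  refine Multiset.map_congr rfl fun u hu => ?_
  congr 1
  funext s'
  rw [Multiset.erase_cons_tail_of_mem hu, Multiset.cons_swap]

namespace Shape

open LTree Classical

variable {α γ : ℝ}

/-- `growSum` on unlabelled trees. -/
noncomputable def growSum (α γ : ℝ) (s : Shape) (φ : Shape → ℝ≥0∞) : ℝ≥0∞ :=
  LTree.growSum α γ (Quotient.out s) (LTree.nextLabel (Quotient.out s)) φ

/-- The last sum in `LTree.growSum_eq` in terms of the multiset of subtrees. -/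
lemma sum_children_eq_multisetDeriv (t : LTree) (x : ℕ) (H : Multiset Shape → ℝ≥0∞)
    (h : ∀ C ∈ t.children t.leaves, ∀ ψ,
      LTree.growSum α γ (t.sub C) x ψ = growSum α γ (mk (t.sub C)) ψ) :
    (∑ C ∈ t.children t.leaves, LTree.growSum α γ (t.sub C) x fun s =>
      H (s ::ₘ ((t.children t.leaves).erase C).val.map fun D => mk (t.sub D))) =
      multisetDeriv (growSum α γ) H t.subtrees := by
  rw [multisetDeriv, LTree.subtrees, Multiset.map_map]
  refine congrArg Multiset.sum (Multiset.map_congr rfl fun C hC => ?_)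
  rw [Function.comp, h C hC, Finset.erase_val, Multiset.map_erase_of_mem _ _ hC]

/-- The sums in `growSum_eq` depend on the shape of the tree only. -/
lemma growSum_congr {t t' : LTree} {x x' : ℕ} (hx : x ∉ t.leaves) (hx' : x' ∉ t'.leaves)
    (h : mk t = mk t') (φ : Shape → ℝ≥0∞) :
    LTree.growSum α γ t x φ = LTree.growSum α γ t' x' φ := by
  have key : ∀ n (t t' : LTree) (x x' : ℕ) (φ : Shape → ℝ≥0∞), t.leaves.card = n →
      x ∉ t.leaves → x' ∉ t'.leaves → mk t = mk t' →
      LTree.growSum α γ t x φ = LTree.growSum α γ t' x' φ := by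
    intro n
    induction n using Nat.strong_induction_on with
    | _ n ih =>
      intro t t' x x' φ hn hx hx' h
      have hn' : t'.leaves.card = n := by
        rw [← hn, ← numLeaves_mk, ← numLeaves_mk, h]
      have hpos := t.leaves_nonempty.card_pos
      by_cases h1 : n = 1
      · obtain ⟨i, rfl⟩ := eq_single_of_card_eq_one (hn.trans h1)
        obtain ⟨i', rfl⟩ := eq_single_of_card_eq_one (hn'.trans h1)
        rw [growSum_single (by simpa [single] using hx),
          growSum_single (by simpa [single] using hx')]
      have hsub : t.subtrees = t'.subtrees := congrArg subtrees h
      have hsum : ∀ (t : LTree) (x : ℕ), t.leaves.card = n → x ∉ t.leaves →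
          ∀ C ∈ t.children t.leaves, ∀ ψ,
            LTree.growSum α γ (t.sub C) x ψ = growSum α γ (mk (t.sub C)) ψ :=
        fun t x hn hx C hC ψ => ih _ (hn ▸ card_leaves_sub_lt hC) _ _ _ _ _ rfl
          (notMem_leaves_sub hx hC) (nextLabel_notMem _) (mk_out _).symm
      rw [growSum_eq hx (by omega), growSum_eq hx' (by omega),
        sum_children_eq_multisetDeriv t x (fun M => φ (joinMultiset M)) (hsum t x hn hx),
        sum_children_eq_multisetDeriv t' x' (fun M => φ (joinMultiset M)) (hsum t' x' hn' hx'),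
        h, hsub]
  exact key _ t t' x x' φ rfl hx hx' h

lemma growSum_mk {t : LTree} {x : ℕ} (hx : x ∉ t.leaves) (φ : Shape → ℝ≥0∞) :
    growSum α γ (mk t) φ = LTree.growSum α γ t x φ :=
  growSum_congr (nextLabel_notMem _) hx (mk_out _) φ

lemma growSum_leaf (φ : Shape → ℝ≥0∞) :
    growSum α γ leaf φ = ENNReal.ofReal (1 - α) * φ (joinMultiset {leaf, leaf}) := by
  rw [leaf, growSum_mk (x := 2) (by simp [single]), growSum_single (by norm_num)]
  rfl

lemma growSum_eq (s : Shape) (h2 : 2 ≤ s.numLeaves) (φ : Shape → ℝ≥0∞) :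
    growSum α γ s φ = ENNReal.ofReal γ * φ (joinMultiset {s, leaf}) +
      ENNReal.ofReal (((s.subtrees.card : ℝ) - 1) * α - γ) *
        φ (joinMultiset (leaf ::ₘ s.subtrees)) +
      multisetDeriv (growSum α γ) (fun M => φ (joinMultiset M)) s.subtrees := by
  obtain ⟨t, rfl⟩ := s.exists_mk_eq
  have hx := nextLabel_notMem t
  rw [growSum_mk hx, LTree.growSum_eq hx h2, subtrees_mk,
    sum_children_eq_multisetDeriv t _ (fun M => φ (joinMultiset M)) fun C hC ψ =>
      (growSum_mk (notMem_leaves_sub hx hC) ψ).symm]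

lemma growSum_joinMultiset {M : Multiset Shape} (h2 : 2 ≤ M.card) (φ : Shape → ℝ≥0∞) :
    growSum α γ (joinMultiset M) φ =
      ENNReal.ofReal γ * φ (joinMultiset {joinMultiset M, leaf}) +
      ENNReal.ofReal (((M.card : ℝ) - 1) * α - γ) * φ (joinMultiset (leaf ::ₘ M)) +
      multisetDeriv (growSum α γ) (fun N => φ (joinMultiset N)) M := by
  rw [growSum_eq _ (two_le_numLeaves_joinMultiset h2), subtrees_joinMultiset h2]

end Shape

end AlphaGamma

/-! ### Expectations -/

namespace AlphaGamma

open Finset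

open scoped ENNReal

section Expect

variable {X Y : Type*}

/-- The expectation of a function with values in `[0, ∞]` under a discrete distribution. -/
noncomputable def expect (p : PMF X) (φ : X → ℝ≥0∞) : ℝ≥0∞ := ∑' a, p a * φ a

lemma expect_pure (a : X) (φ : X → ℝ≥0∞) : expect (PMF.pure a) φ = φ a := by
  classical
  rw [expect, tsum_eq_single a]
  · simp
  · intro b hb
    simp [hb]

lemma expect_const (p : PMF X) (c : ℝ≥0∞) : expect p (fun _ => c) = c := by
  rw [expect, ENNReal.tsum_mul_right, p.tsum_coe, one_mul]

lemma expect_add (p : PMF X) (φ ψ : X → ℝ≥0∞) :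
    expect p (fun a => φ a + ψ a) = expect p φ + expect p ψ := by
  simp only [expect, mul_add, ENNReal.tsum_add]

lemma expect_mul_left (p : PMF X) (c : ℝ≥0∞) (φ : X → ℝ≥0∞) :
    expect p (fun a => c * φ a) = c * expect p φ := by
  simp only [expect, ← ENNReal.tsum_mul_left]
  exact tsum_congr fun a => by ring

lemma expect_sum {ι : Type*} (p : PMF X) (s : Finset ι) (φ : ι → X → ℝ≥0∞) :
    expect p (fun a => ∑ i ∈ s, φ i a) = ∑ i ∈ s, expect p (φ i) := by
  classical
  induction s using Finset.induction_on with
  | empty => simpa using expect_const p 0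
  | insert i s hi ih => simp only [Finset.sum_insert hi, expect_add, ih]

lemma expect_multiset_sum {ι : Type*} (p : PMF X) (M : Multiset ι) (φ : ι → X → ℝ≥0∞) :
    expect p (fun a => (M.map fun i => φ i a).sum) = (M.map fun i => expect p (φ i)).sum := by
  induction M using Multiset.induction_on with
  | empty => simpa using expect_const p 0
  | cons i M ih => simp only [Multiset.map_cons, Multiset.sum_cons, expect_add, ih]

lemma expect_bind (p : PMF X) (f : X → PMF Y) (φ : Y → ℝ≥0∞) :
    expect (p.bind f) φ = expect p fun a => expect (f a) φ := by
  simp only [expect, PMF.bind_apply, ← ENNReal.tsum_mul_right, ← ENNReal.tsum_mul_left]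
  rw [ENNReal.tsum_comm]
  exact tsum_congr fun a => tsum_congr fun b => by ring

lemma expect_map (p : PMF X) (f : X → Y) (φ : Y → ℝ≥0∞) :
    expect (p.map f) φ = expect p fun a => φ (f a) := by
  rw [PMF.map, expect_bind]
  simp only [Function.comp, expect_pure]

lemma expect_comm (p : PMF X) (q : PMF Y) (φ : X → Y → ℝ≥0∞) :
    expect p (fun a => expect q (φ a)) = expect q fun b => expect p fun a => φ a b := by
  simp only [expect, ← ENNReal.tsum_mul_left]
  rw [ENNReal.tsum_comm]
  exact tsum_congr fun a => tsum_congr fun b => by ring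

lemma expect_congr {p : PMF X} {φ ψ : X → ℝ≥0∞} (h : ∀ a ∈ p.support, φ a = ψ a) :
    expect p φ = expect p ψ := by
  refine tsum_congr fun a => ?_
  by_cases ha : a ∈ p.support
  · rw [h a ha]
  · rw [PMF.mem_support_iff, not_not] at ha
    simp [ha]

open Classical in
lemma expect_indicator (p : PMF X) (a : X) :
    expect p (fun b => if b = a then 1 else 0) = p a := by
  rw [expect, tsum_eq_single a]
  · simp
  · intro b hb
    simp [hb]

lemma ext_of_expect {p q : PMF X} (h : ∀ φ, expect p φ = expect q φ) : p = q := by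
  classical
  ext a
  rw [← expect_indicator p, h, expect_indicator]

end Expect

/-! ### The total weight -/

namespace LTree

variable {α γ : ℝ} {t : LTree} {x : ℕ}

lemma growSum_expect {Y : Type*} (q : PMF Y) (F : Shape → Y → ℝ≥0∞) :
    growSum α γ t x (fun s => expect q (F s)) = expect q fun y => growSum α γ t x fun s => F s y := by
  simp only [growSum, expect_add, expect_sum, expect_mul_left]

end LTree

/-- The second part keeps the right side of the first from being truncated at `0`. -/
lemma sum_ofReal_sub {α : ℝ} (hα1 : α ≤ 1) (M : Multiset ℕ) (hM : ∀ m ∈ M, 1 ≤ m) :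
    (M.map fun m : ℕ => ENNReal.ofReal ((m : ℝ) - α)).sum =
      ENNReal.ofReal ((M.sum : ℝ) - M.card * α) ∧ (M.card : ℝ) ≤ M.sum := by
  induction M using Multiset.induction_on with
  | empty => simp
  | cons m M ih =>
    obtain ⟨h1, h2⟩ := ih fun k hk => hM k (Multiset.mem_cons_of_mem hk)
    have hm : (1 : ℝ) ≤ m := by exact_mod_cast hM m (Multiset.mem_cons_self _ _)
    have hc : (0 : ℝ) ≤ M.card := Nat.cast_nonneg _
    have h3 : (M.card : ℝ) * α ≤ M.card := mul_le_of_le_one_right hc hα1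
    rw [Multiset.map_cons, Multiset.sum_cons, h1, ← ENNReal.ofReal_add (by linarith) (by linarith),
      Multiset.sum_cons, Multiset.card_cons, Nat.cast_add, Nat.cast_add, Nat.cast_one]
    constructor
    · congr 1
      ring
    · linarith

namespace Shape

variable {α γ : ℝ}

lemma growSum_expect {Y : Type*} (s : Shape) (q : PMF Y) (F : Shape → Y → ℝ≥0∞) :
    growSum α γ s (fun s' => expect q (F s')) = expect q fun y => growSum α γ s fun s' => F s' y :=
  LTree.growSum_expect q F

lemma eq_leaf_of_numLeaves_eq_one {s : Shape} (h : s.numLeaves = 1) : s = leaf := by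
  obtain ⟨t, rfl⟩ := s.exists_mk_eq
  obtain ⟨i, rfl⟩ := LTree.eq_single_of_card_eq_one h
  exact LTree.mk_single i

lemma numLeaves_leaf : leaf.numLeaves = 1 := by
  rw [leaf, numLeaves_mk]
  simp [LTree.single]

lemma numLeaves_lt_of_mem_subtrees {s s' : Shape} (h : s' ∈ s.subtrees) :
    s'.numLeaves < s.numLeaves := by
  obtain ⟨t, rfl⟩ := s.exists_mk_eq
  obtain ⟨C, hC, rfl⟩ := Multiset.mem_map.1 h
  exact LTree.card_leaves_sub_lt hC

/-- The total weight of a tree with `n` leaves is `n - α`. -/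
lemma growSum_one (hα0 : 0 ≤ α) (hα1 : α ≤ 1) (hγ0 : 0 ≤ γ) (hγα : γ ≤ α) (s : Shape) :
    growSum α γ s (fun _ => 1) = ENNReal.ofReal ((s.numLeaves : ℝ) - α) := by
  have key : ∀ n (s : Shape), s.numLeaves = n →
      growSum α γ s (fun _ => 1) = ENNReal.ofReal ((n : ℝ) - α) := by
    intro n
    induction n using Nat.strong_induction_on with
    | _ n ih =>
      intro s hs
      have hpos := s.numLeaves_pos
      by_cases h1 : n = 1
      · rw [eq_leaf_of_numLeaves_eq_one (hs.trans h1), growSum_leaf, h1]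
        simp
      have h2 : 2 ≤ s.numLeaves := by omega
      have hk : (2 : ℝ) ≤ s.subtrees.card := by exact_mod_cast two_le_card_subtrees h2
      have hd : multisetDeriv (growSum α γ) (fun _ => 1) s.subtrees =
          (s.firstSplit.map fun m : ℕ => ENNReal.ofReal ((m : ℝ) - α)).sum := by
        rw [multisetDeriv, firstSplit_eq, Multiset.map_map]
        refine congrArg Multiset.sum (Multiset.map_congr rfl fun u hu => ?_)
        exact ih _ (hs ▸ numLeaves_lt_of_mem_subtrees hu) u rfl
      have hcard : s.firstSplit.card = s.subtrees.card := by
        rw [firstSplit_eq, Multiset.card_map]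
      obtain ⟨h3, h4⟩ := sum_ofReal_sub hα1 s.firstSplit (by
        intro m hm
        rw [firstSplit_eq] at hm
        obtain ⟨u, -, rfl⟩ := Multiset.mem_map.1 hm
        exact u.numLeaves_pos)
      rw [sum_firstSplit h2, hcard, hs] at h3 h4
      have h5 : (s.subtrees.card : ℝ) * α ≤ s.subtrees.card :=
        mul_le_of_le_one_right (by linarith) hα1
      rw [growSum_eq s h2, hd, h3, mul_one, mul_one, ← ENNReal.ofReal_add hγ0 (by nlinarith),
        ← ENNReal.ofReal_add (by nlinarith) (by linarith)]
      congr 1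
      ring
  exact key _ s rfl

end Shape

namespace LTree

variable {α γ : ℝ} {t : LTree}

lemma leaves_insertAt (s : t.Site) : (t.insertAt s).leaves = insert t.nextLabel t.leaves := by
  rcases s with A | A <;> rfl

lemma sum_weight (hα0 : 0 ≤ α) (hα1 : α ≤ 1) (hγ0 : 0 ≤ γ) (hγα : γ ≤ α) (t : LTree) :
    ∑ s : t.Site, ENNReal.ofReal (t.weight α γ s) =
      ENNReal.ofReal ((t.leaves.card : ℝ) - α) := by
  have h := sum_site (α := α) (γ := γ) t fun _ => 1
  simp only [mul_one] at h
  rw [h, ← Shape.numLeaves_mk, ← Shape.growSum_one hα0 hα1 hγ0 hγα, Shape.growSum_mk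
    t.nextLabel_notMem, growSum]
  simp only [mul_one]

/-- The expectation under one growth step, multiplied by the total weight. -/
lemma mul_expect_grow (hα0 : 0 ≤ α) (hα1 : α ≤ 1) (hγ0 : 0 ≤ γ) (hγα : γ ≤ α)
    (h2 : 2 ≤ t.leaves.card) (φ : LTree → ℝ≥0∞) :
    ENNReal.ofReal ((t.leaves.card : ℝ) - α) * expect (t.grow α γ) φ =
      ∑ s : t.Site, ENNReal.ofReal (t.weight α γ s) * φ (t.insertAt s) := by
  have h0 := sum_weight_ne_zero (γ := γ) hα0 t h2
  have hw := sum_weight hα0 hα1 hγ0 hγα t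
  rw [grow, dif_neg h0, expect_map, expect, tsum_fintype, Finset.mul_sum]
  refine Finset.sum_congr rfl fun s _ => ?_
  rw [PMF.normalize_apply, tsum_fintype, hw]
  rw [hw] at h0
  calc _ = (ENNReal.ofReal ((t.leaves.card : ℝ) - α) *
        (ENNReal.ofReal ((t.leaves.card : ℝ) - α))⁻¹) *
        (ENNReal.ofReal (t.weight α γ s) * φ (t.insertAt s)) := by ring
    _ = _ := by rw [ENNReal.mul_inv_cancel h0 ENNReal.ofReal_ne_top, one_mul]

lemma mul_expect_grow_mk (hα0 : 0 ≤ α) (hα1 : α ≤ 1) (hγ0 : 0 ≤ γ) (hγα : γ ≤ α)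
    (h2 : 2 ≤ t.leaves.card) (φ : Shape → ℝ≥0∞) :
    ENNReal.ofReal ((t.leaves.card : ℝ) - α) * expect (t.grow α γ) (fun t' => φ (Shape.mk t')) =
      Shape.growSum α γ (Shape.mk t) φ := by
  rw [mul_expect_grow hα0 hα1 hγ0 hγα h2, sum_site t fun t' => φ (Shape.mk t'),
    Shape.growSum_mk t.nextLabel_notMem, growSum]

end LTree

section Laws

variable {α γ : ℝ}

lemma treeLaw_succ {n : ℕ} (hn : 2 ≤ n) :
    treeLaw α γ (n + 1) = (treeLaw α γ n).bind (LTree.grow α γ) := by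
  obtain ⟨n, rfl⟩ := Nat.exists_eq_add_of_le' hn
  rfl

lemma leaves_treeLaw_two {t : LTree} (ht : t ∈ (treeLaw α γ 2).support) :
    t.leaves = Finset.Icc 1 2 := by
  rw [treeLaw, PMF.mem_support_pure_iff] at ht
  rw [ht]
  change insert 2 {1} = Finset.Icc 1 2
  decide

lemma leaves_of_mem_support_treeLaw (hα0 : 0 ≤ α) {n : ℕ} (hn : 1 ≤ n) {t : LTree}
    (ht : t ∈ (treeLaw α γ n).support) : t.leaves = Finset.Icc 1 n := by
  induction n, hn using Nat.le_induction generalizing t with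
  | base =>
    rw [treeLaw, PMF.mem_support_pure_iff] at ht
    rw [ht]
    rfl
  | succ n hn ih =>
    rcases Nat.eq_or_lt_of_le hn with rfl | hn
    · exact leaves_treeLaw_two ht
    rw [treeLaw_succ hn, PMF.mem_support_bind_iff] at ht
    obtain ⟨t', ht', ht⟩ := ht
    have h := ih ht'
    have h0 := LTree.sum_weight_ne_zero (γ := γ) hα0 t' (by rw [h]; simp; omega)
    rw [LTree.grow, dif_neg h0, PMF.support_map] at ht
    obtain ⟨s, -, rfl⟩ := ht
    rw [LTree.leaves_insertAt, LTree.nextLabel_eq t' _ h, h]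
    ext i
    simp only [Finset.mem_insert, Finset.mem_Icc]
    omega

lemma card_leaves_of_mem_support_treeLaw (hα0 : 0 ≤ α) {n : ℕ} (hn : 1 ≤ n) {t : LTree}
    (ht : t ∈ (treeLaw α γ n).support) : t.leaves.card = n := by
  rw [leaves_of_mem_support_treeLaw hα0 hn ht]
  simp

lemma numLeaves_of_mem_support_shapeLaw (hα0 : 0 ≤ α) {n : ℕ} (hn : 1 ≤ n) {s : Shape}
    (hs : s ∈ (shapeLaw α γ n).support) : s.numLeaves = n := by
  rw [shapeLaw, PMF.support_map] at hs
  obtain ⟨t, ht, rfl⟩ := hs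
  exact card_leaves_of_mem_support_treeLaw hα0 hn ht

lemma shapeLaw_one : shapeLaw α γ 1 = PMF.pure Shape.leaf := by
  rw [shapeLaw, treeLaw, PMF.pure_map]
  rfl

lemma shapeLaw_two :
    shapeLaw α γ 2 = PMF.pure (Shape.joinMultiset {Shape.leaf, Shape.leaf}) := by
  rw [shapeLaw, treeLaw, PMF.pure_map]
  have h := LTree.isAttach_insertEdge (t := LTree.single 1) (x := 2) (by simp [LTree.single])
    (LTree.single 1).top_mem
  have h' := h.mk_eq
  rw [h.subtrees_of_edge trivial, LTree.mk_single, LTree.mk_single] at h'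
  rw [← h']
  rfl

/-- The recursion for the distributions of the unlabelled trees. -/
lemma mul_expect_shapeLaw_succ (hα0 : 0 ≤ α) (hα1 : α ≤ 1) (hγ0 : 0 ≤ γ) (hγα : γ ≤ α) {n : ℕ}
    (hn : 1 ≤ n) (φ : Shape → ℝ≥0∞) :
    ENNReal.ofReal ((n : ℝ) - α) * expect (shapeLaw α γ (n + 1)) φ =
      expect (shapeLaw α γ n) fun s => Shape.growSum α γ s φ := by
  rcases Nat.eq_or_lt_of_le hn with rfl | hn
  · rw [shapeLaw_one, shapeLaw_two, expect_pure, expect_pure, Shape.growSum_leaf, Nat.cast_one]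
  · rw [shapeLaw, treeLaw_succ hn, expect_map, expect_bind, ← expect_mul_left, shapeLaw,
      expect_map]
    refine expect_congr fun t ht => ?_
    have hc := card_leaves_of_mem_support_treeLaw hα0 (by omega) ht
    rw [← LTree.mul_expect_grow_mk hα0 hα1 hγ0 hγα (by omega), hc]

end Laws

/-! ### Independent subtrees -/

section Forest

variable {P : ℕ → PMF Shape}

lemma expect_indepShapes_perm {l l' : List ℕ} (h : l.Perm l') (H : Multiset Shape → ℝ≥0∞) :
    expect (indepShapes P l) (fun u => H u) = expect (indepShapes P l') fun u => H u := by
  induction h generalizing H with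
  | nil => rfl
  | cons m _ ih =>
    simp only [indepShapes, expect_bind, expect_map, ← Multiset.cons_coe]
    exact congrArg _ (funext fun s => ih fun N => H (s ::ₘ N))
  | swap m m' l =>
    simp only [indepShapes, expect_bind, expect_map, ← Multiset.cons_coe]
    rw [expect_comm]
    simp only [Multiset.cons_swap]
  | trans _ _ ih₁ ih₂ => rw [ih₁, ih₂]

/-- The expectation of a function of the multiset of independent unlabelled trees with numbers of
leaves `M`. -/
noncomputable def forestExpect (P : ℕ → PMF Shape) (H : Multiset Shape → ℝ≥0∞)
    (M : Multiset ℕ) : ℝ≥0∞ :=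
  expect (indepShapes P M.toList) fun u => H u

lemma forestExpect_coe (H : Multiset Shape → ℝ≥0∞) (l : List ℕ) :
    forestExpect P H l = expect (indepShapes P l) fun u => H u :=
  expect_indepShapes_perm (Multiset.coe_eq_coe.1 (Multiset.coe_toList _)) H

lemma forestExpect_zero (H : Multiset Shape → ℝ≥0∞) : forestExpect P H 0 = H 0 := by
  rw [← Multiset.coe_nil, forestExpect_coe, indepShapes, expect_pure, Multiset.coe_nil]

lemma forestExpect_cons (H : Multiset Shape → ℝ≥0∞) (m : ℕ) (M : Multiset ℕ) :
    forestExpect P H (m ::ₘ M) =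
      expect (P m) fun s => forestExpect P (fun N => H (s ::ₘ N)) M := by
  induction M using Quotient.inductionOn with
  | h l =>
    rw [Multiset.quot_mk_to_coe, Multiset.cons_coe, forestExpect_coe]
    simp only [forestExpect_coe, indepShapes, expect_bind, expect_map, Multiset.cons_coe]

lemma forestExpect_add (H H' : Multiset Shape → ℝ≥0∞) (M : Multiset ℕ) :
    forestExpect P (fun N => H N + H' N) M = forestExpect P H M + forestExpect P H' M :=
  expect_add _ _ _

lemma forestExpect_mul_left (c : ℝ≥0∞) (H : Multiset Shape → ℝ≥0∞) (M : Multiset ℕ) :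
    forestExpect P (fun N => c * H N) M = c * forestExpect P H M :=
  expect_mul_left _ _ _

lemma forestExpect_congr (hP : ∀ n, 1 ≤ n → ∀ s ∈ (P n).support, s.numLeaves = n)
    {H H' : Multiset Shape → ℝ≥0∞} {M : Multiset ℕ} (hM : ∀ m ∈ M, 1 ≤ m)
    (h : ∀ N : Multiset Shape, N.map Shape.numLeaves = M → H N = H' N) :
    forestExpect P H M = forestExpect P H' M := by
  induction M using Multiset.induction_on generalizing H H' with
  | empty => rw [forestExpect_zero, forestExpect_zero, h 0 (by simp)]
  | cons m M ih =>
    rw [forestExpect_cons, forestExpect_cons]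
    refine expect_congr fun s hs => ih (fun k hk => hM k (Multiset.mem_cons_of_mem hk)) ?_
    intro N hN
    refine h _ ?_
    rw [Multiset.map_cons, hN, hP m (hM m (Multiset.mem_cons_self _ _)) s hs]

lemma forestExpect_const (c : ℝ≥0∞) (M : Multiset ℕ) : forestExpect P (fun _ => c) M = c :=
  expect_const _ _

/-- The growth step on the numbers of leaves of the trees in a forest: a tree with `m` leaves grows
with weight `m - α`. -/
noncomputable def sizeGrow (α : ℝ) (m : ℕ) (G : ℕ → ℝ≥0∞) : ℝ≥0∞ :=
  ENNReal.ofReal ((m : ℝ) - α) * G (m + 1)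

/-- Independence of the trees in a forest is preserved by the growth step. -/
lemma forestExpect_multisetDeriv {α γ : ℝ}
    (hP : ∀ n : ℕ, 1 ≤ n → ∀ φ, ENNReal.ofReal ((n : ℝ) - α) * expect (P (n + 1)) φ =
      expect (P n) fun s => Shape.growSum α γ s φ)
    (H : Multiset Shape → ℝ≥0∞) {M : Multiset ℕ} (hM : ∀ m ∈ M, 1 ≤ m) :
    forestExpect P (multisetDeriv (Shape.growSum α γ) H) M =
      multisetDeriv (sizeGrow α) (forestExpect P H) M := by
  induction M using Multiset.induction_on generalizing H with
  | empty => rw [forestExpect_zero]; simp [multisetDeriv]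
  | cons m M ih =>
    have hm := hM m (Multiset.mem_cons_self _ _)
    rw [forestExpect_cons, multisetDeriv_cons, sizeGrow, forestExpect_cons, hP m hm]
    simp only [multisetDeriv_cons]
    simp only [forestExpect_add]
    rw [expect_add]
    congr 1
    · refine congrArg _ (funext fun s => ?_)
      exact (Shape.growSum_expect s _ fun s' (u : List Shape) => H (s' ::ₘ (u : Multiset Shape))).symm
    · simp only [ih _ fun k hk => hM k (Multiset.mem_cons_of_mem hk)]
      simp only [multisetDeriv, sizeGrow]
      rw [expect_multiset_sum]
      refine congrArg Multiset.sum (Multiset.map_congr rfl fun a _ => ?_)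
      rw [expect_mul_left, ← forestExpect_cons]

end Forest

end AlphaGamma

/-! ### The Markov branching property -/

namespace AlphaGamma

open Finset

open scoped ENNReal

variable {α γ : ℝ} {n : ℕ}

lemma length_of_mem_support_indepShapes {P : ℕ → PMF Shape} {l : List ℕ} {u : List Shape}
    (hu : u ∈ (indepShapes P l).support) : u.length = l.length := by
  induction l generalizing u with
  | nil =>
    rw [indepShapes, PMF.mem_support_pure_iff] at hu
    rw [hu]
    rfl
  | cons m l ih =>
    rw [indepShapes, PMF.mem_support_bind_iff] at hu
    obtain ⟨s, -, hu⟩ := hu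
    rw [PMF.support_map] at hu
    obtain ⟨v, hv, rfl⟩ := hu
    rw [List.length_cons, List.length_cons, ih hv]

lemma expect_splittingRule (P : ℕ → PMF Shape) (g : Multiset ℕ → ℝ≥0∞) :
    expect (splittingRule P n) g = expect (P n) fun s => g s.firstSplit :=
  expect_map _ _ _

/-- The possible values of the first split of a tree with `n` leaves. -/
structure IsSplit (n : ℕ) (M : Multiset ℕ) : Prop where
  sum_eq : M.sum = n
  two_le_card : 2 ≤ M.card
  one_le : ∀ m ∈ M, 1 ≤ m

lemma isSplit_of_mem_support (hα0 : 0 ≤ α) (hn : 2 ≤ n) {M : Multiset ℕ}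
    (hM : M ∈ (splittingRule (shapeLaw α γ) n).support) : IsSplit n M := by
  rw [splittingRule, PMF.support_map] at hM
  obtain ⟨s, hs, rfl⟩ := hM
  have hsn := numLeaves_of_mem_support_shapeLaw hα0 (by omega) hs
  have h2 : 2 ≤ s.numLeaves := by omega
  refine ⟨by rw [Shape.sum_firstSplit h2, hsn], ?_, ?_⟩
  · rw [Shape.firstSplit_eq, Multiset.card_map]
    exact Shape.two_le_card_subtrees h2
  · intro m hm
    rw [Shape.firstSplit_eq] at hm
    obtain ⟨u, -, rfl⟩ := Multiset.mem_map.1 hm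
    exact u.numLeaves_pos

lemma isSplit_pair (hn : 1 ≤ n) : IsSplit (n + 1) {n, 1} :=
  ⟨by simp, by simp, by simp [hn]⟩

lemma IsSplit.cons_one {M : Multiset ℕ} (h : IsSplit n M) : IsSplit (n + 1) (1 ::ₘ M) := by
  refine ⟨by simp [h.sum_eq, add_comm], by simp [h.two_le_card.trans (Nat.le_succ _)], ?_⟩
  intro m hm
  rcases Multiset.mem_cons.1 hm with rfl | hm
  · rfl
  · exact h.one_le m hm

lemma IsSplit.succ_cons_erase {M : Multiset ℕ} (h : IsSplit n M) {a : ℕ} (ha : a ∈ M) :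
    IsSplit (n + 1) ((a + 1) ::ₘ M.erase a) := by
  have h1 := h.sum_eq
  have h2 := h.two_le_card
  rw [← Multiset.cons_erase ha] at h1 h2
  rw [Multiset.sum_cons] at h1
  rw [Multiset.card_cons] at h2
  refine ⟨by rw [Multiset.sum_cons]; omega, by rwa [Multiset.card_cons], ?_⟩
  intro m hm
  rcases Multiset.mem_cons.1 hm with rfl | hm
  · omega
  · exact h.one_le m (Multiset.mem_of_mem_erase hm)

/-- The growth step for the first split: a leaf is attached to the root edge, to the common
ancestor, or within a subtree. -/
noncomputable def splitGrow (α γ : ℝ) (n : ℕ) (q : PMF (Multiset ℕ)) (g : Multiset ℕ → ℝ≥0∞) :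
    ℝ≥0∞ :=
  ENNReal.ofReal γ * g {n, 1} + expect q fun M =>
    ENNReal.ofReal (((M.card : ℝ) - 1) * α - γ) * g (1 ::ₘ M) + multisetDeriv (sizeGrow α) g M

lemma splitGrow_congr (hα0 : 0 ≤ α) (hn : 2 ≤ n) {g g' : Multiset ℕ → ℝ≥0∞}
    (h : ∀ M, IsSplit (n + 1) M → g M = g' M) :
    splitGrow α γ n (splittingRule (shapeLaw α γ) n) g =
      splitGrow α γ n (splittingRule (shapeLaw α γ) n) g' := by
  rw [splitGrow, splitGrow, h _ (isSplit_pair (by omega))]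
  congr 1
  refine expect_congr fun M hM => ?_
  have hM := isSplit_of_mem_support hα0 hn hM
  rw [h _ hM.cons_one]
  congr 1
  refine congrArg Multiset.sum (Multiset.map_congr rfl fun a ha => ?_)
  rw [sizeGrow, sizeGrow]
  congr 1
  convert h _ (hM.succ_cons_erase ha)

/-- The first split of a tree that is joined from a forest. -/
lemma forestExpect_firstSplit (hα0 : 0 ≤ α) (g : Multiset ℕ → ℝ≥0∞) {M : Multiset ℕ}
    (hM : IsSplit n M) :
    forestExpect (shapeLaw α γ) (fun N => g (Shape.joinMultiset N).firstSplit) M = g M := by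
  rw [forestExpect_congr (H' := fun _ => g M)
    (fun n hn s hs => numLeaves_of_mem_support_shapeLaw hα0 hn hs) hM.one_le, forestExpect_const]
  intro N hN
  have h2 : 2 ≤ N.card := by
    have := congrArg Multiset.card hN
    rw [Multiset.card_map] at this
    exact hM.two_le_card.trans this.ge
  rw [Shape.firstSplit_eq, Shape.subtrees_joinMultiset h2, hN]

lemma forestExpect_pair_one (H : Multiset Shape → ℝ≥0∞) (m : ℕ) :
    forestExpect (shapeLaw α γ) H {m, 1} =
      expect (shapeLaw α γ m) fun s => H {s, Shape.leaf} := by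
  rw [Multiset.insert_eq_cons, forestExpect_cons]
  refine congrArg _ (funext fun s => ?_)
  rw [← Multiset.cons_zero, forestExpect_cons, shapeLaw_one, expect_pure, forestExpect_zero]
  rfl

lemma splittingRule_two :
    splittingRule (shapeLaw α γ) 2 = PMF.pure {1, 1} := by
  rw [splittingRule, shapeLaw_two, PMF.pure_map, Shape.firstSplit_eq,
    Shape.subtrees_joinMultiset (by simp)]
  simp [Shape.numLeaves_leaf]

section Recursion

variable (hα0 : 0 ≤ α) (hα1 : α ≤ 1) (hγ0 : 0 ≤ γ) (hγα : γ ≤ α)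

include hα0 hα1 hγ0 hγα

lemma mul_expect_shapeLaw_eq_splitGrow (hn : 2 ≤ n)
    (h : ∀ φ, expect (shapeLaw α γ n) φ = expect (splittingRule (shapeLaw α γ) n)
      (forestExpect (shapeLaw α γ) fun N => φ (Shape.joinMultiset N))) (φ : Shape → ℝ≥0∞) :
    ENNReal.ofReal ((n : ℝ) - α) * expect (shapeLaw α γ (n + 1)) φ =
      splitGrow α γ n (splittingRule (shapeLaw α γ) n)
        (forestExpect (shapeLaw α γ) fun N => φ (Shape.joinMultiset N)) := by
  rw [mul_expect_shapeLaw_succ hα0 hα1 hγ0 hγα (by omega), h, splitGrow, forestExpect_pair_one, h,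
    ← expect_mul_left, ← expect_add]
  refine expect_congr fun M hM => ?_
  have hM := isSplit_of_mem_support hα0 hn hM
  rw [← forestExpect_multisetDeriv
    (fun n hn φ => mul_expect_shapeLaw_succ hα0 hα1 hγ0 hγα hn φ) _ hM.one_le,
    forestExpect_cons, shapeLaw_one, expect_pure, ← forestExpect_mul_left,
    ← forestExpect_mul_left, ← forestExpect_add, ← forestExpect_add]
  refine forestExpect_congr (fun n hn s hs => numLeaves_of_mem_support_shapeLaw hα0 hn hs)
    hM.one_le fun N hN => ?_
  have hc : N.card = M.card := by rw [← hN, Multiset.card_map]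
  rw [Shape.growSum_joinMultiset (hM.two_le_card.trans hc.ge), hc, add_assoc]

lemma mul_expect_splittingRule_of (hn : 2 ≤ n)
    (h : ∀ φ, expect (shapeLaw α γ n) φ = expect (splittingRule (shapeLaw α γ) n)
      (forestExpect (shapeLaw α γ) fun N => φ (Shape.joinMultiset N))) (g : Multiset ℕ → ℝ≥0∞) :
    ENNReal.ofReal ((n : ℝ) - α) * expect (splittingRule (shapeLaw α γ) (n + 1)) g =
      splitGrow α γ n (splittingRule (shapeLaw α γ) n) g := by
  rw [expect_splittingRule, mul_expect_shapeLaw_eq_splitGrow hα0 hα1 hγ0 hγα hn h]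
  exact splitGrow_congr hα0 hn fun M hM => forestExpect_firstSplit hα0 g hM

/-- The tree is distributed as the tree joined from a forest of independent trees whose numbers of
leaves are given by an independent copy of the first split. -/
theorem expect_shapeLaw (hn : 2 ≤ n) (φ : Shape → ℝ≥0∞) :
    expect (shapeLaw α γ n) φ = expect (splittingRule (shapeLaw α γ) n)
      (forestExpect (shapeLaw α γ) fun N => φ (Shape.joinMultiset N)) := by
  induction n, hn using Nat.le_induction generalizing φ with
  | base =>
    rw [splittingRule_two, expect_pure, forestExpect_pair_one, shapeLaw_one, shapeLaw_two,
      expect_pure, expect_pure]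
  | succ n hn ih =>
    have hpos : ENNReal.ofReal ((n : ℝ) - α) ≠ 0 := by
      have : (2 : ℝ) ≤ n := by exact_mod_cast hn
      rw [Ne, ENNReal.ofReal_eq_zero]
      linarith
    rw [← ENNReal.mul_right_inj hpos ENNReal.ofReal_ne_top,
      mul_expect_shapeLaw_eq_splitGrow hα0 hα1 hγ0 hγα hn fun φ => ih φ,
      mul_expect_splittingRule_of hα0 hα1 hγ0 hγα hn fun φ => ih φ]

/-- The recursion for the splitting rule. -/
lemma mul_expect_splittingRule (hn : 2 ≤ n) (g : Multiset ℕ → ℝ≥0∞) :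
    ENNReal.ofReal ((n : ℝ) - α) * expect (splittingRule (shapeLaw α γ) (n + 1)) g =
      splitGrow α γ n (splittingRule (shapeLaw α γ) n) g :=
  mul_expect_splittingRule_of hα0 hα1 hγ0 hγα hn (expect_shapeLaw hα0 hα1 hγ0 hγα hn) g

open Classical in
/-- The partition of `n` with the given parts; the partition with one part if the given parts do not
form a partition of `n`. -/
noncomputable def toPartition (n : ℕ) (M : Multiset ℕ) : n.Partition :=
  if h : IsSplit n M then ⟨M, fun hi => h.one_le _ hi, h.sum_eq⟩ else Nat.Partition.indiscrete n

omit hα0 hα1 hγ0 hγα in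
lemma parts_toPartition {M : Multiset ℕ} (h : IsSplit n M) : (toPartition n M).parts = M := by
  rw [toPartition, dif_pos h]

theorem markovBranching_shapeLaw : MarkovBranching (shapeLaw α γ) := by
  refine ⟨fun n hn s hs => numLeaves_of_mem_support_shapeLaw hα0 hn hs, fun n hn => ?_⟩
  refine ⟨(splittingRule (shapeLaw α γ) n).map (toPartition n), ?_, ?_⟩
  · intro p hp
    rw [PMF.support_map] at hp
    obtain ⟨M, hM, rfl⟩ := hp
    have hM := isSplit_of_mem_support hα0 hn hM
    rw [parts_toPartition hM]
    exact hM.two_le_card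
  · refine ext_of_expect fun φ => ?_
    rw [expect_shapeLaw hα0 hα1 hγ0 hγα hn, expect_bind, expect_map]
    refine expect_congr fun M hM => ?_
    have hM := isSplit_of_mem_support hα0 hn hM
    rw [parts_toPartition hM, expect_map]
    conv_lhs => rw [← Multiset.sort_eq M (· ≥ ·)]
    rw [forestExpect_coe]
    refine expect_congr fun u hu => ?_
    rw [Shape.joinMultiset_coe]
    rw [length_of_mem_support_indepShapes hu, Multiset.length_sort]
    exact hM.two_le_card

end Recursion

end AlphaGamma

/-! ### The splitting rule -/

namespace AlphaGamma

open Finset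

open scoped ENNReal

variable {α γ θ : ℝ} {n : ℕ}

lemma crossSum_eq (M : Multiset ℕ) :
    crossSum M = (M.sum : ℝ) ^ 2 - (M.map fun a : ℕ => (a : ℝ) ^ 2).sum := by
  have h1 : ∀ a ∈ M, ((M.erase a).map fun b : ℕ => (a : ℝ) * (b : ℝ)).sum =
      (a : ℝ) * M.sum - (a : ℝ) ^ 2 := by
    intro a ha
    have h2 : (M.sum : ℝ) = a + (M.erase a).sum := by
      conv_lhs => rw [← Multiset.cons_erase ha, Multiset.sum_cons, Nat.cast_add]
    rw [Multiset.sum_map_mul_left, h2, Nat.cast_multiset_sum]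
    ring
  have h0 : crossSum M = (M.map fun a => ((M.erase a).map fun b : ℕ =>
      (a : ℝ) * (b : ℝ)).sum).sum := by
    simp [crossSum]
  rw [h0, Multiset.map_congr rfl h1, Multiset.sum_map_sub, Multiset.sum_map_mul_right,
    ← Nat.cast_multiset_sum]
  ring

lemma crossSum_cons (a : ℕ) (M : Multiset ℕ) :
    crossSum (a ::ₘ M) = crossSum M + 2 * a * M.sum := by
  rw [crossSum_eq, crossSum_eq]
  simp only [Multiset.sum_cons, Multiset.map_cons, Nat.cast_add]
  ring

lemma prod_count_factorial_cons (a : ℕ) (M : Multiset ℕ) :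
    ∏ r ∈ (a ::ₘ M).toFinset, (((a ::ₘ M).count r).factorial : ℝ) =
      (M.count a + 1) * ∏ r ∈ M.toFinset, ((M.count r).factorial : ℝ) := by
  have h : ∏ r ∈ M.toFinset, ((M.count r).factorial : ℝ) =
      ∏ r ∈ insert a M.toFinset, ((M.count r).factorial : ℝ) := by
    refine Finset.prod_subset (Finset.subset_insert _ _) fun r _ hr => ?_
    rw [Multiset.mem_toFinset] at hr
    simp [Multiset.count_eq_zero_of_notMem hr]
  rw [h, Multiset.toFinset_cons, ← Finset.mul_prod_erase _ _ (Finset.mem_insert_self a _),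
    ← Finset.mul_prod_erase (insert a M.toFinset) (fun r => ((M.count r).factorial : ℝ))
      (Finset.mem_insert_self a _), Multiset.count_cons_self, Nat.factorial_succ, Nat.cast_mul,
    Nat.cast_add_one, mul_assoc]
  congr 2
  refine Finset.prod_congr rfl fun r hr => ?_
  rw [Multiset.count_cons_of_ne (Finset.ne_of_mem_erase hr)]

lemma numSetPartitions_pos (M : Multiset ℕ) : 0 < numSetPartitions M := by
  have h1 : 0 < (M.map fun m => (m.factorial : ℝ)).prod := by
    refine Multiset.prod_pos fun x hx => ?_
    obtain ⟨m, -, rfl⟩ := Multiset.mem_map.1 hx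
    positivity
  have h2 : 0 < ∏ r ∈ M.toFinset, ((M.count r).factorial : ℝ) :=
    Finset.prod_pos fun r _ => by positivity
  rw [numSetPartitions]
  positivity

lemma numSetPartitions_cons (a : ℕ) (M : Multiset ℕ) :
    numSetPartitions (a ::ₘ M) = numSetPartitions M * (a + M.sum).factorial /
      (M.sum.factorial * a.factorial * (M.count a + 1)) := by
  have h1 : ((M.sum.factorial : ℕ) : ℝ) ≠ 0 := by positivity
  rw [numSetPartitions, numSetPartitions, prod_count_factorial_cons, Multiset.map_cons,
    Multiset.prod_cons, Multiset.sum_cons]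
  field_simp

/-- The ways to choose the block of the last element of an `n`-element set in a partition into
blocks of given sizes: a fraction of `b / n` of the set partitions has this element in a block of a
given size `b`, and its removal gives a partition of the remaining elements. -/
lemma count_mul_numSetPartitions (a : ℕ) (M : Multiset ℕ) :
    ((M.count (a + 1) : ℝ) + 1) * ((a : ℝ) + 1) / ((a : ℝ) + 1 + M.sum) *
      numSetPartitions ((a + 1) ::ₘ M) =
    numSetPartitions (a ::ₘ M) * (M.count a + 1) := by
  rw [numSetPartitions_cons, numSetPartitions_cons, show a + 1 + M.sum = (a + M.sum) + 1 by ring,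
    Nat.factorial_succ, Nat.factorial_succ]
  generalize M.sum = s
  push_cast
  have h : (a : ℝ) + 1 + s ≠ 0 := by positivity
  rw [show (a : ℝ) + s + 1 = a + 1 + s by ring]
  field_simp

lemma numSetPartitions_zero_cons (M : Multiset ℕ) :
    numSetPartitions (0 ::ₘ M) * (M.count 0 + 1) = numSetPartitions M := by
  rw [numSetPartitions_cons]
  have : ((M.sum.factorial : ℕ) : ℝ) ≠ 0 := by positivity
  simp
  field_simp

lemma pdW_one (hα : α < 1) : pdW α 1 = 1 := by
  rw [pdW, Nat.cast_one, div_self (Real.Gamma_pos_of_pos (by linarith)).ne']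

lemma pdW_pos (hα : α < 1) {m : ℕ} (hm : 1 ≤ m) : 0 < pdW α m := by
  have : (1 : ℝ) ≤ m := by exact_mod_cast hm
  exact div_pos (Real.Gamma_pos_of_pos (by linarith)) (Real.Gamma_pos_of_pos (by linarith))

lemma pdW_succ (hα : α < 1) {m : ℕ} (hm : 1 ≤ m) :
    pdW α (m + 1) = ((m : ℝ) - α) * pdW α m := by
  have : (1 : ℝ) ≤ m := by exact_mod_cast hm
  rw [pdW, pdW, show ((m + 1 : ℕ) : ℝ) - α = ((m : ℝ) - α) + 1 by push_cast; ring,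
    Real.Gamma_add_one (by linarith), mul_div_assoc]

lemma pdGibbs_succ_cons (hα : α < 1) {a : ℕ} (ha : 1 ≤ a) (M : Multiset ℕ) :
    pdGibbs α θ ((a + 1) ::ₘ M) = ((a : ℝ) - α) * pdGibbs α θ (a ::ₘ M) := by
  simp only [pdGibbs, Multiset.map_cons, Multiset.prod_cons, Multiset.card_cons, pdW_succ hα ha]
  ring

lemma pdGibbs_one_cons (hα : α < 1) {M : Multiset ℕ} (hM : 2 ≤ M.card) :
    pdGibbs α θ (1 ::ₘ M) = ((M.card : ℝ) * α + θ) * pdGibbs α θ M := by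
  simp only [pdGibbs, Multiset.map_cons, Multiset.prod_cons, Multiset.card_cons, pdW_one hα, pdA,
    Finset.prod_Ico_succ_top hM]
  ring

lemma pdGibbs_nonneg (hα : α < 1) (hγα : γ ≤ α) {M : Multiset ℕ} (hM : ∀ m ∈ M, 1 ≤ m)
    (hα0 : 0 ≤ α) : 0 ≤ pdGibbs α (-α - γ) M := by
  refine mul_nonneg (Finset.prod_nonneg fun i hi => ?_) (Multiset.prod_nonneg fun x hx => ?_)
  · have : (2 : ℝ) ≤ i := by exact_mod_cast (Finset.mem_Ico.1 hi).1
    nlinarith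
  · obtain ⟨m, hm, rfl⟩ := Multiset.mem_map.1 hx
    exact (pdW_pos hα (hM m hm)).le

lemma pdZ_pos (hα0 : 0 ≤ α) (hα : α < 1) (hγα : γ ≤ α) (hn : 2 ≤ n) : 0 < pdZ α (-α - γ) n := by
  refine Finset.sum_pos' (fun p _ => ?_) ⟨toPartition n {n - 1, 1}, ?_, ?_⟩
  · exact mul_nonneg (numSetPartitions_pos _).le
      (pdGibbs_nonneg hα hγα (fun m hm => p.parts_pos hm) hα0)
  all_goals
    have hs : IsSplit n {n - 1, 1} := by
      obtain ⟨n, rfl⟩ := Nat.exists_eq_add_of_le' hn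
      exact isSplit_pair (by omega)
  · rw [Finset.mem_filter, parts_toPartition hs]
    exact ⟨Finset.mem_univ _, hs.two_le_card⟩
  · rw [parts_toPartition hs]
    refine mul_pos (numSetPartitions_pos _) ?_
    have h1 : 1 ≤ n - 1 := by omega
    simp only [pdGibbs, pdA]
    simpa [pdW_one hα] using pdW_pos hα h1

/-! ### The recursion for the probabilities of the first split -/

/-- The average of `1 - α` and `γ`, where the weight of `1 - α` is the probability that two elements
chosen at random lie in different blocks. -/
noncomputable def seqFactor (α γ : ℝ) (M : Multiset ℕ) : ℝ :=
  γ + (1 - α - γ) * (1 / ((M.sum : ℝ) * ((M.sum : ℝ) - 1))) * crossSum M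

/-- The probability of the first split `M`. -/
noncomputable def seqSplit (α γ : ℝ) (M : Multiset ℕ) : ℝ :=
  numSetPartitions M * pdGibbs α (-α - γ) M * seqFactor α γ M / pdW α M.sum

/-- The consistency of `seqFactor`: removal of an element chosen at random. -/
lemma sum_mul_seqFactor (hn : 2 ≤ n) {M : Multiset ℕ} (hM : M.sum = n + 1) (f : ℕ → ℝ)
    (hf : ∀ b ∈ M, f b = γ + (1 - α - γ) * (1 / ((n : ℝ) * ((n : ℝ) - 1))) *
      ((n : ℝ) ^ 2 - (M.map fun a : ℕ => (a : ℝ) ^ 2).sum + 2 * b - 1)) :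
    (M.map fun b : ℕ => (b : ℝ) / ((n : ℝ) + 1) * f b).sum = seqFactor α γ M := by
  have hn' : (2 : ℝ) ≤ n := by exact_mod_cast hn
  set S := (M.map fun a : ℕ => (a : ℝ) ^ 2).sum with hS
  set c := (1 - α - γ) * (1 / ((n : ℝ) * ((n : ℝ) - 1))) with hc
  have h1 : ∀ b ∈ M, (b : ℝ) / ((n : ℝ) + 1) * f b =
      (γ + c * ((n : ℝ) ^ 2 - S - 1)) / ((n : ℝ) + 1) * (b : ℝ) +
        2 * c / ((n : ℝ) + 1) * (b : ℝ) ^ 2 := by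
    intro b hb
    rw [hf b hb]
    ring
  rw [Multiset.map_congr rfl h1, Multiset.sum_map_add, Multiset.sum_map_mul_left,
    Multiset.sum_map_mul_left, ← Nat.cast_multiset_sum, hM, ← hS, seqFactor, crossSum_eq, hM,
    ← hS, hc]
  push_cast
  have h2 : (n : ℝ) ≠ 0 := by linarith
  have h3 : (n : ℝ) - 1 ≠ 0 := by linarith
  have h4 : (n : ℝ) + 1 ≠ 0 := by linarith
  rw [show (n : ℝ) + 1 - 1 = n by ring]
  field_simp
  ring

lemma multisetDeriv_eq {X : Type*} [DecidableEq X] (V : X → (X → ℝ≥0∞) → ℝ≥0∞)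
    (H : Multiset X → ℝ≥0∞) (M : Multiset X) :
    multisetDeriv V H M = (M.map fun s => V s fun s' => H (s' ::ₘ M.erase s)).sum := by
  unfold multisetDeriv
  congr!

/-- A growth step within a subtree leads to `M'` only from the splits where an element `b` of `M'`
is replaced by `b - 1`. -/
lemma multisetDeriv_indicator {M' : Multiset ℕ} (hM' : ∀ b ∈ M', 1 ≤ b) (M : Multiset ℕ) :
    multisetDeriv (sizeGrow α) (fun N => if N = M' then 1 else 0) M =
      ∑ b ∈ M'.toFinset, (M.count (b - 1) : ℝ≥0∞) * ENNReal.ofReal (((b - 1 : ℕ) : ℝ) - α) *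
        if M = (b - 1) ::ₘ M'.erase b then 1 else 0 := by
  set f : ℕ → ℝ≥0∞ := fun a => (M.count a : ℝ≥0∞) * ENNReal.ofReal ((a : ℝ) - α) *
    if a + 1 ∈ M' ∧ M = a ::ₘ M'.erase (a + 1) then 1 else 0 with hf
  have hR : ∀ b ∈ M'.toFinset, ((M.count (b - 1) : ℝ≥0∞) *
      ENNReal.ofReal (((b - 1 : ℕ) : ℝ) - α) *
        if M = (b - 1) ::ₘ M'.erase b then 1 else 0) = f (b - 1) := by
    intro b hb
    have hb' := Multiset.mem_toFinset.1 hb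
    have hb1 := hM' b hb'
    simp only [hf, Nat.sub_add_cancel hb1, hb', true_and]
  have hL : ∀ a ∈ M, (M.count a : ℕ) • (sizeGrow α a fun s' =>
      if s' ::ₘ M.erase a = M' then (1 : ℝ≥0∞) else 0) = f a := by
    intro a ha
    have hiff : (a + 1) ::ₘ M.erase a = M' ↔ a + 1 ∈ M' ∧ M = a ::ₘ M'.erase (a + 1) := by
      constructor
      · rintro rfl
        exact ⟨Multiset.mem_cons_self _ _, by rw [Multiset.erase_cons_head,
          Multiset.cons_erase ha]⟩
      · rintro ⟨h1, h2⟩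
        rw [h2, Multiset.erase_cons_head, Multiset.cons_erase h1]
    simp only [hf, sizeGrow, nsmul_eq_mul, hiff, mul_assoc]
  rw [multisetDeriv_eq, Finset.sum_multiset_map_count, Finset.sum_congr rfl hR,
    Finset.sum_congr rfl fun a ha => hL a (Multiset.mem_toFinset.1 ha)]
  rw [← Finset.sum_image (s := M'.toFinset) (g := fun b => b - 1) (f := f)]
  · have h1 : ∀ a, f a ≠ 0 → a ∈ M.toFinset ∧ a ∈ M'.toFinset.image fun b => b - 1 := by
      intro a ha
      have h2 : M.count a ≠ 0 := by
        intro h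
        simp [hf, h] at ha
      have h3 : a + 1 ∈ M' := by
        by_contra h
        simp [hf, h] at ha
      rw [Multiset.mem_toFinset, Finset.mem_image]
      exact ⟨Multiset.count_ne_zero.1 h2, a + 1, Multiset.mem_toFinset.2 h3, rfl⟩
    rw [← Finset.sum_filter_ne_zero (s := M.toFinset),
      ← Finset.sum_filter_ne_zero (s := M'.toFinset.image _)]
    refine Finset.sum_congr (Finset.ext fun a => ?_) fun _ _ => rfl
    rw [Finset.mem_filter, Finset.mem_filter]
    exact ⟨fun h => ⟨(h1 a h.2).2, h.2⟩, fun h => ⟨(h1 a h.2).1, h.2⟩⟩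
  · intro b hb c hc hbc
    have := hM' b (Multiset.mem_toFinset.1 hb)
    have := hM' c (Multiset.mem_toFinset.1 hc)
    simp only at hbc
    omega

lemma expect_mul_indicator {X : Type*} [DecidableEq X] (p : PMF X) (φ : X → ℝ≥0∞) (a : X) :
    expect p (fun b => φ b * if b = a then 1 else 0) = p a * φ a := by
  rw [expect, tsum_eq_single a]
  · simp
  · intro b hb
    simp [hb]

/-- The recursion for the probabilities of the first split, in terms of the possible predecessors
of a split. -/
lemma splitGrow_indicator {M' : Multiset ℕ} (hM' : IsSplit (n + 1) M')
    (q : PMF (Multiset ℕ)) (hq : ∀ M ∈ q.support, IsSplit n M) :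
    splitGrow α γ n q (fun N => if N = M' then 1 else 0) =
      ENNReal.ofReal γ * (if {n, 1} = M' then 1 else 0) +
      ∑ b ∈ M'.toFinset, (if b = 1 then
        q (M'.erase 1) * ENNReal.ofReal ((((M'.erase 1).card : ℝ) - 1) * α - γ) else
        q ((b - 1) ::ₘ M'.erase b) * (((M'.erase b).count (b - 1) + 1 : ℕ) *
          ENNReal.ofReal (((b - 1 : ℕ) : ℝ) - α))) := by
  have h1 : ∀ M : Multiset ℕ, (if 1 ::ₘ M = M' then (1 : ℝ≥0∞) else 0) =
      if 1 ∈ M' then (if M = M'.erase 1 then 1 else 0) else 0 := by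
    intro M
    by_cases h : 1 ∈ M'
    · have : 1 ::ₘ M = M' ↔ M = M'.erase 1 :=
        ⟨fun h => by rw [← h, Multiset.erase_cons_head],
          fun h' => by rw [h', Multiset.cons_erase h]⟩
      simp only [this, h, if_true]
    · rw [if_neg h, if_neg]
      rintro rfl
      exact h (Multiset.mem_cons_self _ _)
  have h2 : q (0 ::ₘ M'.erase 1) = 0 := by
    by_contra h
    have := (hq _ ((PMF.mem_support_iff _ _).2 h)).one_le 0 (Multiset.mem_cons_self _ _)
    omega
  rw [splitGrow, expect_add]
  congr 1
  rw [show multisetDeriv (sizeGrow α) (fun N => if N = M' then 1 else 0) = _ from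
    funext (multisetDeriv_indicator hM'.one_le), expect_sum]
  simp only [h1]
  simp only [expect_mul_indicator, Multiset.count_cons_self]
  by_cases h : 1 ∈ M'
  · simp only [h, if_true, expect_mul_indicator]
    rw [← Finset.add_sum_erase _ _ (Multiset.mem_toFinset.2 h),
      ← Finset.add_sum_erase _ _ (Multiset.mem_toFinset.2 h), if_pos rfl]
    rw [Nat.sub_self, h2, zero_mul, zero_add]
    congr 1
    refine Finset.sum_congr rfl fun b hb => ?_
    rw [if_neg (Finset.ne_of_mem_erase hb)]
  · simp only [h, if_false, mul_zero, expect_const, zero_add]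
    refine Finset.sum_congr rfl fun b hb => ?_
    rw [if_neg]
    rintro rfl
    exact h (Multiset.mem_toFinset.1 hb)

end AlphaGamma

namespace AlphaGamma

open Finset

open scoped ENNReal

variable {α γ θ : ℝ} {n : ℕ}

lemma seqFactor_eq {M : Multiset ℕ} (hM : M.sum = n) : seqFactor α γ M =
    γ + (1 - α - γ) * (1 / ((n : ℝ) * ((n : ℝ) - 1))) *
      ((n : ℝ) ^ 2 - (M.map fun a : ℕ => (a : ℝ) ^ 2).sum) := by
  rw [seqFactor, crossSum_eq, hM]

lemma seqFactor_cons {a : ℕ} {R : Multiset ℕ} (hM : (a ::ₘ R).sum = n) :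
    seqFactor α γ (a ::ₘ R) = γ + (1 - α - γ) * (1 / ((n : ℝ) * ((n : ℝ) - 1))) *
      ((n : ℝ) ^ 2 - (((a + 1) ::ₘ R).map fun a : ℕ => (a : ℝ) ^ 2).sum +
        2 * ((a + 1 : ℕ) : ℝ) - 1) := by
  rw [seqFactor_eq hM, Multiset.map_cons, Multiset.map_cons, Multiset.sum_cons, Multiset.sum_cons]
  push_cast
  ring

lemma seqFactor_zero_cons (R : Multiset ℕ) : seqFactor α γ (0 ::ₘ R) = seqFactor α γ R := by
  rw [seqFactor, seqFactor, crossSum_cons]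
  simp

lemma seqSplit_within (hα : α < 1) {a : ℕ} (ha : 1 ≤ a) {R : Multiset ℕ}
    (hs : (a ::ₘ R).sum = n) :
    seqSplit α γ (a ::ₘ R) * ((R.count a + 1 : ℕ) * ((a : ℝ) - α)) =
      (((a + 1) ::ₘ R).count (a + 1) : ℝ) *
        (((a + 1 : ℕ) : ℝ) / ((n : ℝ) + 1) * seqFactor α γ (a ::ₘ R)) *
        (numSetPartitions ((a + 1) ::ₘ R) * pdGibbs α (-α - γ) ((a + 1) ::ₘ R) / pdW α n) := by
  have h := count_mul_numSetPartitions a R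
  have hn : (n : ℝ) = a + R.sum := by rw [← hs, Multiset.sum_cons, Nat.cast_add]
  rw [show (a : ℝ) + 1 + R.sum = (n : ℝ) + 1 by rw [hn]; ring] at h
  rw [seqSplit, hs, pdGibbs_succ_cons hα ha, Multiset.count_cons_self, Nat.cast_add_one,
    Nat.cast_add_one, Nat.cast_add_one]
  linear_combination -(pdGibbs α (-α - γ) (a ::ₘ R) * seqFactor α γ (a ::ₘ R) / pdW α n *
    ((a : ℝ) - α)) * h

lemma numSetPartitions_one_cons {R : Multiset ℕ} (hs : R.sum = n) :
    ((1 ::ₘ R).count 1 : ℝ) * (((1 : ℕ) : ℝ) / ((n : ℝ) + 1)) * numSetPartitions (1 ::ₘ R) =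
      numSetPartitions R := by
  have h := count_mul_numSetPartitions 0 R
  rw [numSetPartitions_zero_cons, hs] at h
  rw [← h, Multiset.count_cons_self]
  push_cast
  simp only [zero_add]
  rw [add_comm (1 : ℝ) (n : ℝ)]
  ring

lemma seqSplit_newBlock (hα : α < 1) {R : Multiset ℕ} (hs : R.sum = n) (hR : 2 ≤ R.card) :
    seqSplit α γ R * (((R.card : ℝ) - 1) * α - γ) =
      ((1 ::ₘ R).count 1 : ℝ) * (((1 : ℕ) : ℝ) / ((n : ℝ) + 1) * seqFactor α γ R) *
        (numSetPartitions (1 ::ₘ R) * pdGibbs α (-α - γ) (1 ::ₘ R) / pdW α n) := by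
  have h := numSetPartitions_one_cons hs
  rw [seqSplit, hs, pdGibbs_one_cons hα hR, ← h]
  ring

lemma seqSplit_rootEdge (hα : α < 1) (hn : 2 ≤ n) :
    γ = ((1 ::ₘ {n}).count 1 : ℝ) * (((1 : ℕ) : ℝ) / ((n : ℝ) + 1) * seqFactor α γ {n}) *
        (numSetPartitions (1 ::ₘ {n}) * pdGibbs α (-α - γ) (1 ::ₘ {n}) / pdW α n) := by
  have h := numSetPartitions_one_cons (R := {n}) (n := n) (by simp)
  have h1 : numSetPartitions {n} = 1 := by
    have : ((n.factorial : ℕ) : ℝ) ≠ 0 := by positivity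
    simp [numSetPartitions, this]
  have h2 : seqFactor α γ {n} = γ := by
    rw [seqFactor, crossSum_eq]
    simp
  have h3 : pdGibbs α (-α - γ) (1 ::ₘ {n}) = pdW α n := by
    simp [pdGibbs, pdA, pdW_one hα]
  rw [h1] at h
  rw [h2, h3]
  have h4 := (pdW_pos hα (show 1 ≤ n by omega)).ne'
  calc γ = ((1 ::ₘ {n} : Multiset ℕ).count 1 : ℝ) * (((1 : ℕ) : ℝ) / ((n : ℝ) + 1)) *
        numSetPartitions (1 ::ₘ {n}) * γ := by rw [h, one_mul]
    _ = _ := by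
      field_simp

lemma eq_of_isSplit_two {M : Multiset ℕ} (h : IsSplit 2 M) : M = {1, 1} := by
  have h1 : M.card • 1 ≤ M.sum := Multiset.card_nsmul_le_sum h.one_le
  have h2 := h.two_le_card
  rw [h.sum_eq, smul_eq_mul, mul_one] at h1
  obtain ⟨a, b, rfl⟩ := Multiset.card_eq_two.1 (le_antisymm h1 h2)
  have h3 := h.sum_eq
  have ha := h.one_le a (by simp)
  have hb := h.one_le b (by simp)
  rw [Multiset.insert_eq_cons, Multiset.sum_cons, Multiset.sum_singleton] at h3
  obtain rfl : a = 1 := by omega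
  obtain rfl : b = 1 := by omega
  rfl

lemma seqSplit_two (hα : α < 1) : seqSplit α γ {1, 1} = 1 := by
  have h : pdW α 2 = 1 - α := by
    rw [show 2 = 1 + 1 from rfl, pdW_succ hα le_rfl, pdW_one hα]
    simp
  have h1 : (1 - α) ≠ 0 := by linarith
  have h2 : seqFactor α γ {1, 1} = 1 - α := by
    rw [seqFactor_eq (n := 2) rfl]
    norm_num
    ring
  have h3 : numSetPartitions {1, 1} = 1 := by
    simp [numSetPartitions, Multiset.insert_eq_cons]
  have h4 : pdGibbs α (-α - γ) {1, 1} = 1 := by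
    simp [pdGibbs, pdA, pdW_one hα]
  have h5 : ({1, 1} : Multiset ℕ).sum = 2 := rfl
  rw [seqSplit, h2, h3, h4, h5, h]
  field_simp

/-- The explicit form of the splitting rule. -/
theorem toReal_splittingRule (hα0 : 0 ≤ α) (hα : α < 1) (hγ0 : 0 ≤ γ) (hγα : γ ≤ α) (hn : 2 ≤ n)
    {M : Multiset ℕ} (hM : IsSplit n M) :
    (splittingRule (shapeLaw α γ) n M).toReal = seqSplit α γ M := by
  induction n, hn using Nat.le_induction generalizing M with
  | base =>
    rw [eq_of_isSplit_two hM, splittingRule_two, seqSplit_two hα]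
    simp
  | succ n hn ih =>
    set q := splittingRule (shapeLaw α γ) n with hq
    have hn' : (2 : ℝ) ≤ n := by exact_mod_cast hn
    have hsupp : ∀ N ∈ q.support, IsSplit n N := fun N hN => isSplit_of_mem_support hα0 hn hN
    have key := mul_expect_splittingRule hα0 hα.le hγ0 hγα hn fun N => if N = M then 1 else 0
    have hind : expect (splittingRule (shapeLaw α γ) (n + 1)) (fun N => if N = M then 1 else 0) =
        splittingRule (shapeLaw α γ) (n + 1) M := by
      have := expect_mul_indicator (splittingRule (shapeLaw α γ) (n + 1)) (fun _ => 1) M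
      simpa using this
    rw [hind, ← hq, splitGrow_indicator hM q hsupp] at key
    -- the terms of the recursion are the terms of the sum over the element that is removed last
    set K := numSetPartitions M * pdGibbs α (-α - γ) M / pdW α n with hK
    set f : ℕ → ℝ := fun b => γ + (1 - α - γ) * (1 / ((n : ℝ) * ((n : ℝ) - 1))) *
      ((n : ℝ) ^ 2 - (M.map fun a : ℕ => (a : ℝ) ^ 2).sum + 2 * b - 1) with hf
    set U : ℕ → ℝ := fun b => (M.count b : ℝ) * ((b : ℝ) / ((n : ℝ) + 1) * f b) * K with hU
    have hsum : ∑ b ∈ M.toFinset, U b = seqFactor α γ M * K := by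
      rw [← sum_mul_seqFactor hn hM.sum_eq f fun b _ => rfl, Finset.sum_multiset_map_count,
        Finset.sum_mul]
      simp only [nsmul_eq_mul, hU]
    have hwithin : ∀ b ∈ M, b ≠ 1 → (q ((b - 1) ::ₘ M.erase b) *
        (((M.erase b).count (b - 1) + 1 : ℕ) *
          ENNReal.ofReal (((b - 1 : ℕ) : ℝ) - α))).toReal = U b := by
      intro b hb hb1
      obtain ⟨a, rfl⟩ : ∃ a, b = a + 1 := ⟨b - 1, by have := hM.one_le b hb; omega⟩
      have ha : 1 ≤ a := by omega
      have ha' : (1 : ℝ) ≤ a := by exact_mod_cast ha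
      obtain ⟨R, rfl⟩ := Multiset.exists_cons_of_mem hb
      have hsR : (a ::ₘ R).sum = n := by
        have := hM.sum_eq
        rw [Multiset.sum_cons] at this ⊢
        omega
      have hR : IsSplit n (a ::ₘ R) := by
        refine ⟨hsR, ?_, ?_⟩
        · simpa using hM.two_le_card
        · intro m hm
          rcases Multiset.mem_cons.1 hm with rfl | hm
          · exact ha
          · exact hM.one_le m (Multiset.mem_cons_of_mem hm)
      rw [Nat.add_sub_cancel, Multiset.erase_cons_head, ENNReal.toReal_mul, ENNReal.toReal_mul,
        ih hR, ENNReal.toReal_natCast, ENNReal.toReal_ofReal (by linarith),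
        seqSplit_within hα ha hsR, seqFactor_cons hsR]
    have hone : 1 ∈ M → (ENNReal.ofReal γ * (if {n, 1} = M then 1 else 0) + q (M.erase 1) *
        ENNReal.ofReal ((((M.erase 1).card : ℝ) - 1) * α - γ)).toReal = U 1 := by
      intro h1
      obtain ⟨R, rfl⟩ := Multiset.exists_cons_of_mem h1
      have hsR : R.sum = n := by
        have := hM.sum_eq
        rw [Multiset.sum_cons] at this
        omega
      have hfR : f 1 = seqFactor α γ R := by
        rw [← seqFactor_zero_cons, seqFactor_cons (a := 0) (by simpa using hsR)]
      have hpair : ({n, 1} : Multiset ℕ) = 1 ::ₘ R ↔ R = {n} := by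
        rw [Multiset.pair_comm, Multiset.insert_eq_cons, Multiset.cons_inj_right, eq_comm]
      simp only [hU, hfR, Multiset.erase_cons_head, hpair]
      by_cases hcard : 2 ≤ R.card
      · have hR : IsSplit n R :=
          ⟨hsR, hcard, fun m hm => hM.one_le m (Multiset.mem_cons_of_mem hm)⟩
        have hne : R ≠ {n} := by
          rintro rfl
          simp at hcard
        have hcard' : (2 : ℝ) ≤ R.card := by exact_mod_cast hcard
        rw [if_neg hne, mul_zero, zero_add, ENNReal.toReal_mul, ih hR,
          ENNReal.toReal_ofReal (by nlinarith), seqSplit_newBlock hα hsR hcard]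
      · have h2 := hM.two_le_card
        rw [Multiset.card_cons] at h2
        obtain ⟨m, rfl⟩ := Multiset.card_eq_one.1 (show R.card = 1 by omega)
        rw [Multiset.sum_singleton] at hsR
        subst hsR
        have hq0 : q {m} = 0 := by
          by_contra h
          have := (hsupp _ ((PMF.mem_support_iff _ _).2 h)).two_le_card
          simp at this
        rw [if_pos rfl, hq0, zero_mul, add_zero, mul_one, ENNReal.toReal_ofReal hγ0]
        exact seqSplit_rootEdge hα hn
    have hfin : ∀ N (c : ℝ≥0∞), c ≠ ∞ → q N * c ≠ ∞ := fun N c hc =>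
      ENNReal.mul_ne_top (q.apply_ne_top N) hc
    have hterm : ∀ b, (if b = 1 then q (M.erase 1) *
        ENNReal.ofReal ((((M.erase 1).card : ℝ) - 1) * α - γ) else q ((b - 1) ::ₘ M.erase b) *
        (((M.erase b).count (b - 1) + 1 : ℕ) * ENNReal.ofReal (((b - 1 : ℕ) : ℝ) - α))) ≠ ∞ := by
      intro b
      split_ifs
      · exact hfin _ _ ENNReal.ofReal_ne_top
      · exact hfin _ _ (ENNReal.mul_ne_top (ENNReal.natCast_ne_top _) ENNReal.ofReal_ne_top)
    have key2 : ((n : ℝ) - α) * (splittingRule (shapeLaw α γ) (n + 1) M).toReal =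
        seqFactor α γ M * K := by
      have h := congrArg ENNReal.toReal key
      rw [ENNReal.toReal_mul, ENNReal.toReal_ofReal (by linarith)] at h
      rw [h, ← hsum]
      by_cases h1 : 1 ∈ M
      · have h1' := Multiset.mem_toFinset.2 h1
        rw [← Finset.add_sum_erase _ _ h1', ← Finset.add_sum_erase _ _ h1', if_pos rfl,
          ← add_assoc, ENNReal.toReal_add, hone h1, ENNReal.toReal_sum fun b _ => hterm b]
        · congr 1
          refine Finset.sum_congr rfl fun b hb => ?_
          obtain ⟨hb1, hb⟩ := Finset.mem_erase.1 hb
          rw [if_neg hb1, hwithin b (Multiset.mem_toFinset.1 hb) hb1]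
        · refine ENNReal.add_ne_top.2 ⟨ENNReal.mul_ne_top ENNReal.ofReal_ne_top ?_,
            hfin _ _ ENNReal.ofReal_ne_top⟩
          split_ifs <;> simp
        · exact ENNReal.sum_ne_top.2 fun b _ => hterm b
      · have hne : ({n, 1} : Multiset ℕ) ≠ M := by
          rintro rfl
          simp at h1
        rw [if_neg hne, mul_zero, zero_add, ENNReal.toReal_sum fun b _ => hterm b]
        refine Finset.sum_congr rfl fun b hb => ?_
        have hb' := Multiset.mem_toFinset.1 hb
        have hb1 : b ≠ 1 := by
          rintro rfl
          exact h1 hb'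
        rw [if_neg hb1, hwithin b hb' hb1]
    have hpos : (n : ℝ) - α ≠ 0 := by linarith
    have hw := (pdW_pos hα (show 1 ≤ n by omega)).ne'
    refine mul_left_cancel₀ hpos ?_
    rw [key2, seqSplit, hM.sum_eq, pdW_succ hα (by omega), hK]
    field_simp

/-- The splitting rule in terms of `pdSplit`; the constant is `Z_n / w_n`. -/
theorem exists_pos_splittingRule_eq (hα0 : 0 ≤ α) (hα : α < 1) (hγ0 : 0 ≤ γ) (hγα : γ ≤ α)
    (hn : 2 ≤ n) : ∃ c : ℝ, 0 < c ∧
      (∑ p : n.Partition with 2 ≤ p.parts.card,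
        c * ((γ + (1 - α - γ) * (1 / ((n : ℝ) * ((n : ℝ) - 1))) * crossSum p.parts) *
          pdSplit α (-α - γ) p.parts)) = 1 ∧
      ∀ p : n.Partition, 2 ≤ p.parts.card →
        (splittingRule (shapeLaw α γ) n p.parts).toReal =
          c * ((γ + (1 - α - γ) * (1 / ((n : ℝ) * ((n : ℝ) - 1))) * crossSum p.parts) *
            pdSplit α (-α - γ) p.parts) := by
  have hZ := pdZ_pos hα0 hα hγα hn
  have hw := pdW_pos hα (show 1 ≤ n by omega)
  have hrule : ∀ p : n.Partition, 2 ≤ p.parts.card →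
      (splittingRule (shapeLaw α γ) n p.parts).toReal = pdZ α (-α - γ) n / pdW α n *
        ((γ + (1 - α - γ) * (1 / ((n : ℝ) * ((n : ℝ) - 1))) * crossSum p.parts) *
          pdSplit α (-α - γ) p.parts) := by
    intro p hp
    rw [toReal_splittingRule hα0 hα hγ0 hγα hn ⟨p.parts_sum, hp, fun m hm => p.parts_pos hm⟩,
      seqSplit, seqFactor, pdSplit, pdEPPF, p.parts_sum]
    field_simp
  refine ⟨pdZ α (-α - γ) n / pdW α n, div_pos hZ hw, ?_, hrule⟩
  rw [← Finset.sum_congr rfl fun p hp => hrule p (Finset.mem_filter.1 hp).2,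
    ← ENNReal.toReal_sum fun p _ => PMF.apply_ne_top _ _]
  have hinj : Function.Injective fun p : n.Partition => p.parts := fun p p' h =>
    Nat.Partition.ext h
  rw [← Finset.sum_image (s := {p : n.Partition | 2 ≤ p.parts.card})
    (g := fun p => p.parts) (f := fun M => splittingRule (shapeLaw α γ) n M) hinj.injOn,
    ← ENNReal.toReal_one, ← (splittingRule (shapeLaw α γ) n).tsum_coe]
  refine congrArg ENNReal.toReal (tsum_eq_sum fun M hM => ?_).symm
  by_contra h
  have hs := isSplit_of_mem_support hα0 hn ((PMF.mem_support_iff _ _).2 h)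
  refine hM (Finset.mem_image.2 ⟨toPartition n M, ?_, parts_toPartition hs⟩)
  rw [Finset.mem_filter, parts_toPartition hs]
  exact ⟨Finset.mem_univ _, hs.two_le_card⟩

end AlphaGamma

/-! ### Removing the leaf that was attached last -/

namespace AlphaGamma

open Finset

open scoped ENNReal

namespace LTree

variable {t t' t₁ t₂ : LTree} {A B C D A₁ A₂ : Finset ℕ} {x : ℕ} {e e₁ e₂ : Prop}

/-- The tree without the leaf `x`; a vertex with only one remaining child is suppressed.  (By
convention this is `t` itself if `x` is its only leaf.) -/
def prune (t : LTree) (x : ℕ) : LTree :=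
  if h : t.leaves = {x} then t else
  { leaves := t.leaves.erase x
    nodes := (t.nodes.erase {x}).image fun B => B.erase x
    top_mem := Finset.mem_image_of_mem (fun B : Finset ℕ => B.erase x)
      (Finset.mem_erase.2 ⟨h, t.top_mem⟩)
    singleton_mem := by
      intro i hi
      obtain ⟨hix, hi⟩ := Finset.mem_erase.1 hi
      refine Finset.mem_image.2 ⟨{i}, Finset.mem_erase.2 ⟨by simpa using hix,
        t.singleton_mem i hi⟩, Finset.erase_eq_of_notMem (by simpa using Ne.symm hix)⟩
    nonempty_of_mem := by
      intro B hB
      obtain ⟨C, hC, rfl⟩ := Finset.mem_image.1 hB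
      obtain ⟨hCx, hC⟩ := Finset.mem_erase.1 hC
      rw [Finset.nonempty_iff_ne_empty]
      intro h0
      rcases (Finset.erase_eq_empty_iff C x).1 h0 with h1 | h1
      · exact (t.nonempty_of_mem C hC).ne_empty h1
      · exact hCx h1
    subset_of_mem := by
      intro B hB
      obtain ⟨C, hC, rfl⟩ := Finset.mem_image.1 hB
      exact Finset.erase_subset_erase x (t.subset_of_mem C (Finset.mem_of_mem_erase hC))
    laminar := by
      intro B hB B' hB'
      obtain ⟨C, hC, rfl⟩ := Finset.mem_image.1 hB
      obtain ⟨C', hC', rfl⟩ := Finset.mem_image.1 hB'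
      rcases t.laminar C (Finset.mem_of_mem_erase hC) C' (Finset.mem_of_mem_erase hC')
        with h | h | h
      · exact Or.inl (h.mono (Finset.erase_subset _ _) (Finset.erase_subset _ _))
      · exact Or.inr (Or.inl (Finset.erase_subset_erase x h))
      · exact Or.inr (Or.inr (Finset.erase_subset_erase x h)) }

lemma exists_parent (hB : B ∈ t.nodes) (hBt : B ≠ t.leaves) :
    ∃ D ∈ t.nodes, B ∈ t.children D := by
  obtain ⟨D, hD, hmin⟩ := Finset.exists_min_image {D ∈ t.nodes | B ⊂ D} Finset.card
    ⟨t.leaves, by simp [t.top_mem, Finset.ssubset_iff_subset_ne, t.subset_of_mem B hB, hBt]⟩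
  simp only [Finset.mem_filter] at hD hmin
  refine ⟨D, hD.1, mem_children.2 ⟨hB, hD.2, fun E hE hBE hED => ?_⟩⟩
  by_cases h : E = B
  · exact Or.inl h
  · exact Or.inr (Finset.eq_of_subset_of_card_le hED
      (hmin E ⟨hE, Finset.ssubset_iff_subset_ne.2 ⟨hBE, Ne.symm h⟩⟩))

/-- The parent of `B` is contained in every vertex that strictly contains `B`. -/
lemma parent_subset (hD : D ∈ t.nodes) (hB : B ∈ t.children D) (hC : C ∈ t.nodes) (hBC : B ⊂ C) :
    D ⊆ C := by
  obtain ⟨hBn, hBD, hmax⟩ := mem_children.1 hB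
  obtain ⟨i, hi⟩ := t.nonempty_of_mem B hBn
  rcases t.laminar C hC D hD with h | h | h
  · exact absurd (hBD.subset hi) (Finset.disjoint_left.1 h (hBC.subset hi))
  · rcases hmax C hC hBC.subset h with h1 | h1
    · exact absurd h1.symm hBC.ne
    · exact h1.symm.subset
  · exact h

/-- Every tree with at least two leaves arises by attaching any of its leaves `x`.  The site is given
by the set `A` of the other leaves above the parent of `x`: if `A` is a vertex, then `x` has one
sibling and is attached to the edge below it, otherwise `x` is attached to a branch point. -/
lemma exists_isAttach (hx : x ∈ t'.leaves) (h2 : t'.leaves ≠ {x}) :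
    ∃ t A, IsAttach (A ∈ t'.nodes) t x A t' ∧ (A ∉ t'.nodes → A ∈ t.branchPoints) := by
  have hxn := t'.singleton_mem x hx
  obtain ⟨D, hD, hxD⟩ := exists_parent hxn h2.symm
  have hxltD := ssubset_of_mem_children hxD
  have hxD' : x ∈ D := hxltD.subset (Finset.mem_singleton_self x)
  set A := D.erase x with hA
  have hAne : A.Nonempty := by
    rw [Finset.nonempty_iff_ne_empty]
    intro h0
    rcases (Finset.erase_eq_empty_iff D x).1 h0 with h1 | h1
    · rw [h1] at hxD'
      exact absurd hxD' (Finset.notMem_empty x)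
    · exact hxltD.ne h1.symm
  have hxA : x ∉ A := Finset.notMem_erase x D
  have hAD : insert x A = D := Finset.insert_erase hxD'
  have hleaves : (t'.prune x).leaves = t'.leaves.erase x := by simp [prune, h2]
  have hnodes : (t'.prune x).nodes = (t'.nodes.erase {x}).image fun B => B.erase x := by
    simp [prune, h2]
  -- a vertex that contains `x` contains the parent of `x`
  have hwith : ∀ B ∈ t'.nodes, B ≠ {x} → x ∈ B → lift x A (B.erase x) = B := by
    intro B hB hBx hxB
    have hDB := parent_subset hD hxD hB
      (Finset.ssubset_iff_subset_ne.2 ⟨by simpa using hxB, Ne.symm hBx⟩)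
    rw [lift_of_subset (Finset.erase_subset_erase x hDB), Finset.insert_erase hxB]
  have hwithout : ∀ B ∈ t'.nodes, x ∉ B → A ⊆ B → B = A := by
    intro B hB hxB hAB
    obtain ⟨i, hi⟩ := hAne
    rcases t'.laminar B hB D hD with h | h | h
    · exact absurd (Finset.mem_of_mem_erase hi) (Finset.disjoint_left.1 h (hAB hi))
    · exact (Finset.subset_erase.2 ⟨h, hxB⟩).antisymm hAB
    · exact absurd (h hxD') hxB
  have hDx : D ≠ {x} := hxltD.ne'
  have hAmem : A ∈ (t'.prune x).nodes := by
    rw [hnodes]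
    exact Finset.mem_image_of_mem (fun B : Finset ℕ => B.erase x) (Finset.mem_erase.2 ⟨hDx, hD⟩)
  refine ⟨t'.prune x, A, ⟨by simp [hleaves], hAmem, ?_, fun B => ?_⟩, fun hAn => ?_⟩
  · rw [hleaves, Finset.insert_erase hx]
  · rw [hnodes]
    constructor
    · intro hB
      by_cases hBx : B = {x}
      · exact Or.inr (Or.inl hBx)
      have hB' : B.erase x ∈ (t'.nodes.erase {x}).image fun B => B.erase x :=
        Finset.mem_image_of_mem (fun B : Finset ℕ => B.erase x) (Finset.mem_erase.2 ⟨hBx, hB⟩)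
      by_cases hxB : x ∈ B
      · exact Or.inr (Or.inr ⟨_, hB', hwith B hB hBx hxB⟩)
      · by_cases hAB : A ⊆ B
        · have := hwithout B hB hxB hAB
          exact Or.inl ⟨this ▸ hB, this⟩
        · refine Or.inr (Or.inr ⟨_, hB', ?_⟩)
          rw [Finset.erase_eq_of_notMem hxB, lift_of_not_subset hAB]
    · rintro (⟨h1, rfl⟩ | rfl | ⟨C, hC, rfl⟩)
      · exact h1
      · exact hxn
      · obtain ⟨B, hB, rfl⟩ := Finset.mem_image.1 hC
        obtain ⟨hBx, hB⟩ := Finset.mem_erase.1 hB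
        by_cases hxB : x ∈ B
        · rwa [hwith B hB hBx hxB]
        · rw [Finset.erase_eq_of_notMem hxB]
          by_cases hAB : A ⊆ B
          · rw [lift_of_subset hAB, hwithout B hB hxB hAB, hAD]
            exact hD
          · rwa [lift_of_not_subset hAB]
  · refine mem_branchPoints.2 ⟨hAmem, ?_⟩
    by_contra hcard
    have h1 : A.card = 1 := by
      have := hAne.card_pos
      omega
    obtain ⟨i, hi⟩ := Finset.card_eq_one.1 h1
    have hiD : i ∈ D := Finset.mem_of_mem_erase (hi ▸ Finset.mem_singleton_self i : i ∈ A)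
    rw [hi] at hAn
    exact hAn (t'.singleton_mem i (t'.subset_of_mem D hD hiD))

namespace IsAttach

lemma nodes_eq (h : IsAttach e t x A t') :
    t.nodes = (t'.nodes.erase {x}).image fun B => B.erase x := by
  ext C
  rw [Finset.mem_image]
  constructor
  · intro hC
    refine ⟨lift x A C, Finset.mem_erase.2 ⟨?_, h.lift_mem hC⟩, erase_lift (h.notMem_of_mem hC)⟩
    exact fun h' => h.not_lift_subset_singleton hC h'.subset
  · rintro ⟨B, hB, rfl⟩
    obtain ⟨hBx, hB⟩ := Finset.mem_erase.1 hB
    rcases (h.nodes B).1 hB with ⟨-, rfl⟩ | rfl | ⟨C, hC, rfl⟩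
    · rw [Finset.erase_eq_of_notMem (h.notMem_of_mem h.mem)]
      exact h.mem
    · exact absurd rfl hBx
    · rwa [erase_lift (h.notMem_of_mem hC)]

/-- The tree before the last growth step is determined by the tree after it. -/
lemma tree_eq (h₁ : IsAttach e₁ t₁ x A₁ t') (h₂ : IsAttach e₂ t₂ x A₂ t') : t₁ = t₂ := by
  refine LTree.ext ?_ (by rw [h₁.nodes_eq, h₂.nodes_eq])
  have h3 := h₁.leaves.symm.trans h₂.leaves
  rw [← Finset.erase_insert h₁.notMem, h3, Finset.erase_insert h₂.notMem]

/-- The selected site is determined by the tree after the growth step: the new leaf is a child of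
`A ∪ {x}`. -/
lemma vertex_eq (h₁ : IsAttach e₁ t₁ x A₁ t') (h₂ : IsAttach e₂ t₂ x A₂ t') : A₁ = A₂ := by
  have hc₁ := h₁.singleton_mem_children
  have hc₂ := h₂.singleton_mem_children
  have hn₁ := h₁.lift_mem h₁.mem
  have hn₂ := h₂.lift_mem h₂.mem
  have h := (parent_subset hn₁ hc₁ hn₂ (ssubset_of_mem_children hc₂)).antisymm
    (parent_subset hn₂ hc₂ hn₁ (ssubset_of_mem_children hc₁))
  rw [← erase_lift (A := A₁) (h₁.notMem_of_mem h₁.mem), h,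
    erase_lift (h₂.notMem_of_mem h₂.mem)]

lemma mem_nodes_iff (h : IsAttach e t x A t') : A ∈ t'.nodes ↔ e := by
  rw [h.nodes]
  constructor
  · rintro (⟨he, -⟩ | h1 | ⟨C, hC, h1⟩)
    · exact he
    · exact absurd (h1 ▸ Finset.mem_singleton_self x) (h.notMem_of_mem h.mem)
    · exact absurd h1 (h.lift_ne_self hC)
  · exact fun he => Or.inl ⟨he, rfl⟩

end IsAttach

/-- The vertex that represents a site: the endpoint of an edge, or a branch point. -/
def siteVertex (t : LTree) : t.Site → Finset ℕ
  | Sum.inl A => A.1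
  | Sum.inr A => A.1

lemma isAttach_insertAt (s : t.Site) :
    IsAttach (s.isLeft = true) t t.nextLabel (t.siteVertex s) (t.insertAt s) := by
  rcases s with A | A
  · simpa [siteVertex, insertAt] using isAttach_insertEdge t.nextLabel_notMem A.2
  · simpa [siteVertex, insertAt] using isAttach_insertVertex t.nextLabel_notMem A.2

lemma insertAt_injective (t : LTree) : Function.Injective t.insertAt := by
  intro s s' h
  have h1 := isAttach_insertAt s
  have h2 := isAttach_insertAt s'
  rw [← h] at h2
  have h3 := h1.vertex_eq h2
  have h4 : s.isLeft = true ↔ s'.isLeft = true := by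
    rw [← h1.mem_nodes_iff, ← h2.mem_nodes_iff, h3]
  rcases s with ⟨A, hA⟩ | ⟨A, hA⟩ <;> rcases s' with ⟨B, hB⟩ | ⟨B, hB⟩ <;>
    simp_all [siteVertex]

lemma eq_of_insertAt_eq (hn : t₁.nextLabel = t₂.nextLabel) {s₁ : t₁.Site} {s₂ : t₂.Site}
    (h : t₁.insertAt s₁ = t₂.insertAt s₂) : t₁ = t₂ := by
  have h1 := isAttach_insertAt s₁
  have h2 := isAttach_insertAt s₂
  rw [← h, ← hn] at h2
  exact h1.tree_eq h2

lemma exists_insertAt_eq {n : ℕ} (hn : 1 ≤ n) (ht' : t'.leaves = Finset.Icc 1 (n + 1)) :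
    ∃ t : LTree, t.leaves = Finset.Icc 1 n ∧ ∃ s : t.Site, t.insertAt s = t' := by
  have hx : n + 1 ∈ t'.leaves := by simp [ht']
  have h2 : t'.leaves ≠ {n + 1} := by
    intro h
    have h1 : 1 ∈ t'.leaves := by simp [ht']
    rw [h, Finset.mem_singleton] at h1
    omega
  obtain ⟨t, A, h, hbp⟩ := exists_isAttach hx h2
  have hl : t.leaves = Finset.Icc 1 n := by
    rw [← Finset.erase_insert h.notMem, ← h.leaves, ht']
    ext i
    simp only [Finset.mem_erase, Finset.mem_Icc]
    omega
  refine ⟨t, hl, ?_⟩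
  have hnext := nextLabel_eq t n hl
  by_cases hA : A ∈ t'.nodes
  · refine ⟨Sum.inl ⟨A, h.mem⟩, ?_⟩
    have h3 := isAttach_insertAt (t := t) (Sum.inl ⟨A, h.mem⟩)
    simp only [hA] at h
    rw [hnext] at h3
    simp only [Sum.isLeft_inl] at h3
    exact h3.unique h
  · refine ⟨Sum.inr ⟨A, hbp hA⟩, ?_⟩
    have h3 := isAttach_insertAt (t := t) (Sum.inr ⟨A, hbp hA⟩)
    simp only [hA] at h
    rw [hnext] at h3
    simp only [Sum.isLeft_inr, Bool.false_eq_true] at h3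
    exact h3.unique h

end LTree

variable {α γ : ℝ} {n : ℕ}

/-- The recursion for the probabilities of the labelled trees. -/
lemma mul_treeLaw_insertAt (hα0 : 0 ≤ α) (hα1 : α ≤ 1) (hγ0 : 0 ≤ γ) (hγα : γ ≤ α) (hn : 2 ≤ n)
    {t : LTree} (ht : t.leaves = Finset.Icc 1 n) (s : t.Site) :
    ENNReal.ofReal ((n : ℝ) - α) * treeLaw α γ (n + 1) (t.insertAt s) =
      treeLaw α γ n t * ENNReal.ofReal (t.weight α γ s) := by
  classical
  have hgrow : ∀ t' : LTree, t'.leaves = Finset.Icc 1 n →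
      ENNReal.ofReal ((n : ℝ) - α) * t'.grow α γ (t.insertAt s) =
        ∑ s' : t'.Site, ENNReal.ofReal (t'.weight α γ s') *
          if t'.insertAt s' = t.insertAt s then 1 else 0 := by
    intro t' ht'
    have hc : t'.leaves.card = n := by simp [ht']
    have h := LTree.mul_expect_grow (t := t') hα0 hα1 hγ0 hγα (by omega)
      fun u => if u = t.insertAt s then 1 else 0
    have h' := expect_mul_indicator (t'.grow α γ) (fun _ => 1) (t.insertAt s)
    simp only [one_mul, mul_one] at h'
    rw [h', hc] at h
    exact h
  rw [treeLaw_succ hn, PMF.bind_apply, tsum_eq_single t]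
  · rw [mul_left_comm, hgrow t ht, Finset.sum_eq_single s]
    · simp
    · intro s' _ hs'
      rw [if_neg fun h => hs' (t.insertAt_injective h), mul_zero]
    · simp
  · intro t' ht'
    by_cases hsupp : t' ∈ (treeLaw α γ n).support
    · have hl := leaves_of_mem_support_treeLaw hα0 (by omega) hsupp
      have h := hgrow t' hl
      rw [Finset.sum_eq_zero] at h
      · rcases mul_eq_zero.1 h with h | h
        · rw [ENNReal.ofReal_eq_zero] at h
          have : (2 : ℝ) ≤ n := by exact_mod_cast hn
          linarith
        · rw [h, mul_zero]
      · intro s' _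
        rw [if_neg, mul_zero]
        intro h'
        refine ht' (LTree.eq_of_insertAt_eq ?_ h')
        rw [LTree.nextLabel_eq _ _ hl, LTree.nextLabel_eq _ _ ht]
    · rw [PMF.mem_support_iff, not_not] at hsupp
      rw [hsupp, zero_mul]

end AlphaGamma

/-! ### Exchangeability -/

namespace AlphaGamma

open Finset

open scoped ENNReal

namespace LTree

variable {t t' : LTree} {A B C D : Finset ℕ} {x : ℕ} {e : Prop} {α γ : ℝ}

/-- In the case `γ = 1 - α`, the probability of a labelled tree up to a constant: a factor `1 - α`
for each branch point but one, and a factor `(2 α - 1) ⋯ ((k - 1) α - 1)` for each branch point with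
`k` children.  It depends on the numbers of children only. -/
noncomputable def gibbsWeight (α : ℝ) (t : LTree) : ℝ≥0∞ :=
  ENNReal.ofReal (1 - α) ^ (t.branchPoints.card - 1) *
    ∏ A ∈ t.branchPoints, ∏ j ∈ Finset.Ico 2 (t.children A).card,
      ENNReal.ofReal ((j : ℝ) * α - 1)

lemma card_lift_of_ne (hA : A.Nonempty) (hC : C.card = 1) (hCA : C ≠ A) : lift x A C = C := by
  obtain ⟨i, rfl⟩ := Finset.card_eq_one.1 hC
  exact lift_of_not_subset fun h => hCA (hA.subset_singleton_iff.1 h).symm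

lemma two_le_card_children_of_mem (hA : A ∈ t.branchPoints) : 2 ≤ (t.children A).card := by
  obtain ⟨hAn, h2⟩ := mem_branchPoints.1 hA
  have h := (t.sub A).two_le_card_children (by rwa [sub_leaves hAn])
  rwa [sub_leaves hAn, children_sub hAn subset_rfl] at h

namespace IsAttach

lemma injOn_lift (h : IsAttach e t x A t') :
    Set.InjOn (lift x A) (t.nodes : Set (Finset ℕ)) := fun _ hD _ hE hDE =>
  lift_inj (h.notMem_of_mem hD) (h.notMem_of_mem hE) hDE

lemma card_children_lift (h : IsAttach e t x A t') (hC : C ∈ t.nodes) (hCA : C ≠ A) :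
    (t'.children (lift x A C)).card = (t.children C).card := by
  rw [h.children_lift hC hCA, Finset.card_image_of_injOn]
  exact h.injOn_lift.mono fun D hD => mem_nodes_of_mem_children hD

lemma card_children_lift_self_of_vertex (h : IsAttach e t x A t') (he : ¬ e) :
    (t'.children (lift x A A)).card = (t.children A).card + 1 := by
  rw [h.children_lift_self_of_vertex he, Finset.card_insert_of_notMem,
    Finset.card_image_of_injOn (h.injOn_lift.mono fun D hD => mem_nodes_of_mem_children hD)]
  intro h'
  obtain ⟨D, hD, hDx⟩ := Finset.mem_image.1 h'
  exact h.not_lift_subset_singleton (mem_nodes_of_mem_children hD) hDx.subset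

lemma card_children_lift_self_of_edge (h : IsAttach e t x A t') (he : e) :
    (t'.children (lift x A A)).card = 2 := by
  rw [h.children_lift_self_of_edge he, Finset.card_pair]
  intro h'
  exact h.notMem_of_mem h.mem (h' ▸ Finset.mem_singleton_self x)

lemma card_lift_self (h : IsAttach e t x A t') : (lift x A A).card = A.card + 1 := by
  rw [lift_of_subset subset_rfl, Finset.card_insert_of_notMem (h.notMem_of_mem h.mem)]

lemma branchPoints_of_vertex (h : IsAttach e t x A t') (he : ¬ e) (hA : A ∈ t.branchPoints) :
    t'.branchPoints = t.branchPoints.image (lift x A) := by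
  have hAne := t.nonempty_of_mem A h.mem
  ext B
  rw [mem_branchPoints, h.nodes, Finset.mem_image]
  constructor
  · rintro ⟨⟨h1, -⟩ | rfl | ⟨C, hC, rfl⟩, h2⟩
    · exact absurd h1 he
    · simp at h2
    · refine ⟨C, mem_branchPoints.2 ⟨hC, ?_⟩, rfl⟩
      by_contra hc
      have hc1 : C.card = 1 := by
        have := (t.nonempty_of_mem C hC).card_pos
        omega
      have hCA : C ≠ A := by
        rintro rfl
        exact hc (mem_branchPoints.1 hA).2
      rw [card_lift_of_ne hAne hc1 hCA] at h2
      omega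
  · rintro ⟨C, hC, rfl⟩
    obtain ⟨hC, h2⟩ := mem_branchPoints.1 hC
    exact ⟨Or.inr (Or.inr ⟨C, hC, rfl⟩), h2.trans (Finset.card_le_card subset_lift)⟩

lemma branchPoints_of_edge (h : IsAttach e t x A t') (he : e) :
    t'.branchPoints = insert (lift x A A)
      (t.branchPoints.image fun C => if C = A then A else lift x A C) := by
  have hAne := t.nonempty_of_mem A h.mem
  ext B
  rw [mem_branchPoints, h.nodes, Finset.mem_insert, Finset.mem_image]
  constructor
  · rintro ⟨⟨-, rfl⟩ | rfl | ⟨C, hC, rfl⟩, h2⟩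
    · exact Or.inr ⟨B, mem_branchPoints.2 ⟨h.mem, h2⟩, if_pos rfl⟩
    · simp at h2
    · by_cases hCA : C = A
      · exact Or.inl (by rw [hCA])
      · refine Or.inr ⟨C, mem_branchPoints.2 ⟨hC, ?_⟩, if_neg hCA⟩
        by_contra hc
        have hc1 : C.card = 1 := by
          have := (t.nonempty_of_mem C hC).card_pos
          omega
        rw [card_lift_of_ne hAne hc1 hCA] at h2
        omega
  · rintro (rfl | ⟨C, hC, rfl⟩)
    · refine ⟨Or.inr (Or.inr ⟨A, h.mem, rfl⟩), ?_⟩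
      have := hAne.card_pos
      rw [h.card_lift_self]
      omega
    · obtain ⟨hC, h2⟩ := mem_branchPoints.1 hC
      by_cases hCA : C = A
      · rw [if_pos hCA]
        exact ⟨Or.inl ⟨he, rfl⟩, hCA ▸ h2⟩
      · rw [if_neg hCA]
        exact ⟨Or.inr (Or.inr ⟨C, hC, rfl⟩), h2.trans (Finset.card_le_card subset_lift)⟩

lemma gibbsWeight_of_vertex (h : IsAttach e t x A t') (he : ¬ e) (hA : A ∈ t.branchPoints) :
    gibbsWeight α t' =
      gibbsWeight α t * ENNReal.ofReal (((t.children A).card : ℝ) * α - 1) := by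
  have hinj : Set.InjOn (lift x A) (t.branchPoints : Set (Finset ℕ)) :=
    h.injOn_lift.mono fun D hD => (mem_branchPoints.1 hD).1
  rw [gibbsWeight, gibbsWeight, h.branchPoints_of_vertex he hA, Finset.card_image_of_injOn hinj,
    Finset.prod_image hinj, ← Finset.mul_prod_erase _ _ hA, ← Finset.mul_prod_erase _ _ hA,
    h.card_children_lift_self_of_vertex he,
    Finset.prod_Ico_succ_top (two_le_card_children_of_mem hA)]
  rw [Finset.prod_congr (s₁ := t.branchPoints.erase A) rfl fun C hC =>
    show (∏ j ∈ Finset.Ico 2 (t'.children (lift x A C)).card,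
      ENNReal.ofReal ((j : ℝ) * α - 1)) =
      ∏ j ∈ Finset.Ico 2 (t.children C).card, ENNReal.ofReal ((j : ℝ) * α - 1) by
    rw [h.card_children_lift (mem_branchPoints.1 (Finset.mem_of_mem_erase hC)).1
      (Finset.ne_of_mem_erase hC)]]
  ring

lemma gibbsWeight_of_edge (h : IsAttach e t x A t') (he : e) (h2 : 2 ≤ t.leaves.card) :
    gibbsWeight α t' = gibbsWeight α t * ENNReal.ofReal (1 - α) := by
  have hinj : Set.InjOn (fun C => if C = A then A else lift x A C)
      (t.branchPoints : Set (Finset ℕ)) := by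
    intro C hC D hD hCD
    have hCn := (mem_branchPoints.1 hC).1
    have hDn := (mem_branchPoints.1 hD).1
    by_cases hCA : C = A <;> by_cases hDA : D = A <;>
      simp only [hCA, hDA, if_true, if_false] at hCD
    · rw [hCA, hDA]
    · exact absurd hCD.symm (h.lift_ne_self hDn)
    · exact absurd hCD (h.lift_ne_self hCn)
    · exact h.injOn_lift hCn hDn hCD
  have hnot : lift x A A ∉ t.branchPoints.image fun C => if C = A then A else lift x A C := by
    intro h'
    obtain ⟨C, hC, hCl⟩ := Finset.mem_image.1 h'
    by_cases hCA : C = A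
    · rw [if_pos hCA] at hCl
      exact h.lift_ne_self h.mem hCl.symm
    · rw [if_neg hCA] at hCl
      exact hCA (h.injOn_lift (mem_branchPoints.1 hC).1 h.mem hCl)
  have hpos : 1 ≤ t.branchPoints.card :=
    Finset.card_pos.2 ⟨t.leaves, mem_branchPoints.2 ⟨t.top_mem, h2⟩⟩
  rw [gibbsWeight, gibbsWeight, h.branchPoints_of_edge he, Finset.card_insert_of_notMem hnot,
    Finset.card_image_of_injOn hinj, Finset.prod_insert hnot, Finset.prod_image hinj,
    h.card_children_lift_self_of_edge he, Finset.Ico_self, Finset.prod_empty, one_mul,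
    Nat.add_sub_cancel]
  rw [Finset.prod_congr rfl fun C hC => show (∏ j ∈ Finset.Ico 2
      (t'.children (if C = A then A else lift x A C)).card, ENNReal.ofReal ((j : ℝ) * α - 1)) =
      ∏ j ∈ Finset.Ico 2 (t.children C).card, ENNReal.ofReal ((j : ℝ) * α - 1) by
    by_cases hCA : C = A
    · rw [if_pos hCA, h.children_self, hCA]
    · rw [if_neg hCA, h.card_children_lift (mem_branchPoints.1 hC).1 hCA]]
  obtain ⟨b, hb⟩ := Nat.exists_eq_add_of_le' hpos
  rw [hb, Nat.add_sub_cancel, pow_succ]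
  ring

end IsAttach

lemma gibbsWeight_insertAt (hγ : γ = 1 - α) (h2 : 2 ≤ t.leaves.card) (s : t.Site) :
    gibbsWeight α (t.insertAt s) = gibbsWeight α t * ENNReal.ofReal (t.weight α γ s) := by
  rcases s with A | A
  · have hw : t.weight α γ (Sum.inl A) = 1 - α := by
      simp [weight, hγ]
    rw [hw]
    exact (isAttach_insertEdge t.nextLabel_notMem A.2).gibbsWeight_of_edge trivial h2
  · have hw : t.weight α γ (Sum.inr A) = ((t.children A.1).card : ℝ) * α - 1 := by
      simp only [weight, hγ]
      ring
    rw [hw]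
    exact (isAttach_insertVertex t.nextLabel_notMem A.2).gibbsWeight_of_vertex not_false A.2

lemma image_perm_injective (σ : Equiv.Perm ℕ) :
    Function.Injective (Finset.image σ : Finset ℕ → Finset ℕ) :=
  Finset.image_injective σ.injective

lemma relabel_injective (σ : Equiv.Perm ℕ) : Function.Injective (relabel σ) := by
  intro t t' h
  refine LTree.ext (image_perm_injective σ (congrArg leaves h))
    (Finset.image_injective (image_perm_injective σ) (congrArg nodes h))

lemma relabel_symm (σ : Equiv.Perm ℕ) (t : LTree) : relabel σ (relabel σ.symm t) = t := by
  have h : ∀ A : Finset ℕ, (A.image σ.symm).image σ = A := by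
    intro A
    rw [Finset.image_image, Equiv.self_comp_symm, Finset.image_id]
  refine LTree.ext (h _) ?_
  change (t.nodes.image (Finset.image σ.symm)).image (Finset.image σ) = t.nodes
  rw [Finset.image_image]
  conv_rhs => rw [← Finset.image_id (s := t.nodes)]
  exact Finset.image_congr fun A _ => h A

lemma children_relabel (σ : Equiv.Perm ℕ) (t : LTree) (A : Finset ℕ) :
    (relabel σ t).children (A.image σ) = (t.children A).image (Finset.image σ) := by
  have hsub : ∀ {A C : Finset ℕ}, A.image σ ⊆ C.image σ ↔ A ⊆ C :=
    Finset.image_subset_image_iff σ.injective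
  have hss : ∀ {A C : Finset ℕ}, A.image σ ⊂ C.image σ ↔ A ⊂ C := by
    intro A C
    rw [Finset.ssubset_def, Finset.ssubset_def, hsub, hsub]
  ext C
  simp only [mem_children, Finset.mem_image, relabel]
  constructor
  · rintro ⟨⟨C, hC, rfl⟩, hlt, hmax⟩
    refine ⟨C, ⟨hC, hss.1 hlt, fun D hD hCD hDA => ?_⟩, rfl⟩
    exact (hmax _ ⟨D, hD, rfl⟩ (hsub.2 hCD) (hsub.2 hDA)).imp
      (fun h => image_perm_injective σ h) fun h => image_perm_injective σ h
  · rintro ⟨C, ⟨hC, hlt, hmax⟩, rfl⟩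
    refine ⟨⟨C, hC, rfl⟩, hss.2 hlt, ?_⟩
    rintro _ ⟨D, hD, rfl⟩ hCD hDA
    exact (hmax D hD (hsub.1 hCD) (hsub.1 hDA)).imp (fun h => by rw [h]) fun h => by rw [h]

lemma branchPoints_relabel (σ : Equiv.Perm ℕ) (t : LTree) :
    (relabel σ t).branchPoints = t.branchPoints.image (Finset.image σ) := by
  ext A
  simp only [mem_branchPoints, Finset.mem_image, relabel]
  constructor
  · rintro ⟨⟨C, hC, rfl⟩, h2⟩
    rw [Finset.card_image_of_injective _ σ.injective] at h2
    exact ⟨C, ⟨hC, h2⟩, rfl⟩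
  · rintro ⟨C, ⟨hC, h2⟩, rfl⟩
    rw [Finset.card_image_of_injective _ σ.injective]
    exact ⟨⟨C, hC, rfl⟩, h2⟩

lemma gibbsWeight_relabel (σ : Equiv.Perm ℕ) (t : LTree) :
    gibbsWeight α (relabel σ t) = gibbsWeight α t := by
  rw [gibbsWeight, gibbsWeight, branchPoints_relabel,
    Finset.card_image_of_injective _ (image_perm_injective σ),
    Finset.prod_image (image_perm_injective σ).injOn]
  simp only [children_relabel, Finset.card_image_of_injective _ (image_perm_injective σ)]

end LTree

variable {α γ : ℝ} {n : ℕ}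

/-- The unique tree with leaves `1` and `2`. -/
def cherry : LTree :=
  (LTree.single 1).insertEdge 2 (by simp [LTree.single]) {1} (by simp [LTree.single])

lemma treeLaw_two : treeLaw α γ 2 = PMF.pure cherry := rfl

lemma eq_cherry {t : LTree} (ht : t.leaves = Finset.Icc 1 2) : t = cherry := by
  obtain ⟨u, hu, s, rfl⟩ := LTree.exists_insertAt_eq le_rfl ht
  obtain ⟨i, rfl⟩ := LTree.eq_single_of_card_eq_one (t := u) (by simp [hu])
  have hi : i = 1 := by simpa [LTree.single] using hu
  subst hi
  rcases s with ⟨A, hA⟩ | ⟨A, hA⟩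
  · have hA' : A = {1} := by simpa [LTree.single] using hA
    subst hA'
    rfl
  · obtain ⟨h1, h2⟩ := LTree.mem_branchPoints.1 hA
    have hA' : A = {1} := by simpa [LTree.single] using h1
    subst hA'
    simp at h2

lemma gibbsWeight_cherry : LTree.gibbsWeight α cherry = 1 := by
  have h1 : cherry.branchPoints = {{1, 2}} := by decide
  have h2 : (cherry.children {1, 2}).card = 2 := by decide
  simp [LTree.gibbsWeight, h1, h2]

/-- In the case `γ = 1 - α`, the probability of a labelled tree is a function of its shape. -/
lemma exists_treeLaw_eq (hα0 : 0 ≤ α) (hα1 : α ≤ 1) (hγ0 : 0 ≤ γ) (hγα : γ ≤ α)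
    (hγ : γ = 1 - α) (hn : 2 ≤ n) : ∃ c : ℝ≥0∞, ∀ t : LTree, t.leaves = Finset.Icc 1 n →
      treeLaw α γ n t = c * LTree.gibbsWeight α t := by
  induction n, hn using Nat.le_induction with
  | base =>
    refine ⟨1, fun t ht => ?_⟩
    rw [eq_cherry ht, gibbsWeight_cherry, treeLaw_two]
    simp
  | succ n hn ih =>
    obtain ⟨c, hc⟩ := ih
    refine ⟨(ENNReal.ofReal ((n : ℝ) - α))⁻¹ * c, fun t' ht' => ?_⟩
    obtain ⟨t, ht, s, rfl⟩ := LTree.exists_insertAt_eq (by omega) ht'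
    have h := mul_treeLaw_insertAt hα0 hα1 hγ0 hγα hn ht s
    have h0 : ENNReal.ofReal ((n : ℝ) - α) ≠ 0 := by
      have : (2 : ℝ) ≤ n := by exact_mod_cast hn
      rw [Ne, ENNReal.ofReal_eq_zero]
      linarith
    rw [LTree.gibbsWeight_insertAt hγ (by simp [ht]; omega), mul_assoc, ← mul_assoc c, ← hc t ht,
      ← h, ← mul_assoc, ENNReal.inv_mul_cancel h0 ENNReal.ofReal_ne_top, one_mul]

lemma map_apply_of_injective {X Y : Type*} (p : PMF X) {f : X → Y} (hf : Function.Injective f)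
    (a : X) : p.map f (f a) = p a := by
  classical
  rw [PMF.map_apply, tsum_eq_single a]
  · simp
  · intro b hb
    rw [if_neg fun h => hb (hf h).symm]

lemma exchangeable_of_eq (hα0 : 0 ≤ α) (hα1 : α ≤ 1) (hγ0 : 0 ≤ γ) (hγα : γ ≤ α)
    (hγ : γ = 1 - α) (hn : 1 ≤ n) : Exchangeable n (treeLaw α γ n) := by
  intro σ hσ
  ext t'
  obtain ⟨t, rfl⟩ : ∃ t, LTree.relabel σ t = t' := ⟨_, LTree.relabel_symm σ t'⟩
  rw [map_apply_of_injective _ (LTree.relabel_injective σ)]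
  have himg : (Finset.Icc 1 n).image σ = Finset.Icc 1 n := by
    ext i
    rw [Finset.mem_image]
    constructor
    · rintro ⟨j, hj, rfl⟩
      exact (hσ j).2 hj
    · intro hi
      refine ⟨σ.symm i, ?_, σ.apply_symm_apply i⟩
      rwa [← hσ, σ.apply_symm_apply]
  have hleaves : (LTree.relabel σ t).leaves = Finset.Icc 1 n ↔ t.leaves = Finset.Icc 1 n := by
    change t.leaves.image σ = _ ↔ _
    conv_lhs => rw [← himg]
    exact (LTree.image_perm_injective σ).eq_iff
  by_cases ht : t.leaves = Finset.Icc 1 n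
  · rcases Nat.eq_or_lt_of_le hn with rfl | hn
    · have h1 : ∀ u : LTree, u.leaves = Finset.Icc 1 1 → u = LTree.single 1 := by
        intro u hu
        obtain ⟨i, rfl⟩ := LTree.eq_single_of_card_eq_one (t := u) (by simp [hu])
        have hi : i = 1 := by simpa [LTree.single] using hu
        rw [hi]
      rw [h1 _ (hleaves.2 ht), h1 t ht]
    · obtain ⟨c, hc⟩ := exists_treeLaw_eq hα0 hα1 hγ0 hγα hγ hn
      rw [hc t ht, hc _ (hleaves.2 ht), LTree.gibbsWeight_relabel]
  · have h0 : ∀ u : LTree, u.leaves ≠ Finset.Icc 1 n → treeLaw α γ n u = 0 := by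
      intro u hu
      by_contra h
      exact hu (leaves_of_mem_support_treeLaw hα0 hn ((PMF.mem_support_iff _ _).2 h))
    rw [h0 t ht, h0 _ fun h => ht (hleaves.1 h)]

/-- Exchangeability of the trees with three leaves: the leaf `3` is attached to the root edge with
the same probability as to the leaf `1`. -/
lemma eq_of_exchangeable (hα0 : 0 ≤ α) (hα1 : α ≤ 1) (hγ0 : 0 ≤ γ) (hγα : γ ≤ α)
    (h : Exchangeable 3 (treeLaw α γ 3)) : γ = 1 - α := by
  have hl : cherry.leaves = Finset.Icc 1 2 := by decide
  have h12 : {1, 2} ∈ cherry.nodes := by decide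
  have h1 : {1} ∈ cherry.nodes := by decide
  have hnext := LTree.nextLabel_eq _ _ hl
  set s : cherry.Site := Sum.inl ⟨{1, 2}, h12⟩ with hs
  set s' : cherry.Site := Sum.inl ⟨{1}, h1⟩ with hs'
  have hw : cherry.weight α γ s = γ := by simp [hs, LTree.weight]
  have hw' : cherry.weight α γ s' = 1 - α := by simp [hs', LTree.weight]
  have hrel : LTree.relabel (Equiv.swap 2 3) (cherry.insertAt s) = cherry.insertAt s' := by
    refine LTree.ext ?_ ?_
    · change (insert cherry.nextLabel cherry.leaves).image _ = insert cherry.nextLabel cherry.leaves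
      rw [hnext]
      decide
    · change (insert {1, 2} (insert {cherry.nextLabel}
        (cherry.nodes.image (LTree.lift cherry.nextLabel {1, 2})))).image _ =
        insert {1} (insert {cherry.nextLabel}
          (cherry.nodes.image (LTree.lift cherry.nextLabel {1})))
      rw [hnext]
      decide
  have hperm : ∀ i, Equiv.swap 2 3 i ∈ Finset.Icc 1 3 ↔ i ∈ Finset.Icc 1 3 := by
    intro i
    by_cases h2 : i = 2
    · simp [h2]
    by_cases h3 : i = 3
    · simp [h3]
    rw [Equiv.swap_apply_of_ne_of_ne h2 h3]
  have hex : treeLaw α γ 3 (cherry.insertAt s') = treeLaw α γ 3 (cherry.insertAt s) := by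
    rw [← hrel, ← map_apply_of_injective (treeLaw α γ 3)
      (LTree.relabel_injective (Equiv.swap 2 3)) (cherry.insertAt s), h _ hperm]
  have e1 := mul_treeLaw_insertAt hα0 hα1 hγ0 hγα le_rfl hl s
  have e2 := mul_treeLaw_insertAt hα0 hα1 hγ0 hγα le_rfl hl s'
  rw [hex, e1, hw, hw', treeLaw_two] at e2
  simp only [PMF.pure_apply, if_true, one_mul] at e2
  rwa [ENNReal.ofReal_eq_ofReal_iff hγ0 (by linarith)] at e2

end AlphaGamma

theorem proposition1 (α γ : ℝ) (hα0 : 0 ≤ α) (hα1 : α ≤ 1) (hγ0 : 0 ≤ γ) (hγα : γ ≤ α) :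
    AlphaGamma.MarkovBranching (AlphaGamma.shapeLaw α γ) ∧
    (α < 1 → ∀ n : ℕ, 2 ≤ n → ∃ c : ℝ, 0 < c ∧
      (∑ p : n.Partition with 2 ≤ p.parts.card,
        c * ((γ + (1 - α - γ) * (1 / ((n : ℝ) * ((n : ℝ) - 1))) * AlphaGamma.crossSum p.parts) *
          AlphaGamma.pdSplit α (-α - γ) p.parts)) = 1 ∧
      ∀ p : n.Partition, 2 ≤ p.parts.card →
        (AlphaGamma.splittingRule (AlphaGamma.shapeLaw α γ) n p.parts).toReal =
          c * ((γ + (1 - α - γ) * (1 / ((n : ℝ) * ((n : ℝ) - 1))) * AlphaGamma.crossSum p.parts) *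
            AlphaGamma.pdSplit α (-α - γ) p.parts)) ∧
    ((∀ n : ℕ, 1 ≤ n → AlphaGamma.Exchangeable n (AlphaGamma.treeLaw α γ n)) ↔
      (γ = 1 - α ∧ 1 / 2 ≤ α ∧ α ≤ 1)) := by
  refine ⟨AlphaGamma.markovBranching_shapeLaw hα0 hα1 hγ0 hγα,
    fun hα n hn => AlphaGamma.exists_pos_splittingRule_eq hα0 hα hγ0 hγα hn, fun h => ?_,
    fun h n hn => AlphaGamma.exchangeable_of_eq hα0 hα1 hγ0 hγα h.1 hn⟩
  have hγ := AlphaGamma.eq_of_exchangeable hα0 hα1 hγ0 hγα (h 3 (by norm_num))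
  exact ⟨hγ, by linarith, hα1⟩
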